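/- Let $\kappa>0$, $\lambda\in\mathbb R$, and $I=(\alpha,\beta)$ with $0<\alpha<\theta<\beta<\infty$. Set $w(x)=e^{\lambda\sqrt{1+x^2}}$. Let $L^2_\lambda(\mathbb R)=w\,L^2(\mathbb R)$ and $L^2_\lambda(I\times\mathbb R)=w\,L^2(I\times\mathbb R)$ (complex-valued functions of $x$, respectively of $(\sigma,x)$), normed by $\|f\|=\|w^{-1}f\|_{L^2}$. Let $H^2_\lambda(\mathbb R)$ and $\mathcal K_1:=H^2_\lambda(I\times\mathbb R)$ be the spaces of functions whose weak derivatives of order $\le 2$ all lie in $L^2_\lambda(\mathbb R)$, respectively in $L^2_\lambda(I\times\mathbb R)$, with the norm $\|u\|^2=\sum_{i+j\le 2}\|\partial_\sigma^i\partial_x^j u\|^2_{L^2_\lambda}$ on $\mathcal K_1$. Let $$A=\kappa(\theta-\sigma)\partial_\sigma,\qquad B=\partial_x^2-\partial_x,\qquad L_0=A+\tfrac{\sigma^2}{2}B .$$ The operator $B$ with domain $H^2_\lambda(\mathbb R)$ generates a $c_0$ semigroup $(e^{sB})_{s\ge0}$ on $L^2_\lambda(\mathbb R)$. For $t\ge 0$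 put $$\delta_t(\sigma)=\theta(1-e^{-\kappa t})+\sigma e^{-\kappa t},\qquad (e^{tA}h)(\sigma,x)=h(\delta_t(\sigma),x),$$ $$\mathfrak D(t,\sigma)=\frac{(\theta-\sigma)^2}{4\kappa}\bigl(1-e^{-2\kappa t}\bigr)-\frac{\theta(\theta-\sigma)}{\kappa}\bigl(1-e^{-\kappa t}\bigr)+\frac12\theta^2t ,$$ $$(e^{\mathfrak D(t)B}h)(\sigma,\cdot)=e^{\mathfrak D(t,\sigma)B}\bigl(h(\sigma,\cdot)\bigr)\quad\text{for a.e. }\sigma\in I .$$ These formulas define bounded operators $e^{tA}$ and $e^{\mathfrak D(t)B}$ on $L^2_\lambda(I\times\mathbb R)$, and $S(t):=e^{\mathfrak D(t)B}e^{tA}$, $t\ge0$, is a $c_0$ semigroup on $L^2_\lambda(I\times\mathbb R)$. The domain of its generator contains $\mathcal K_1$, and the generator coincides with $L_0$ on $\mathcal K_1$. Moreover, $S(t)$ maps $\mathcal K_1$ into itself, and its restriction to $\mathcal K_1$ is a $c_0$ semigroup on $\mathcal K_1$. -/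

import Mathlib

open MeasureTheory Filter Topology
open scoped ContDiff

noncomputable section

namespace LambdaSABR

/-! ### Strongly continuous semigroups and their generators -/

section Semigroup

variable {X : Type*} [NormedAddCommGroup X] [NormedSpace ℂ X]

/-- A `c₀` semigroup of bounded operators on `X`. Only the values `S t` with `t ≥ 0` matter. -/
structure IsC0Semigroup (S : ℝ → X →L[ℂ] X) : Prop where
  map_add : ∀ t₁ t₂ : ℝ, 0 ≤ t₁ → 0 ≤ t₂ → S (t₁ + t₂) = (S t₁).comp (S t₂)
  map_zero : S 0 = ContinuousLinearMap.id ℂ X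
  tendsto : ∀ x : X, Tendsto (fun t => S t x) (𝓝[>] 0) (𝓝 x)

/-- `x` lies in the domain of the generator `T` of `S`, and `T x = y`; that is,
`t⁻¹ (S t x - x) → y` as `t ↘ 0`. -/
def GeneratorMapsTo (S : ℝ → X →L[ℂ] X) (x y : X) : Prop :=
  Tendsto (fun t : ℝ => (t : ℂ)⁻¹ • (S t x - x)) (𝓝[>] 0) (𝓝 y)

end Semigroup

/-! ### Exponentially weighted `L²` spaces -/

/-- The density `w(x)⁻²`, where `w(x) = exp (lam * √(1 + x²))`. -/
def weightDensity (lam x : ℝ) : ℝ := Real.exp (-2 * lam * Real.sqrt (1 + x ^ 2))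

/-- The measure `w⁻² dx` on `ℝ`. -/
def weightMeasure (lam : ℝ) : Measure ℝ :=
  volume.withDensity fun x => ENNReal.ofReal (weightDensity lam x)

/-- The measure `w(x)⁻² dσ dx` on `I × ℝ`, `I = (α, β)`; points of `I × ℝ` are pairs `(σ, x)`. -/
def weightMeasure₂ (α β lam : ℝ) : Measure (ℝ × ℝ) :=
  (volume.restrict (Set.Ioo α β)).prod (weightMeasure lam)

/-- `L²_lam(ℝ) = w L²(ℝ)`, with the norm `‖f‖ = ‖w⁻¹ f‖_{L²}`. -/
abbrev L2R (lam : ℝ) : Type := Lp ℂ 2 (weightMeasure lam)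

/-- `L²_lam(I × ℝ) = w L²(I × ℝ)`, `I = (α, β)`, with the norm `‖u‖ = ‖w⁻¹ u‖_{L²}`. -/
abbrev L2IR (α β lam : ℝ) : Type := Lp ℂ 2 (weightMeasure₂ α β lam)

/-! ### Weak derivatives and Sobolev spaces -/

/-- `g` is the weak derivative of order `n` of `f` on `ℝ`. -/
def IsWeakDeriv (n : ℕ) (f g : ℝ → ℂ) : Prop :=
  ∀ φ : ℝ → ℂ, ContDiff ℝ ∞ φ → HasCompactSupport φ →
    ∫ x, f x * iteratedDeriv n φ x = (-1) ^ n * ∫ x, g x * φ x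

/-- The classical derivative `∂_σ` of a function of `(σ, x)`. -/
def dSigma (φ : ℝ × ℝ → ℂ) : ℝ × ℝ → ℂ := fun p => fderiv ℝ φ p (1, 0)

/-- The classical derivative `∂_x` of a function of `(σ, x)`. -/
def dX (φ : ℝ × ℝ → ℂ) : ℝ × ℝ → ℂ := fun p => fderiv ℝ φ p (0, 1)

/-- Test functions on `I × ℝ`, `I = (α, β)`: smooth, with compact support inside `I × ℝ`. -/
structure IsTest (α β : ℝ) (φ : ℝ × ℝ → ℂ) : Prop where
  smooth : ContDiff ℝ ∞ φ
  compact : HasCompactSupport φ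
  support : tsupport φ ⊆ Set.Ioo α β ×ˢ Set.univ

/-- `g = ∂_σ^i ∂_x^j u` weakly on `I × ℝ`, `I = (α, β)`. -/
def IsWeakPDeriv (α β : ℝ) (i j : ℕ) (u g : ℝ × ℝ → ℂ) : Prop :=
  ∀ φ : ℝ × ℝ → ℂ, IsTest α β φ →
    ∫ p in Set.Ioo α β ×ˢ Set.univ, u p * (dSigma^[i] (dX^[j] φ)) p =
      (-1) ^ (i + j) * ∫ p in Set.Ioo α β ×ˢ Set.univ, g p * φ p

/-- The multi-indices `(i, j)` with `i + j ≤ 2`. -/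
abbrev Idx : Type := {a : Fin 3 × Fin 3 // (a.1 : ℕ) + (a.2 : ℕ) ≤ 2}

section Helpers

theorem IsTest.dSigma {α β : ℝ} {φ : ℝ × ℝ → ℂ} (h : IsTest α β φ) :
    IsTest α β (dSigma φ) where
  smooth := (h.smooth.fderiv_right (m := ∞) (by simp)).clm_apply contDiff_const
  compact := h.compact.fderiv_apply (𝕜 := ℝ) _
  support := (tsupport_fderiv_apply_subset ℝ _).trans h.support

theorem IsTest.dX {α β : ℝ} {φ : ℝ × ℝ → ℂ} (h : IsTest α β φ) : IsTest α β (dX φ) where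
  smooth := (h.smooth.fderiv_right (m := ∞) (by simp)).clm_apply contDiff_const
  compact := h.compact.fderiv_apply (𝕜 := ℝ) _
  support := (tsupport_fderiv_apply_subset ℝ _).trans h.support

theorem IsTest.pderiv {α β : ℝ} {φ : ℝ × ℝ → ℂ} (h : IsTest α β φ) (i j : ℕ) :
    IsTest α β (LambdaSABR.dSigma^[i] (LambdaSABR.dX^[j] φ)) := by
  have h1 : IsTest α β (LambdaSABR.dX^[j] φ) := by
    induction j with
    | zero => exact h
    | succ k ih => rw [Function.iterate_succ_apply']; exact ih.dX
  induction i with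
  | zero => exact h1
  | succ k ih => rw [Function.iterate_succ_apply']; exact ih.dSigma

theorem continuous_weightDensity (lam : ℝ) : Continuous (weightDensity lam) := by
  unfold weightDensity; fun_prop

theorem weightMeasure₂_eq (α β lam : ℝ) :
    weightMeasure₂ α β lam = (volume.restrict (Set.Ioo α β ×ˢ Set.univ)).withDensity
      fun p => ENNReal.ofReal (weightDensity lam p.2) := by
  have hm : Measurable fun x => ENNReal.ofReal (weightDensity lam x) :=
    (continuous_weightDensity lam).measurable.ennreal_ofReal
  unfold weightMeasure₂ weightMeasure
  rw [prod_withDensity_right hm, Measure.volume_eq_prod, ← Measure.prod_restrict,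
    Measure.restrict_univ]

theorem integrable_mul_test' {α β lam : ℝ} {u : ℝ × ℝ → ℂ}
    (hu : MemLp u 2 (weightMeasure₂ α β lam)) {φ : ℝ × ℝ → ℂ}
    (h : IsTest α β φ) :
    Integrable (fun p => u p * φ p) (volume.restrict (Set.Ioo α β ×ˢ Set.univ)) := by
  have hw := continuous_weightDensity lam
  have hpos : ∀ x, 0 < weightDensity lam x := fun x => Real.exp_pos _
  have hm : Measurable fun p : ℝ × ℝ => (weightDensity lam p.2).toNNReal :=
    (hw.measurable.comp measurable_snd).real_toNNReal
  have hc : Continuous fun p : ℝ × ℝ => ((weightDensity lam p.2)⁻¹ : ℝ) :=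
    (hw.comp continuous_snd).inv₀ fun p => (hpos p.2).ne'
  -- the pairing partner of `u` in the weighted space
  obtain ⟨ψ, hψ⟩ : ∃ ψ : ℝ × ℝ → ℂ, ψ = fun p => ((weightDensity lam p.2)⁻¹ : ℝ) • φ p := ⟨_, rfl⟩
  have hψc : Continuous ψ := by
    rw [hψ]; exact hc.smul h.smooth.continuous
  have hψs : HasCompactSupport ψ := by
    rw [hψ]; exact h.compact.smul_left (f := fun p : ℝ × ℝ => ((weightDensity lam p.2)⁻¹ : ℝ))
  have hfin : IsFiniteMeasureOnCompacts (weightMeasure₂ α β lam) := by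
    have : IsLocallyFiniteMeasure (weightMeasure lam) :=
      IsLocallyFiniteMeasure.withDensity_ofReal hw
    unfold weightMeasure₂
    infer_instance
  have hψ2 : MemLp ψ 2 (weightMeasure₂ α β lam) := hψc.memLp_of_hasCompactSupport hψs
  have hint : Integrable (fun p => u p * ψ p) (weightMeasure₂ α β lam) :=
    MemLp.integrable_mul (p := 2) (q := 2) hu hψ2
  rw [weightMeasure₂_eq] at hint
  have hint2 := (integrable_withDensity_iff_integrable_smul (E := ℂ) hm
    (μ := volume.restrict (Set.Ioo α β ×ˢ Set.univ)) (g := fun p => u p * ψ p)).1 hint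
  refine hint2.congr (Eventually.of_forall fun p => ?_)
  have hne : ((weightDensity lam p.2 : ℝ) : ℂ) ≠ 0 := by exact_mod_cast (hpos p.2).ne'
  change ((weightDensity lam p.2).toNNReal : ℝ) • (u p * ψ p) = u p * φ p
  have hψp : ψ p = ((weightDensity lam p.2)⁻¹ : ℝ) • φ p := by rw [hψ]
  rw [hψp, Real.coe_toNNReal _ (hpos p.2).le, Complex.real_smul, Complex.real_smul,
    Complex.ofReal_inv, mul_left_comm, mul_inv_cancel_left₀ hne]

theorem integrable_mul_test {α β lam : ℝ} (u : L2IR α β lam) {φ : ℝ × ℝ → ℂ}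
    (h : IsTest α β φ) :
    Integrable (fun p => u p * φ p) (volume.restrict (Set.Ioo α β ×ˢ Set.univ)) :=
  integrable_mul_test' (Lp.memLp u) h

theorem ac_weightMeasure₂ (α β lam : ℝ) :
    volume.restrict (Set.Ioo α β ×ˢ Set.univ) ≪ weightMeasure₂ α β lam := by
  rw [weightMeasure₂_eq]
  refine withDensity_absolutelyContinuous' ?_ ?_
  · exact ((continuous_weightDensity lam).measurable.comp measurable_snd).ennreal_ofReal.aemeasurable
  · exact Eventually.of_forall fun p => by simp [weightDensity, Real.exp_pos]

theorem integral_add_mul {α β lam : ℝ} (u v : L2IR α β lam) {φ : ℝ × ℝ → ℂ}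
    (h : IsTest α β φ) :
    ∫ p in Set.Ioo α β ×ˢ Set.univ, (u + v : L2IR α β lam) p * φ p =
      (∫ p in Set.Ioo α β ×ˢ Set.univ, u p * φ p) +
        ∫ p in Set.Ioo α β ×ˢ Set.univ, v p * φ p := by
  rw [← integral_add (integrable_mul_test u h) (integrable_mul_test v h)]
  refine integral_congr_ae ?_
  filter_upwards [(ac_weightMeasure₂ α β lam).ae_le (Lp.coeFn_add u v)] with p hp
  rw [hp, Pi.add_apply, add_mul]

theorem integral_smul_mul {α β lam : ℝ} (c : ℂ) (u : L2IR α β lam) (φ : ℝ × ℝ → ℂ) :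
    ∫ p in Set.Ioo α β ×ˢ Set.univ, (c • u : L2IR α β lam) p * φ p =
      c * ∫ p in Set.Ioo α β ×ˢ Set.univ, u p * φ p := by
  rw [← integral_const_mul]
  refine integral_congr_ae ?_
  filter_upwards [(ac_weightMeasure₂ α β lam).ae_le (Lp.coeFn_smul c u)] with p hp
  rw [hp, Pi.smul_apply, smul_eq_mul, mul_assoc]

end Helpers

/-- The space `K₁ = H²_lam(I × ℝ)`, `I = (α, β)`, of all `u ∈ L²_lam(I × ℝ)` whose weak
derivatives `∂_σ^i ∂_x^j u`, `i + j ≤ 2`, lie in `L²_lam(I × ℝ)`. Such a `u` is represented by the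
family of these derivatives (which `u`, the entry of index `(0, 0)`, determines), and the norm is
`‖u‖² = ∑ ‖∂_σ^i ∂_x^j u‖²`. -/
def sobolevJets (α β lam : ℝ) : Submodule ℂ (PiLp 2 fun _ : Idx => L2IR α β lam) where
  carrier := {U | ∀ a : Idx, IsWeakPDeriv α β a.1.1 a.1.2 (U ⟨(0, 0), by decide⟩) (U a)}
  add_mem' := by
    intro U V hU hV a φ hφ
    have h1 := hU a φ hφ
    have h2 := hV a φ hφ
    rw [PiLp.add_apply, PiLp.add_apply, integral_add_mul _ _ (hφ.pderiv _ _),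
      integral_add_mul _ _ hφ, h1, h2, mul_add]
  zero_mem' := by
    intro a φ hφ
    have h0 : ∀ ψ : ℝ × ℝ → ℂ,
        ∫ p in Set.Ioo α β ×ˢ Set.univ, (0 : L2IR α β lam) p * ψ p = 0 := by
      intro ψ
      have := integral_smul_mul (0 : ℂ) (0 : L2IR α β lam) ψ
      rwa [zero_smul, zero_mul] at this
    rw [PiLp.zero_apply, PiLp.zero_apply, h0, h0, mul_zero]
  smul_mem' := by
    intro c U hU a φ hφ
    have h1 := hU a φ hφ
    rw [PiLp.smul_apply, PiLp.smul_apply, integral_smul_mul, integral_smul_mul, h1]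
    ring

/-- The Banach space `K₁ = H²_lam(I × ℝ)`. -/
abbrev H2IR (α β lam : ℝ) : Type := sobolevJets α β lam

/-- The weak derivative `∂_σ^i ∂_x^j U`, `i + j ≤ 2`, of an element `U` of `H²_lam(I × ℝ)`. -/
def H2IR.pd {α β lam : ℝ} (U : H2IR α β lam) (i j : Fin 3)
    (h : (i : ℕ) + (j : ℕ) ≤ 2 := by decide) : L2IR α β lam :=
  (U : PiLp 2 fun _ : Idx => L2IR α β lam) ⟨(i, j), h⟩

/-- The inclusion of `H²_lam(I × ℝ)` in `L²_lam(I × ℝ)`. -/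
def H2IR.incl {α β lam : ℝ} (U : H2IR α β lam) : L2IR α β lam := U.pd 0 0

/-! ### The operators -/

/-- `v = B u`, where `B = ∂_x² - ∂_x` is the operator on `L²_lam(ℝ)` with domain `H²_lam(ℝ)`. -/
def BMapsTo {lam : ℝ} (u v : L2R lam) : Prop :=
  ∃ u₁ u₂ : L2R lam, IsWeakDeriv 1 u u₁ ∧ IsWeakDeriv 2 u u₂ ∧ v = u₂ - u₁

/-- `E` is the semigroup `e^{sB}` on `L²_lam(ℝ)`: the `c₀` semigroup whose generator is `B` with
domain exactly `H²_lam(ℝ)`. (A `c₀` semigroup is determined by its generator.) -/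
def IsExpB {lam : ℝ} (E : ℝ → L2R lam →L[ℂ] L2R lam) : Prop :=
  IsC0Semigroup E ∧ ∀ u v : L2R lam, GeneratorMapsTo E u v ↔ BMapsTo u v

/-- `δ_t(σ) = θ (1 - e^{-κt}) + σ e^{-κt}`. -/
def flow (κ θ t σ : ℝ) : ℝ := θ * (1 - Real.exp (-κ * t)) + σ * Real.exp (-κ * t)

/-- `v = e^{tA} u`, where `A = κ (θ - σ) ∂_σ`; that is, `v(σ, x) = u(δ_t(σ), x)`. -/
def IsExpA {α β lam : ℝ} (κ θ t : ℝ) (u v : L2IR α β lam) : Prop :=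
  ∀ᵐ p ∂(weightMeasure₂ α β lam), v p = u (flow κ θ t p.1, p.2)

/-- `v = e^{pB} u` for a function `p ≥ 0` on `I = (α, β)`, when `E s = e^{sB}`; that is,
`v(σ, ·) = e^{p(σ)B} u(σ, ·)` in `L²_lam(ℝ)` for almost every `σ ∈ I`. -/
def IsExpFamilyB {α β lam : ℝ} (E : ℝ → L2R lam →L[ℂ] L2R lam) (p : ℝ → ℝ)
    (u v : L2IR α β lam) : Prop :=
  ∀ᵐ σ ∂(volume.restrict (Set.Ioo α β)), ∃ f g : L2R lam,
    (f =ᵐ[weightMeasure lam] fun x => u (σ, x)) ∧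
    (g =ᵐ[weightMeasure lam] fun x => v (σ, x)) ∧ g = E (p σ) f

/-- The function `𝔇(t, σ)`. -/
def frakD (κ θ t σ : ℝ) : ℝ :=
  (θ - σ) ^ 2 / (4 * κ) * (1 - Real.exp (-2 * κ * t))
    - θ * (θ - σ) / κ * (1 - Real.exp (-κ * t)) + 1 / 2 * θ ^ 2 * t

/-- `v = L₀ U`, where `L₀ = A + (σ²/2) B = κ (θ - σ) ∂_σ + (σ²/2) (∂_x² - ∂_x)`, for
`U ∈ H²_lam(I × ℝ)`. -/
def L0MapsTo {α β lam : ℝ} (κ θ : ℝ) (U : H2IR α β lam) (v : L2IR α β lam) : Prop :=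
  ∀ᵐ p ∂(weightMeasure₂ α β lam),
    v p = (κ * (θ - p.1) : ℝ) * (U.pd 1 0) p + (p.1 ^ 2 / 2 : ℝ) * ((U.pd 0 2) p - (U.pd 0 1) p)

end LambdaSABR

end

/-!
All the operators involved are averages of weighted composition operators
`f ↦ (p ↦ ∫ ρ(p, z) f(Φ(p, z)) dν(z))` over a probability space. Indeed `e^{sB}`, for `B = ∂_x² - ∂_x`, is the
convolution with the normal law of mean `s` and variance `2s`: with a standard normal variable `z`,
`(e^{sB} f)(x) = E f(x - s - √(2s) z)`. Hence `S(t) = e^{𝔇(t)B} e^{tA}` averages `u` along the maps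
`(σ, x) ↦ (δ_t(σ), x - 𝔇(t, σ) - √(2 𝔇(t, σ)) z)`. A shift of `x` by `c` changes the weight by a
factor of at most `exp (2 |lam| |c|)`, which has finite Gaussian mean, so Jensen's inequality
bounds such averages on the weighted `L²` spaces (`IsAveraging.exists_clm`). By approximation with
continuous functions of compact support and dominated convergence, they converge strongly as soon
as the maps tend to the identity and the coefficients converge pointwise, under uniform bounds
(`tendsto_averaging`). This one limit theorem gives every strong limit below.

*The semigroup on the line.* The semigroup law is the additivity of the variances of independent
normal variables (`integral_gauss_gauss`), and on `H²_lam(ℝ)` the generator is found by averaging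
Taylor's formula with integral remainder (`generatorMapsTo_of_BMapsTo`). That no other function
belongs to the domain follows by smoothing: Gaussian integration by parts shows that `e^{εB} u`
lies in `H²_lam(ℝ)`; Taylor's formula for one small step bounds `u'` by `u` and `B u`
(`exists_deriv_eq`), so for `u` in the domain the derivatives of `e^{εB} u` converge as `ε ↘ 0`,
and weak derivatives are closed.

*The semigroup on the strip.* Since `𝔇(t, σ) = ½ ∫₀ᵗ δ_s(σ)² ds`, one has `0 < 𝔇(t, σ)` for `t > 0`
and the cocycle identity `𝔇(s + t, σ) = 𝔇(s, σ) + 𝔇(t, δ_s(σ))` (`frakD_add`). The latter, with the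
additivity of variances, is the semigroup law of `S`. On `K₁` the difference `S(t) u - u` is
expanded to first order along the flow `δ`, in terms of `∂_σ u`, and to second order in `x`
(`expFamilyB_expA_sub_eq`). Divided by `t`, its three terms are again averages of the above kind,
and `𝔇(t, σ) / t → σ² / 2` yields `L₀ u`. The two versions of the fundamental theorem of calculus
for weak derivatives that this needs (`comp_shear_sub_eq`, `comp_contraction_sub_eq`) are obtained
by moving the maps onto test functions.

*The restriction to `K₁`.* For `t > 0` the displacement `𝔇 + √(2𝔇) z` is smooth in `σ`, as `𝔇` is
positive, and the chain rule expresses the derivatives of `S(t) u` of order at most two by averages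
of the derivatives of `u` (`IsJetOperators`). The new coefficients are the `σ`-derivatives of the
displacement, of order `√t` as `t ↘ 0` (`exists_drift_bound`). So the operators on the jets are
bounded and converge strongly to the identity.
-/

open scoped ENNReal

namespace LambdaSABR

open ProbabilityTheory

/-! ### Averages of weighted composition operators on `L²` -/

section Averaging

variable {P Z : Type*} [MeasurableSpace P] [MeasurableSpace Z]

/-- The data of an averaged weighted composition operator
`f ↦ ∫ ρ(p, z) f(Φ(p, z)) dν(z)` on `L²(μ)`. The coefficient `ρ` is dominated by a function `R` of
`z` alone, and `Φ(·, z)` inflates `μ` at most by the factor `C z`; the operator is bounded as soon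
as `R² C` is `ν`-integrable. Requiring `1 ≤ C` costs nothing and makes `R²` integrable as well. -/
structure IsAveraging (μ : Measure P) (ν : Measure Z) (ρ : P → Z → ℝ) (Φ : P → Z → P)
    (R C : Z → ℝ) : Prop where
  measurable_coeff : Measurable (Function.uncurry ρ)
  measurable_map : Measurable (Function.uncurry Φ)
  measurable_R : Measurable R
  measurable_C : Measurable C
  abs_le : ∀ᵐ p ∂μ, ∀ z, |ρ p z| ≤ R z
  map_le : ∀ z, μ.map (fun p => Φ p z) ≤ ENNReal.ofReal (C z) • μ
  one_le : ∀ z, 1 ≤ C z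
  integrable : Integrable (fun z => R z ^ 2 * C z) ν

theorem eLpNorm_two_sq (μ : Measure P) (f : P → ℂ) :
    eLpNorm f 2 μ ^ 2 = ∫⁻ p, ‖f p‖ₑ ^ 2 ∂μ := by
  have := eLpNorm_nnreal_pow_eq_lintegral (μ := μ) (f := f) (p := 2) (by norm_num)
  simpa using this

theorem lintegral_enorm_sq_lt_top {μ : Measure P} {f : P → ℂ} (hf : MemLp f 2 μ) :
    ∫⁻ p, ‖f p‖ₑ ^ 2 ∂μ < ⊤ := by
  rw [← eLpNorm_two_sq]
  exact ENNReal.pow_lt_top hf.2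

theorem memLp_two_of_lintegral {μ : Measure P} {f : P → ℂ} (hm : AEStronglyMeasurable f μ)
    (hf : ∫⁻ p, ‖f p‖ₑ ^ 2 ∂μ < ⊤) : MemLp f 2 μ := by
  refine ⟨hm, ?_⟩
  rw [← eLpNorm_two_sq] at hf
  by_contra h
  rw [not_lt, top_le_iff] at h
  simp [h] at hf

theorem add_sq_le_enorm (a b : ℂ) : ‖a + b‖ₑ ^ 2 ≤ 2 * (‖a‖ₑ ^ 2 + ‖b‖ₑ ^ 2) := by
  have h : ‖a + b‖₊ ^ 2 ≤ 2 * (‖a‖₊ ^ 2 + ‖b‖₊ ^ 2) := by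
    rw [← NNReal.coe_le_coe]
    push_cast
    have := norm_add_le a b
    nlinarith [norm_nonneg (a + b), sq_nonneg (‖a‖ - ‖b‖)]
  simp only [enorm_eq_nnnorm]
  exact_mod_cast h

theorem enorm_sq_real_smul (r : ℝ) (a : ℂ) :
    ‖r • a‖ₑ ^ 2 = ENNReal.ofReal (r ^ 2) * ‖a‖ₑ ^ 2 := by
  rw [enorm_smul, mul_pow, Real.enorm_eq_ofReal_abs, ← ENNReal.ofReal_pow (abs_nonneg _), sq_abs]

/-- The average over a probability measure does not increase the square. -/
theorem enorm_integral_sq_le (ν : Measure Z) [IsProbabilityMeasure ν] (g : Z → ℂ) :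
    ‖∫ z, g z ∂ν‖ₑ ^ 2 ≤ ∫⁻ z, ‖g z‖ₑ ^ 2 ∂ν := by
  by_cases hg : AEStronglyMeasurable g ν
  · have h1 : ‖∫ z, g z ∂ν‖ₑ ≤ eLpNorm g 2 ν := by
      refine (enorm_integral_le_lintegral_enorm g).trans ?_
      rw [← eLpNorm_one_eq_lintegral_enorm]
      exact eLpNorm_le_eLpNorm_of_exponent_le (by norm_num) hg
    rw [← eLpNorm_two_sq]
    gcongr
  · rw [integral_non_aestronglyMeasurable hg]
    simp

namespace IsAveraging

variable {μ : Measure P} {ν : Measure Z} {ρ : P → Z → ℝ} {Φ : P → Z → P} {R C : Z → ℝ}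

theorem measurable_map_left (h : IsAveraging μ ν ρ Φ R C) (z : Z) : Measurable fun p => Φ p z :=
  h.measurable_map.comp (measurable_id.prodMk measurable_const)

theorem measurable_coeff_left (h : IsAveraging μ ν ρ Φ R C) (z : Z) : Measurable fun p => ρ p z :=
  h.measurable_coeff.comp (measurable_id.prodMk measurable_const)

theorem lintegral_comp_le (h : IsAveraging μ ν ρ Φ R C) (z : Z) {F : P → ℝ≥0∞}
    (hF : Measurable F) :
    ∫⁻ p, F (Φ p z) ∂μ ≤ ENNReal.ofReal (C z) * ∫⁻ p, F p ∂μ := by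
  rw [← lintegral_map hF (h.measurable_map_left z), ← smul_eq_mul, ← lintegral_smul_measure]
  exact lintegral_mono' (h.map_le z) le_rfl

theorem quasiMeasurePreserving_left (h : IsAveraging μ ν ρ Φ R C) (z : Z) :
    Measure.QuasiMeasurePreserving (fun p => Φ p z) μ μ :=
  ⟨h.measurable_map_left z,
    ((h.map_le z).absolutelyContinuous).trans Measure.smul_absolutelyContinuous⟩

theorem quasiMeasurePreserving [SFinite μ] [SFinite ν] (h : IsAveraging μ ν ρ Φ R C) :
    Measure.QuasiMeasurePreserving (fun q : P × Z => Φ q.1 q.2) (μ.prod ν) μ := by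
  refine ⟨h.measurable_map, Measure.AbsolutelyContinuous.mk fun s hs h0 => ?_⟩
  have hm : Measurable fun q : P × Z => Φ q.1 q.2 := h.measurable_map
  rw [Measure.map_apply hm hs, Measure.prod_apply_symm (hm hs)]
  refine (lintegral_congr fun z => ?_).trans lintegral_zero
  exact (h.quasiMeasurePreserving_left z).preimage_null h0

/-- The averages over `z` of functions which agree almost everywhere agree almost everywhere. -/
theorem ae_comp [SFinite μ] [SFinite ν] (h : IsAveraging μ ν ρ Φ R C) {q : P → Prop}
    (hq : ∀ᵐ p ∂μ, q p) : ∀ᵐ p ∂μ, ∀ᵐ z ∂ν, q (Φ p z) :=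
  Measure.ae_ae_of_ae_prod (h.quasiMeasurePreserving.ae hq)

theorem lintegral_left_le (h : IsAveraging μ ν ρ Φ R C) {f : P → ℂ} (hf : Measurable f) (z : Z) :
    ∫⁻ p, ‖ρ p z • f (Φ p z)‖ₑ ^ 2 ∂μ ≤
      ENNReal.ofReal (R z ^ 2 * C z) * ∫⁻ p, ‖f p‖ₑ ^ 2 ∂μ := by
  calc ∫⁻ p, ‖ρ p z • f (Φ p z)‖ₑ ^ 2 ∂μ
      ≤ ∫⁻ p, ENNReal.ofReal (R z ^ 2) * ‖f (Φ p z)‖ₑ ^ 2 ∂μ := by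
        refine lintegral_mono_ae ?_
        filter_upwards [h.abs_le] with p hp
        rw [enorm_sq_real_smul]
        gcongr ENNReal.ofReal ?_ * _
        exact sq_le_sq.2 ((hp z).trans (le_abs_self _))
    _ = ENNReal.ofReal (R z ^ 2) * ∫⁻ p, ‖f (Φ p z)‖ₑ ^ 2 ∂μ :=
        lintegral_const_mul _ ((hf.comp (h.measurable_map_left z)).enorm.pow_const 2)
    _ ≤ _ := by
        rw [ENNReal.ofReal_mul (sq_nonneg _), mul_assoc]
        gcongr
        exact h.lintegral_comp_le z (F := fun p => ‖f p‖ₑ ^ 2) (hf.enorm.pow_const 2)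

theorem measurable_prod (h : IsAveraging μ ν ρ Φ R C) {f : P → ℂ} (hf : Measurable f) :
    Measurable fun q : P × Z => ρ q.1 q.2 • f (Φ q.1 q.2) :=
  h.measurable_coeff.smul (hf.comp h.measurable_map)

theorem nonneg (h : IsAveraging μ ν ρ Φ R C) (z : Z) : 0 ≤ R z ^ 2 * C z :=
  mul_nonneg (sq_nonneg _) (zero_le_one.trans (h.one_le z))

theorem lintegral_prod_le [SFinite μ] [SFinite ν] (h : IsAveraging μ ν ρ Φ R C) {f : P → ℂ}
    (hf : Measurable f) :
    ∫⁻ q, ‖ρ q.1 q.2 • f (Φ q.1 q.2)‖ₑ ^ 2 ∂(μ.prod ν) ≤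
      ENNReal.ofReal (∫ z, R z ^ 2 * C z ∂ν) * ∫⁻ p, ‖f p‖ₑ ^ 2 ∂μ := by
  rw [lintegral_prod_symm _ ((h.measurable_prod hf).enorm.pow_const 2).aemeasurable,
    ofReal_integral_eq_lintegral_ofReal h.integrable (Eventually.of_forall h.nonneg),
    ← lintegral_mul_const _
      (show Measurable fun z => ENNReal.ofReal (R z ^ 2 * C z) from
        ((h.measurable_R.pow_const 2).mul h.measurable_C).ennreal_ofReal)]
  exact lintegral_mono fun z => h.lintegral_left_le hf z

theorem memLp_prod [SFinite μ] [SFinite ν] (h : IsAveraging μ ν ρ Φ R C) {f : P → ℂ}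
    (hf : Measurable f) (hf2 : MemLp f 2 μ) :
    MemLp (fun q : P × Z => ρ q.1 q.2 • f (Φ q.1 q.2)) 2 (μ.prod ν) :=
  memLp_two_of_lintegral (h.measurable_prod hf).aestronglyMeasurable
    ((h.lintegral_prod_le hf).trans_lt
      (ENNReal.mul_lt_top ENNReal.ofReal_lt_top (lintegral_enorm_sq_lt_top hf2)))

/-- For almost every `p` the average defining the operator converges. -/
theorem ae_integrable [SFinite μ] [IsProbabilityMeasure ν] (h : IsAveraging μ ν ρ Φ R C)
    {f : P → ℂ} (hf : Measurable f) (hf2 : MemLp f 2 μ) :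
    ∀ᵐ p ∂μ, Integrable (fun z => ρ p z • f (Φ p z)) ν := by
  have h1 := (lintegral_enorm_sq_lt_top (h.memLp_prod hf hf2))
  rw [lintegral_prod _ ((h.measurable_prod hf).enorm.pow_const 2).aemeasurable] at h1
  have h2 := ae_lt_top'
    (((h.measurable_prod hf).enorm.pow_const 2).lintegral_prod_right').aemeasurable h1.ne
  filter_upwards [h2] with p hp
  exact (memLp_two_of_lintegral (((h.measurable_prod hf).comp
    measurable_prodMk_left).aestronglyMeasurable) hp).integrable (by norm_num)

theorem measurable_integral [SFinite ν] (h : IsAveraging μ ν ρ Φ R C) {f : P → ℂ}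
    (hf : Measurable f) : Measurable fun p => ∫ z, ρ p z • f (Φ p z) ∂ν :=
  ((h.measurable_prod hf).stronglyMeasurable.integral_prod_right').measurable

theorem lintegral_integral_le [SFinite μ] [IsProbabilityMeasure ν] (h : IsAveraging μ ν ρ Φ R C)
    {f : P → ℂ} (hf : Measurable f) :
    ∫⁻ p, ‖∫ z, ρ p z • f (Φ p z) ∂ν‖ₑ ^ 2 ∂μ ≤
      ENNReal.ofReal (∫ z, R z ^ 2 * C z ∂ν) * ∫⁻ p, ‖f p‖ₑ ^ 2 ∂μ := by
  refine le_trans ?_ (h.lintegral_prod_le hf)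
  rw [lintegral_prod _ ((h.measurable_prod hf).enorm.pow_const 2).aemeasurable]
  exact lintegral_mono fun p => enorm_integral_sq_le ν _

theorem memLp_integral [SFinite μ] [IsProbabilityMeasure ν] (h : IsAveraging μ ν ρ Φ R C)
    {f : P → ℂ} (hf : Measurable f) (hf2 : MemLp f 2 μ) :
    MemLp (fun p => ∫ z, ρ p z • f (Φ p z) ∂ν) 2 μ :=
  memLp_two_of_lintegral (h.measurable_integral hf).aestronglyMeasurable
    ((h.lintegral_integral_le hf).trans_lt
      (ENNReal.mul_lt_top ENNReal.ofReal_lt_top (lintegral_enorm_sq_lt_top hf2)))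

/-- The bounded operator on `L²(μ)` attached to averaging data. -/
theorem exists_clm [SFinite μ] [IsProbabilityMeasure ν] (h : IsAveraging μ ν ρ Φ R C) :
    ∃ T : Lp ℂ 2 μ →L[ℂ] Lp ℂ 2 μ,
      (∀ f, T f =ᵐ[μ] fun p => ∫ z, ρ p z • f (Φ p z) ∂ν) ∧
      ∀ f, ‖T f‖ ≤ Real.sqrt (∫ z, R z ^ 2 * C z ∂ν) * ‖f‖ := by
  have hmeas : ∀ f : Lp ℂ 2 μ, Measurable f := fun f => (Lp.stronglyMeasurable f).measurable
  let T₀ : Lp ℂ 2 μ →ₗ[ℂ] Lp ℂ 2 μ :=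
    { toFun := fun f => (h.memLp_integral (hmeas f) (Lp.memLp f)).toLp _
      map_add' := by
        intro f g
        apply Lp.ext
        refine (MemLp.coeFn_toLp _).trans ?_
        refine EventuallyEq.trans ?_ (Lp.coeFn_add _ _).symm
        filter_upwards [h.ae_comp (Lp.coeFn_add f g), h.ae_integrable (hmeas f) (Lp.memLp f),
          h.ae_integrable (hmeas g) (Lp.memLp g),
          (h.memLp_integral (hmeas f) (Lp.memLp f)).coeFn_toLp,
          (h.memLp_integral (hmeas g) (Lp.memLp g)).coeFn_toLp] with p h1 h2 h3 h4 h5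
        rw [Pi.add_apply, h4, h5, ← integral_add h2 h3]
        refine integral_congr_ae ?_
        filter_upwards [h1] with z hz
        rw [hz, Pi.add_apply, smul_add]
      map_smul' := by
        intro c f
        apply Lp.ext
        refine (MemLp.coeFn_toLp _).trans ?_
        refine EventuallyEq.trans ?_ (Lp.coeFn_smul _ _).symm
        filter_upwards [h.ae_comp (Lp.coeFn_smul c f),
          (h.memLp_integral (hmeas f) (Lp.memLp f)).coeFn_toLp] with p h1 h4
        rw [Pi.smul_apply, RingHom.id_apply, h4, ← integral_smul]
        refine integral_congr_ae ?_
        filter_upwards [h1] with z hz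
        rw [hz, Pi.smul_apply, smul_comm] }
  have hT : ∀ f, T₀ f =ᵐ[μ] fun p => ∫ z, ρ p z • f (Φ p z) ∂ν := fun f =>
    MemLp.coeFn_toLp (h.memLp_integral (hmeas f) (Lp.memLp f))
  have hb : ∀ f, ‖T₀ f‖ ≤ Real.sqrt (∫ z, R z ^ 2 * C z ∂ν) * ‖f‖ := by
    intro f
    have hI : 0 ≤ ∫ z, R z ^ 2 * C z ∂ν := integral_nonneg h.nonneg
    have h1 : ‖T₀ f‖ₑ ^ 2 ≤ ENNReal.ofReal (∫ z, R z ^ 2 * C z ∂ν) * ‖f‖ₑ ^ 2 := by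
      rw [Lp.enorm_def, Lp.enorm_def, eLpNorm_two_sq, eLpNorm_two_sq]
      refine le_trans (le_of_eq ?_) (h.lintegral_integral_le (hmeas f))
      refine lintegral_congr_ae ?_
      filter_upwards [hT f] with p hp
      rw [hp]
    rw [← ofReal_norm, ← ofReal_norm, ← ENNReal.ofReal_pow (norm_nonneg _),
      ← ENNReal.ofReal_pow (norm_nonneg _), ← ENNReal.ofReal_mul hI,
      ENNReal.ofReal_le_ofReal_iff (by positivity)] at h1
    refine le_of_sq_le_sq ?_ (by positivity)
    rwa [mul_pow, Real.sq_sqrt hI]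
  exact ⟨T₀.mkContinuous _ hb, hT, hb⟩

/-- Multiplication by `∫ ρ(p, z) dν(z)`, as an averaging operator with trivial maps. -/
theorem of_coeff (h : IsAveraging μ ν ρ Φ R C) :
    IsAveraging μ ν ρ (fun p _ => p) R C where
  measurable_coeff := h.measurable_coeff
  measurable_map := measurable_fst
  measurable_R := h.measurable_R
  measurable_C := h.measurable_C
  abs_le := h.abs_le
  map_le z := by
    rw [Measure.map_id']
    refine Measure.le_intro fun s _ _ => ?_
    rw [Measure.smul_apply, smul_eq_mul]
    exact le_mul_of_one_le_left' (by simpa using h.one_le z)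
  one_le := h.one_le
  integrable := h.integrable

/-- The pairing of the integrand of an averaging operator with a function of `L²(μ)`. -/
theorem integrable_mul [SFinite μ] [IsProbabilityMeasure ν] (h : IsAveraging μ ν ρ Φ R C)
    {f ψ : P → ℂ} (hf : Measurable f) (hf2 : MemLp f 2 μ) (hψ : MemLp ψ 2 μ) :
    Integrable (fun q : P × Z => ρ q.1 q.2 • f (Φ q.1 q.2) * ψ q.1) (μ.prod ν) :=
  MemLp.integrable_mul (p := 2) (q := 2) (h.memLp_prod hf hf2) (hψ.comp_fst ν)

end IsAveraging

/-! ### Limits of averaging operators -/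

section Limit

variable [MetricSpace P] [ProperSpace P] [BorelSpace P] {μ : Measure P} [μ.Regular]
  {ι : Type*} {l : Filter ι}

/-- Composition with maps close to the identity is close to the identity, on continuous functions
of compact support. -/
theorem tendsto_lintegral_comp_sub_of_hasCompactSupport {Φ : ι → P → P} {η : ι → ℝ} {g : P → ℂ}
    (hη : Tendsto η l (𝓝 0)) (hd : ∀ᶠ t in l, ∀ᵐ p ∂μ, dist (Φ t p) p ≤ η t)
    (hg : Continuous g) (hgs : HasCompactSupport g) :
    Tendsto (fun t => ∫⁻ p, ‖g (Φ t p) - g p‖ₑ ^ 2 ∂μ) l (𝓝 0) := by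
  obtain ⟨M, hM⟩ := hg.bounded_above_of_compact_support hgs
  have hu : UniformContinuous g := hgs.uniformContinuous_of_continuous hg
  have hK : IsCompact (Metric.cthickening 1 (tsupport g)) := hgs.cthickening
  set K := Metric.cthickening 1 (tsupport g) with hKdef
  rw [ENNReal.tendsto_nhds_zero]
  intro ε hε
  have hμK : μ K < ⊤ := hK.measure_lt_top
  obtain ⟨δ, hδ, hδε⟩ : ∃ δ : ℝ, 0 < δ ∧ ENNReal.ofReal δ ^ 2 * μ K ≤ ε := by
    have : Tendsto (fun δ : ℝ => ENNReal.ofReal δ ^ 2 * μ K) (𝓝[>] 0) (𝓝 0) := by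
      have h1 : Tendsto (fun δ : ℝ => ENNReal.ofReal δ ^ 2) (𝓝[>] 0) (𝓝 0) := by
        have : Continuous fun δ : ℝ => ENNReal.ofReal δ ^ 2 :=
          (ENNReal.continuous_pow 2).comp ENNReal.continuous_ofReal
        have h := this.tendsto 0
        simp only [ENNReal.ofReal_zero, ne_eq, OfNat.ofNat_ne_zero, not_false_eq_true,
          zero_pow] at h
        exact h.mono_left nhdsWithin_le_nhds
      simpa using ENNReal.Tendsto.mul_const h1 (Or.inr hμK.ne)
    have h2 := (ENNReal.tendsto_nhds_zero.1 this ε hε).and self_mem_nhdsWithin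
    obtain ⟨δ, h3, h4⟩ := h2.exists
    exact ⟨δ, h4, h3⟩
  obtain ⟨r, hr, hru⟩ := Metric.uniformContinuous_iff.1 hu δ hδ
  filter_upwards [hd, hη.eventually (gt_mem_nhds hr), hη.eventually (ge_mem_nhds one_pos)]
    with t ht h1 h2
  calc ∫⁻ p, ‖g (Φ t p) - g p‖ₑ ^ 2 ∂μ
      ≤ ∫⁻ p, K.indicator (fun _ => ENNReal.ofReal δ ^ 2) p ∂μ := by
        refine lintegral_mono_ae ?_
        filter_upwards [ht] with p hp
        by_cases hpK : p ∈ K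
        · rw [Set.indicator_of_mem hpK]
          gcongr
          rw [← ofReal_norm, ← dist_eq_norm]
          exact ENNReal.ofReal_le_ofReal (hru (hp.trans_lt h1)).le
        · have h3 : p ∉ tsupport g := fun h => hpK (Metric.self_subset_cthickening _ h)
          have h4 : Φ t p ∉ tsupport g := fun h => hpK <|
            Metric.mem_cthickening_of_dist_le p (Φ t p) 1 _ h
              (by rw [dist_comm]; exact hp.trans h2)
          rw [image_eq_zero_of_notMem_tsupport h3, image_eq_zero_of_notMem_tsupport h4]
          simp
    _ = ENNReal.ofReal δ ^ 2 * μ K := lintegral_indicator_const hK.measurableSet _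
    _ ≤ ε := hδε

/-- Composition with maps which inflate the measure at most by a fixed factor and converge to the
identity, converges strongly to the identity of `L²(μ)`. -/
theorem tendsto_lintegral_comp_sub {Φ : ι → P → P} {η : ι → ℝ} {c : ℝ} {f : P → ℂ}
    (hΦ : ∀ᶠ t in l, Measurable (Φ t)) (hη : Tendsto η l (𝓝 0))
    (hd : ∀ᶠ t in l, ∀ᵐ p ∂μ, dist (Φ t p) p ≤ η t)
    (hc : ∀ᶠ t in l, μ.map (Φ t) ≤ ENNReal.ofReal c • μ)
    (hf : Measurable f) (hf2 : MemLp f 2 μ) :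
    Tendsto (fun t => ∫⁻ p, ‖f (Φ t p) - f p‖ₑ ^ 2 ∂μ) l (𝓝 0) := by
  rw [ENNReal.tendsto_nhds_zero]
  intro ε hε
  -- a tolerance `e` with `4 (c + 1) e² ≤ ε / 2`
  obtain ⟨e, he, hee⟩ : ∃ e : ℝ≥0∞, e ≠ 0 ∧ 4 * (ENNReal.ofReal c + 1) * e ^ 2 ≤ ε / 2 := by
    have h0 : (0 : ℝ≥0∞) < ε / 2 := ENNReal.half_pos hε.ne'
    have h1 : Tendsto (fun e : ℝ≥0∞ => 4 * (ENNReal.ofReal c + 1) * e ^ 2) (𝓝[>] 0) (𝓝 0) := by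
      have h2 : Tendsto (fun e : ℝ≥0∞ => e ^ 2) (𝓝[>] 0) (𝓝 0) := by
        have h := (ENNReal.continuous_pow 2).tendsto 0
        simp only [ne_eq, OfNat.ofNat_ne_zero, not_false_eq_true, zero_pow] at h
        exact h.mono_left nhdsWithin_le_nhds
      have h3 : 4 * (ENNReal.ofReal c + 1) ≠ ⊤ := by finiteness
      simpa using ENNReal.Tendsto.const_mul h2 (Or.inr h3)
    have h2 := (ENNReal.tendsto_nhds_zero.1 h1 _ h0).and self_mem_nhdsWithin
    obtain ⟨e, h3, h4⟩ := h2.exists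
    exact ⟨e, (Set.mem_Ioi.1 h4).ne', h3⟩
  obtain ⟨g, hgs, hfg, hg, hg2⟩ := hf2.exists_hasCompactSupport_eLpNorm_sub_le (by norm_num) he
  have hfg2 : ∫⁻ p, ‖f p - g p‖ₑ ^ 2 ∂μ ≤ e ^ 2 := by
    have := eLpNorm_two_sq μ (f - g)
    simp only [Pi.sub_apply] at this
    rw [← this]
    gcongr
  have hlim := tendsto_lintegral_comp_sub_of_hasCompactSupport (μ := μ) hη hd hg hgs
  have hlim2 : Tendsto (fun t => 2 * ∫⁻ p, ‖g (Φ t p) - g p‖ₑ ^ 2 ∂μ) l (𝓝 0) := by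
    simpa using ENNReal.Tendsto.const_mul hlim (Or.inr (by norm_num : (2 : ℝ≥0∞) ≠ ⊤))
  filter_upwards [ENNReal.tendsto_nhds_zero.1 hlim2 _ (ENNReal.half_pos hε.ne'), hc, hΦ]
    with t ht hct hΦt
  have hm : Measurable fun p => ‖f p - g p‖ₑ ^ 2 := (hf.sub hg.measurable).enorm.pow_const 2
  have hcomp : ∫⁻ p, ‖f (Φ t p) - g (Φ t p)‖ₑ ^ 2 ∂μ ≤ ENNReal.ofReal c * e ^ 2 := by
    have h1 : ∫⁻ p, ‖f (Φ t p) - g (Φ t p)‖ₑ ^ 2 ∂μ ≤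
        ENNReal.ofReal c * ∫⁻ p, ‖f p - g p‖ₑ ^ 2 ∂μ := by
      rw [← lintegral_map (f := fun p => ‖f p - g p‖ₑ ^ 2) hm hΦt, ← smul_eq_mul,
        ← lintegral_smul_measure]
      exact lintegral_mono' hct le_rfl
    exact h1.trans (by gcongr)
  have hmg : Measurable fun p => ‖g (Φ t p) - g p‖ₑ ^ 2 :=
    ((hg.measurable.comp hΦt).sub hg.measurable).enorm.pow_const 2
  calc ∫⁻ p, ‖f (Φ t p) - f p‖ₑ ^ 2 ∂μ
      ≤ ∫⁻ p, (2 * ‖g (Φ t p) - g p‖ₑ ^ 2 +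
          (4 * ‖f (Φ t p) - g (Φ t p)‖ₑ ^ 2 + 4 * ‖f p - g p‖ₑ ^ 2)) ∂μ := by
        refine lintegral_mono fun p => ?_
        have e1 : f (Φ t p) - f p =
            (g (Φ t p) - g p) + ((f (Φ t p) - g (Φ t p)) + -(f p - g p)) := by ring
        have e2 := add_sq_le_enorm (g (Φ t p) - g p) ((f (Φ t p) - g (Φ t p)) + -(f p - g p))
        have e3 := add_sq_le_enorm (f (Φ t p) - g (Φ t p)) (-(f p - g p))
        rw [enorm_neg] at e3
        rw [e1]
        refine e2.trans ?_
        calc _ ≤ 2 * (‖g (Φ t p) - g p‖ₑ ^ 2 +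
            2 * (‖f (Φ t p) - g (Φ t p)‖ₑ ^ 2 + ‖f p - g p‖ₑ ^ 2)) := by gcongr
          _ = _ := by ring
    _ = 2 * ∫⁻ p, ‖g (Φ t p) - g p‖ₑ ^ 2 ∂μ +
          (4 * ∫⁻ p, ‖f (Φ t p) - g (Φ t p)‖ₑ ^ 2 ∂μ + 4 * ∫⁻ p, ‖f p - g p‖ₑ ^ 2 ∂μ) := by
        rw [lintegral_add_left (hmg.const_mul 2), lintegral_const_mul _ hmg,
          lintegral_add_right _ (hm.const_mul 4), lintegral_const_mul _ hm,
          lintegral_const_mul (f := fun p => ‖f (Φ t p) - g (Φ t p)‖ₑ ^ 2) _ (hm.comp hΦt)]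
    _ ≤ ε / 2 + (4 * (ENNReal.ofReal c * e ^ 2) + 4 * e ^ 2) := by gcongr
    _ = ε / 2 + 4 * (ENNReal.ofReal c + 1) * e ^ 2 := by ring
    _ ≤ ε / 2 + ε / 2 := by gcongr
    _ = ε := ENNReal.add_halves ε

variable [SFinite μ] {ν : Measure Z} [IsProbabilityMeasure ν]
  [l.IsCountablyGenerated] [l.NeBot]

/-- Strong convergence of averaging operators: if the maps tend to the identity and the
coefficients `ρ t` tend to `ρ₀`, under uniform bounds, then the operators tend strongly to the
multiplication by `∫ ρ₀(p, z) dν(z)`. -/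
theorem tendsto_averaging {ρ : ι → P → Z → ℝ} {Φ : ι → P → Z → P} {R C : Z → ℝ}
    {ρ₀ : P → Z → ℝ} {η : ι → Z → ℝ}
    (h : ∀ᶠ t in l, IsAveraging μ ν (ρ t) (Φ t) R C)
    (hη : ∀ z, Tendsto (fun t => η t z) l (𝓝 0))
    (hd : ∀ᶠ t in l, ∀ᵐ p ∂μ, ∀ z, dist (Φ t p z) p ≤ η t z)
    (hρ₀ : Measurable (Function.uncurry ρ₀)) (hb₀ : ∀ᵐ p ∂μ, ∀ z, |ρ₀ p z| ≤ R z)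
    (hρ : ∀ᵐ p ∂μ, ∀ z, Tendsto (fun t => ρ t p z) l (𝓝 (ρ₀ p z)))
    (f : Lp ℂ 2 μ) {F : ι → Lp ℂ 2 μ} {g : Lp ℂ 2 μ}
    (hF : ∀ᶠ t in l, F t =ᵐ[μ] fun p => ∫ z, ρ t p z • f (Φ t p z) ∂ν)
    (hg : g =ᵐ[μ] fun p => (∫ z, ρ₀ p z ∂ν) • f p) :
    Tendsto F l (𝓝 g) := by
  have hfm : Measurable f := (Lp.stronglyMeasurable f).measurable
  have hfL : ∫⁻ p, ‖f p‖ₑ ^ 2 ∂μ < ⊤ := lintegral_enorm_sq_lt_top (Lp.memLp f)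
  obtain ⟨t₀, ht₀⟩ := h.exists
  have hA₀ : IsAveraging μ ν ρ₀ (fun p _ => p) R C :=
    { ht₀.of_coeff with measurable_coeff := hρ₀, abs_le := hb₀ }
  obtain ⟨D, hD⟩ : ∃ D : ι → Z → ℝ≥0∞,
      D = fun t z => ∫⁻ p, ‖ρ t p z • f (Φ t p z) - ρ₀ p z • f p‖ₑ ^ 2 ∂μ := ⟨_, rfl⟩
  have hmeasD : ∀ᶠ t in l, Measurable fun q : P × Z =>
      ‖ρ t q.1 q.2 • f (Φ t q.1 q.2) - ρ₀ q.1 q.2 • f q.1‖ₑ ^ 2 := by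
    filter_upwards [h] with t ht
    exact ((ht.measurable_prod hfm).sub (hA₀.measurable_prod hfm)).enorm.pow_const 2
  -- convergence for each fixed `z`
  have hDz : ∀ z, Tendsto (fun t => D t z) l (𝓝 0) := by
    intro z
    have hmaps := tendsto_lintegral_comp_sub (μ := μ) (Φ := fun t p => Φ t p z)
      (η := fun t => η t z) (c := C z) (f := f) (h.mono fun t ht => ht.measurable_map_left z)
      (hη z) (hd.mono fun t ht => ht.mono fun p hp => hp z) (h.mono fun t ht => ht.map_le z)
      hfm (Lp.memLp f)
    have h1 : Tendsto (fun t => 2 * (ENNReal.ofReal (R z ^ 2) *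
        ∫⁻ p, ‖f (Φ t p z) - f p‖ₑ ^ 2 ∂μ)) l (𝓝 0) := by
      have := ENNReal.Tendsto.const_mul (ENNReal.Tendsto.const_mul hmaps
        (Or.inr (ENNReal.ofReal_ne_top (r := R z ^ 2)))) (Or.inr (by norm_num : (2 : ℝ≥0∞) ≠ ⊤))
      simpa using this
    have h2 : Tendsto (fun t => ∫⁻ p, ENNReal.ofReal ((ρ t p z - ρ₀ p z) ^ 2) * ‖f p‖ₑ ^ 2 ∂μ)
        l (𝓝 (∫⁻ _, 0 ∂μ)) := by
      refine tendsto_lintegral_filter_of_dominated_convergence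
        (fun p => ENNReal.ofReal ((2 * R z) ^ 2) * ‖f p‖ₑ ^ 2) ?_ ?_ ?_ ?_
      · filter_upwards [h] with t ht
        exact ((((ht.measurable_coeff_left z).sub (hA₀.measurable_coeff_left z)).pow_const
          2).ennreal_ofReal).mul (hfm.enorm.pow_const 2)
      · filter_upwards [h] with t ht
        filter_upwards [ht.abs_le, hb₀] with p h1 h2
        gcongr ENNReal.ofReal ?_ * _
        refine sq_le_sq.2 ?_
        calc |ρ t p z - ρ₀ p z| ≤ |ρ t p z| + |ρ₀ p z| := abs_sub _ _
          _ ≤ R z + R z := add_le_add (h1 z) (h2 z)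
          _ = 2 * R z := by ring
          _ ≤ |2 * R z| := le_abs_self _
      · rw [lintegral_const_mul _ (hfm.enorm.pow_const 2)]
        exact (ENNReal.mul_lt_top ENNReal.ofReal_lt_top hfL).ne
      · filter_upwards [hρ] with p hp
        have h3 : Tendsto (fun t => (ρ t p z - ρ₀ p z) ^ 2) l (𝓝 0) := by
          have := ((hp z).sub_const (ρ₀ p z)).pow 2
          simpa using this
        have h4 := (ENNReal.continuous_ofReal.tendsto 0).comp h3
        rw [ENNReal.ofReal_zero] at h4
        simpa using ENNReal.Tendsto.mul_const (b := ‖f p‖ₑ ^ 2) h4 (Or.inr (by simp))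
    rw [lintegral_zero] at h2
    have h3 : Tendsto (fun t => 2 * ∫⁻ p, ENNReal.ofReal ((ρ t p z - ρ₀ p z) ^ 2) * ‖f p‖ₑ ^ 2 ∂μ)
        l (𝓝 0) := by
      simpa using ENNReal.Tendsto.const_mul h2 (Or.inr (by norm_num : (2 : ℝ≥0∞) ≠ ⊤))
    have h4 := h1.add h3
    rw [add_zero] at h4
    refine tendsto_of_tendsto_of_tendsto_of_le_of_le' tendsto_const_nhds h4
      (Eventually.of_forall fun _ => zero_le) ?_
    filter_upwards [h] with t ht
    have m1 : Measurable fun p => ‖f (Φ t p z) - f p‖ₑ ^ 2 :=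
      ((hfm.comp (ht.measurable_map_left z)).sub hfm).enorm.pow_const 2
    have m2 : Measurable fun p => ENNReal.ofReal ((ρ t p z - ρ₀ p z) ^ 2) * ‖f p‖ₑ ^ 2 :=
      ((((ht.measurable_coeff_left z).sub (hA₀.measurable_coeff_left z)).pow_const
          2).ennreal_ofReal).mul (hfm.enorm.pow_const 2)
    calc D t z = ∫⁻ p, ‖ρ t p z • f (Φ t p z) - ρ₀ p z • f p‖ₑ ^ 2 ∂μ := by rw [hD]
      _ ≤ ∫⁻ p, (2 * (ENNReal.ofReal (R z ^ 2) * ‖f (Φ t p z) - f p‖ₑ ^ 2) +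
          2 * (ENNReal.ofReal ((ρ t p z - ρ₀ p z) ^ 2) * ‖f p‖ₑ ^ 2)) ∂μ := by
          refine lintegral_mono_ae ?_
          filter_upwards [ht.abs_le] with p hp
          have e1 : ρ t p z • f (Φ t p z) - ρ₀ p z • f p =
              ρ t p z • (f (Φ t p z) - f p) + (ρ t p z - ρ₀ p z) • f p := by
            rw [smul_sub, sub_smul]; ring
          rw [e1]
          refine (add_sq_le_enorm _ _).trans ?_
          rw [enorm_sq_real_smul, enorm_sq_real_smul, mul_add]
          gcongr 2 * (ENNReal.ofReal ?_ * _) + _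
          exact sq_le_sq.2 ((hp z).trans (le_abs_self _))
      _ = _ := by
          rw [lintegral_add_left ((m1.const_mul _).const_mul _), lintegral_const_mul _
            (m1.const_mul _), lintegral_const_mul _ m1, lintegral_const_mul _ m2]
  have hDint : Tendsto (fun t => ∫⁻ z, D t z ∂ν) l (𝓝 (∫⁻ _, 0 ∂ν)) := by
    refine tendsto_lintegral_filter_of_dominated_convergence
      (fun z => 4 * (ENNReal.ofReal (R z ^ 2 * C z) * ∫⁻ p, ‖f p‖ₑ ^ 2 ∂μ)) ?_ ?_ ?_
      (Eventually.of_forall hDz)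
    · filter_upwards [hmeasD] with t ht
      rw [hD]
      exact ht.lintegral_prod_left'
    · filter_upwards [h] with t ht
      refine Eventually.of_forall fun z => ?_
      have m1 : Measurable fun p => ‖ρ t p z • f (Φ t p z)‖ₑ ^ 2 :=
        ((ht.measurable_prod hfm).comp measurable_prodMk_right).enorm.pow_const 2
      have m2 : Measurable fun p => ‖ρ₀ p z • f p‖ₑ ^ 2 :=
        ((hA₀.measurable_prod hfm).comp measurable_prodMk_right).enorm.pow_const 2
      calc D t z = ∫⁻ p, ‖ρ t p z • f (Φ t p z) - ρ₀ p z • f p‖ₑ ^ 2 ∂μ := by rw [hD]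
        _ ≤ ∫⁻ p, 2 * (‖ρ t p z • f (Φ t p z)‖ₑ ^ 2 + ‖ρ₀ p z • f p‖ₑ ^ 2) ∂μ := by
            refine lintegral_mono fun p => ?_
            rw [sub_eq_add_neg]
            have := add_sq_le_enorm (ρ t p z • f (Φ t p z)) (-(ρ₀ p z • f p))
            rwa [enorm_neg] at this
        _ = 2 * (∫⁻ p, ‖ρ t p z • f (Φ t p z)‖ₑ ^ 2 ∂μ + ∫⁻ p, ‖ρ₀ p z • f p‖ₑ ^ 2 ∂μ) := by
            rw [lintegral_const_mul (f := fun p => ‖ρ t p z • f (Φ t p z)‖ₑ ^ 2 +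
              ‖ρ₀ p z • f p‖ₑ ^ 2) _ (m1.add m2), lintegral_add_left m1]
        _ ≤ 2 * (ENNReal.ofReal (R z ^ 2 * C z) * ∫⁻ p, ‖f p‖ₑ ^ 2 ∂μ +
              ENNReal.ofReal (R z ^ 2 * C z) * ∫⁻ p, ‖f p‖ₑ ^ 2 ∂μ) := by
            gcongr
            · exact ht.lintegral_left_le hfm z
            · exact hA₀.lintegral_left_le hfm z
        _ = _ := by ring
    · have m : Measurable fun z => ENNReal.ofReal (R z ^ 2 * C z) :=
        ((ht₀.measurable_R.pow_const 2).mul ht₀.measurable_C).ennreal_ofReal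
      rw [lintegral_const_mul _ (m.mul_const _), lintegral_mul_const _ m,
        ← ofReal_integral_eq_lintegral_ofReal ht₀.integrable (Eventually.of_forall ht₀.nonneg)]
      exact (ENNReal.mul_lt_top (by norm_num) (ENNReal.mul_lt_top ENNReal.ofReal_lt_top hfL)).ne
  rw [lintegral_zero] at hDint
  have hsq : Tendsto (fun t => eLpNorm (⇑(F t) - ⇑g) 2 μ ^ 2) l (𝓝 0) := by
    refine tendsto_of_tendsto_of_tendsto_of_le_of_le' tendsto_const_nhds hDint
      (Eventually.of_forall fun _ => zero_le) ?_
    filter_upwards [h, hF, hmeasD] with t ht hFt hmt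
    rw [eLpNorm_two_sq]
    have hswap : ∫⁻ z, D t z ∂ν =
        ∫⁻ p, ∫⁻ z, ‖ρ t p z • f (Φ t p z) - ρ₀ p z • f p‖ₑ ^ 2 ∂ν ∂μ := by
      rw [hD]
      exact (lintegral_lintegral_swap (f := fun p z =>
        ‖ρ t p z • f (Φ t p z) - ρ₀ p z • f p‖ₑ ^ 2) hmt.aemeasurable).symm
    rw [hswap]
    refine lintegral_mono_ae ?_
    filter_upwards [hFt, hg, ht.ae_integrable hfm (Lp.memLp f),
      hA₀.ae_integrable hfm (Lp.memLp f)] with p h1 h2 h3 h4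
    rw [Pi.sub_apply, h1, h2, ← integral_smul_const, ← integral_sub h3 h4]
    exact enorm_integral_sq_le ν _
  rw [Lp.tendsto_Lp_iff_tendsto_eLpNorm']
  rw [ENNReal.tendsto_nhds_zero] at hsq ⊢
  intro ε hε
  filter_upwards [hsq (ε ^ 2) (by positivity)] with t ht
  exact (ENNReal.pow_le_pow_left_iff two_ne_zero).1 ht

end Limit

end Averaging

/-! ### The weighted measures -/

instance (lam : ℝ) : SigmaFinite (weightMeasure lam) := by
  unfold weightMeasure; infer_instance

instance (lam : ℝ) : IsFiniteMeasureOnCompacts (weightMeasure lam) := by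
  have : IsLocallyFiniteMeasure (weightMeasure lam) :=
    IsLocallyFiniteMeasure.withDensity_ofReal (continuous_weightDensity lam)
  infer_instance

instance (α β lam : ℝ) : SigmaFinite (weightMeasure₂ α β lam) := by
  unfold weightMeasure₂; infer_instance

instance (α β lam : ℝ) : IsFiniteMeasureOnCompacts (weightMeasure₂ α β lam) := by
  unfold weightMeasure₂; infer_instance

theorem weightDensity_pos (lam x : ℝ) : 0 < weightDensity lam x := Real.exp_pos _

theorem abs_sqrt_one_add_sq_sub_le (x y : ℝ) :
    |Real.sqrt (1 + x ^ 2) - Real.sqrt (1 + y ^ 2)| ≤ |x - y| := by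
  have hx := Real.sqrt_nonneg (1 + x ^ 2)
  have hy := Real.sqrt_nonneg (1 + y ^ 2)
  have hx2 := Real.sq_sqrt (show 0 ≤ 1 + x ^ 2 by positivity)
  have hy2 := Real.sq_sqrt (show 0 ≤ 1 + y ^ 2 by positivity)
  rw [← sq_le_sq]
  nlinarith [Real.abs_le_sqrt (show (1 + x * y) ^ 2 ≤ (1 + x ^ 2) * (1 + y ^ 2) by
    nlinarith [sq_nonneg (x - y)]), Real.sqrt_mul (show 0 ≤ 1 + x ^ 2 by positivity) (1 + y ^ 2),
    le_abs_self (1 + x * y)]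

/-- A shift by `c` changes the weight at most by the factor `exp (2 |lam| |c|)`. -/
theorem weightDensity_le (lam x c : ℝ) :
    weightDensity lam x ≤ Real.exp (2 * |lam| * |c|) * weightDensity lam (x - c) := by
  unfold weightDensity
  rw [← Real.exp_add]
  refine Real.exp_le_exp.2 ?_
  have h1 := abs_sqrt_one_add_sq_sub_le (x - c) x
  rw [show x - c - x = -c by ring, abs_neg] at h1
  have h2 : lam * (Real.sqrt (1 + (x - c) ^ 2) - Real.sqrt (1 + x ^ 2)) ≤ |lam| * |c| :=
    (le_abs_self _).trans (by rw [abs_mul]; gcongr)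
  nlinarith

theorem weightMeasure_map_le (lam c : ℝ) {b : ℝ} (hb : Real.exp (2 * |lam| * |c|) ≤ b) :
    (weightMeasure lam).map (fun x => x - c) ≤ ENNReal.ofReal b • weightMeasure lam := by
  have hm : Measurable fun x : ℝ => x - c := measurable_id.sub_const c
  have hd : Measurable fun x => ENNReal.ofReal (weightDensity lam x) :=
    (continuous_weightDensity lam).measurable.ennreal_ofReal
  refine Measure.le_intro fun s hs _ => ?_
  rw [Measure.map_apply hm hs, Measure.smul_apply, smul_eq_mul, weightMeasure,
    withDensity_apply _ (hm hs), withDensity_apply _ hs, ← lintegral_indicator (hm hs),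
    ← lintegral_indicator hs, ← lintegral_const_mul _ (hd.indicator hs),
    ← lintegral_sub_right_eq_self (μ := volume) (fun x => ENNReal.ofReal b *
      s.indicator (fun x => ENNReal.ofReal (weightDensity lam x)) x) c]
  refine lintegral_mono fun x => ?_
  by_cases hx : x - c ∈ s
  · have hx' : x ∈ (fun x => x - c) ⁻¹' s := hx
    rw [Set.indicator_of_mem hx', Set.indicator_of_mem hx,
      ← ENNReal.ofReal_mul ((Real.exp_pos _).le.trans hb)]
    refine ENNReal.ofReal_le_ofReal ((weightDensity_le lam x c).trans ?_)
    gcongr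
    exact (weightDensity_pos _ _).le
  · have hx' : x ∉ (fun x => x - c) ⁻¹' s := hx
    rw [Set.indicator_of_notMem hx']
    exact zero_le

/-- The map `(σ, x) ↦ (θ + m (σ - θ), x - h σ)`: a dilation towards `θ` in the first variable and
a shear in the second one. -/
def shearMap (θ m : ℝ) (h : ℝ → ℝ) (p : ℝ × ℝ) : ℝ × ℝ := (θ + m * (p.1 - θ), p.2 - h p.1)

theorem measurePreserving_shearMap (θ : ℝ) {m : ℝ} (hm : 0 < m) {h : ℝ → ℝ} (hh : Measurable h) :
    MeasurePreserving (shearMap θ m h) volume (ENNReal.ofReal m⁻¹ • volume) := by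
  have h1 : MeasurePreserving (fun σ : ℝ => θ + m * (σ - θ)) volume
      (ENNReal.ofReal m⁻¹ • volume) := by
    have e1 : MeasurePreserving (fun σ : ℝ => σ - θ) volume volume :=
      measurePreserving_sub_right volume θ
    have e2 : MeasurePreserving (fun σ : ℝ => m * σ) volume (ENNReal.ofReal m⁻¹ • volume) := by
      refine ⟨measurable_const_mul m, ?_⟩
      rw [Real.map_volume_mul_left hm.ne', abs_of_pos (inv_pos.2 hm)]
    have e3 : MeasurePreserving (fun σ : ℝ => θ + σ) (ENNReal.ofReal m⁻¹ • volume)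
        (ENNReal.ofReal m⁻¹ • volume) :=
      (measurePreserving_add_left volume θ).smul_measure _
    exact e3.comp (e2.comp e1)
  have h2 : Measurable (Function.uncurry fun σ x : ℝ => x - h σ) :=
    measurable_snd.sub (hh.comp measurable_fst)
  have h3 := h1.skew_product (μc := (volume : Measure ℝ)) (μd := (volume : Measure ℝ)) h2
    (Eventually.of_forall fun σ => (measurePreserving_sub_right volume (h σ)).map_eq)
  rwa [Measure.prod_smul_left] at h3

theorem mem_Ioo_of_contraction {α β θ m σ : ℝ} (hαθ : α < θ) (hθβ : θ < β) (hm : 0 < m)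
    (hm1 : m ≤ 1) (hσ : σ ∈ Set.Ioo α β) : θ + m * (σ - θ) ∈ Set.Ioo α β := by
  obtain ⟨h1, h2⟩ := hσ
  constructor <;> nlinarith

theorem ae_fst_mem (α β lam : ℝ) : ∀ᵐ p ∂weightMeasure₂ α β lam, p.1 ∈ Set.Ioo α β := by
  have h : ∀ᵐ σ ∂(volume.restrict (Set.Ioo α β)), σ ∈ Set.Ioo α β :=
    ae_restrict_mem measurableSet_Ioo
  exact Measure.quasiMeasurePreserving_fst.ae h

theorem weightMeasure₂_map_le {α β θ m H b : ℝ} (lam : ℝ) (hαθ : α < θ) (hθβ : θ < β) (hm : 0 < m)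
    (hm1 : m ≤ 1) {h : ℝ → ℝ} (hh : Measurable h) (hH : ∀ σ ∈ Set.Ioo α β, |h σ| ≤ H)
    (hb : m⁻¹ * Real.exp (2 * |lam| * H) ≤ b) :
    (weightMeasure₂ α β lam).map (shearMap θ m h) ≤
      ENNReal.ofReal b • weightMeasure₂ α β lam := by
  have hΦ := measurePreserving_shearMap θ hm hh
  have hd : Measurable fun p : ℝ × ℝ => ENNReal.ofReal (weightDensity lam p.2) :=
    ((continuous_weightDensity lam).measurable.comp measurable_snd).ennreal_ofReal
  have hS : MeasurableSet (Set.Ioo α β ×ˢ (Set.univ : Set ℝ)) :=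
    measurableSet_Ioo.prod MeasurableSet.univ
  refine Measure.le_intro fun s hs _ => ?_
  have key : ∀ A : Set (ℝ × ℝ), MeasurableSet A → weightMeasure₂ α β lam A =
      ∫⁻ p, (A ∩ Set.Ioo α β ×ˢ Set.univ).indicator
        (fun p => ENNReal.ofReal (weightDensity lam p.2)) p := by
    intro A hA
    rw [weightMeasure₂_eq, withDensity_apply _ hA, Measure.restrict_restrict hA,
      lintegral_indicator (hA.inter hS)]
  rw [Measure.map_apply hΦ.measurable hs, Measure.smul_apply, smul_eq_mul,
    key _ (hΦ.measurable hs), key _ hs]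
  have hE : 0 < Real.exp (2 * |lam| * H) := Real.exp_pos _
  have hmi : 0 < m⁻¹ := inv_pos.2 hm
  have hcomp : ∫⁻ p, (s ∩ Set.Ioo α β ×ˢ Set.univ).indicator
        (fun p => ENNReal.ofReal (weightDensity lam p.2)) (shearMap θ m h p) =
      ENNReal.ofReal m⁻¹ * ∫⁻ p, (s ∩ Set.Ioo α β ×ˢ Set.univ).indicator
        (fun p => ENNReal.ofReal (weightDensity lam p.2)) p := by
    rw [hΦ.lintegral_comp (hd.indicator (hs.inter hS)), lintegral_smul_measure, smul_eq_mul]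
  calc ∫⁻ p, (shearMap θ m h ⁻¹' s ∩ Set.Ioo α β ×ˢ Set.univ).indicator
        (fun p => ENNReal.ofReal (weightDensity lam p.2)) p
      ≤ ∫⁻ p, ENNReal.ofReal (Real.exp (2 * |lam| * H)) * (s ∩ Set.Ioo α β ×ˢ Set.univ).indicator
        (fun p => ENNReal.ofReal (weightDensity lam p.2)) (shearMap θ m h p) := by
        refine lintegral_mono fun p => ?_
        by_cases hp : p ∈ shearMap θ m h ⁻¹' s ∩ Set.Ioo α β ×ˢ Set.univ
        · have hp1 : p.1 ∈ Set.Ioo α β := hp.2.1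
          have hp' : shearMap θ m h p ∈ s ∩ Set.Ioo α β ×ˢ Set.univ :=
            ⟨hp.1, mem_Ioo_of_contraction hαθ hθβ hm hm1 hp1, Set.mem_univ _⟩
          rw [Set.indicator_of_mem hp, Set.indicator_of_mem hp', ← ENNReal.ofReal_mul hE.le]
          refine ENNReal.ofReal_le_ofReal ((weightDensity_le lam p.2 (h p.1)).trans ?_)
          refine mul_le_mul_of_nonneg_right (Real.exp_le_exp.2 ?_) (weightDensity_pos _ _).le
          have := hH _ hp1
          gcongr
        · rw [Set.indicator_of_notMem hp]
          exact zero_le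
    _ = ENNReal.ofReal (m⁻¹ * Real.exp (2 * |lam| * H)) * ∫⁻ p,
        (s ∩ Set.Ioo α β ×ˢ Set.univ).indicator
          (fun p => ENNReal.ofReal (weightDensity lam p.2)) p := by
        rw [lintegral_const_mul' _ _ ENNReal.ofReal_ne_top, hcomp,
          ENNReal.ofReal_mul hmi.le]
        ring
    _ ≤ _ := by gcongr

/-! ### Averaging along shifts and shears -/

section Constructors

variable {Z : Type*} [MeasurableSpace Z] {ν : Measure Z}

theorem isAveraging_shift (lam : ℝ) {ρ : ℝ → Z → ℝ} {h R C : Z → ℝ}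
    (hρ : Measurable (Function.uncurry ρ)) (hh : Measurable h) (hR : Measurable R)
    (hC : Measurable C) (hρR : ∀ x z, |ρ x z| ≤ R z)
    (hhC : ∀ z, Real.exp (2 * |lam| * |h z|) ≤ C z)
    (hi : Integrable (fun z => R z ^ 2 * C z) ν) :
    IsAveraging (weightMeasure lam) ν ρ (fun x z => x - h z) R C where
  measurable_coeff := hρ
  measurable_map := measurable_fst.sub (hh.comp measurable_snd)
  measurable_R := hR
  measurable_C := hC
  abs_le := Eventually.of_forall hρR
  map_le z := weightMeasure_map_le lam (h z) (hhC z)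
  one_le z := (Real.one_le_exp (by positivity)).trans (hhC z)
  integrable := hi

theorem isAveraging_shear {α β θ : ℝ} (lam : ℝ) (hαθ : α < θ) (hθβ : θ < β)
    {ρ : ℝ × ℝ → Z → ℝ} {m : Z → ℝ} {h : ℝ → Z → ℝ} {R C H : Z → ℝ}
    (hρ : Measurable (Function.uncurry ρ)) (hm : Measurable m) (hm0 : ∀ z, 0 < m z)
    (hm1 : ∀ z, m z ≤ 1) (hh : Measurable (Function.uncurry h)) (hR : Measurable R)
    (hC : Measurable C) (hρR : ∀ p : ℝ × ℝ, p.1 ∈ Set.Ioo α β → ∀ z, |ρ p z| ≤ R z)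
    (hH : ∀ σ ∈ Set.Ioo α β, ∀ z, |h σ z| ≤ H z)
    (hHC : ∀ z, (m z)⁻¹ * Real.exp (2 * |lam| * H z) ≤ C z)
    (hi : Integrable (fun z => R z ^ 2 * C z) ν) :
    IsAveraging (weightMeasure₂ α β lam) ν ρ (fun p z => shearMap θ (m z) (fun σ => h σ z) p)
      R C where
  measurable_coeff := hρ
  measurable_map := by
    refine Measurable.prodMk ?_ ?_
    · exact measurable_const.add ((hm.comp measurable_snd).mul
        ((measurable_fst.comp measurable_fst).sub measurable_const))
    · exact (measurable_snd.comp measurable_fst).sub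
        (hh.comp ((measurable_fst.comp measurable_fst).prodMk measurable_snd))
  measurable_R := hR
  measurable_C := hC
  abs_le := (ae_fst_mem α β lam).mono hρR
  map_le z := weightMeasure₂_map_le lam hαθ hθβ (hm0 z) (hm1 z)
    (hh.comp (measurable_id.prodMk measurable_const)) (fun σ hσ => hH σ hσ z) (hHC z)
  one_le z := by
    have h0 : 0 ≤ H z := (abs_nonneg _).trans (hH θ ⟨hαθ, hθβ⟩ z)
    have h1 : 1 ≤ Real.exp (2 * |lam| * H z) := Real.one_le_exp (by positivity)
    exact (one_le_mul_of_one_le_of_one_le ((one_le_inv₀ (hm0 z)).2 (hm1 z)) h1).trans (hHC z)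
  integrable := hi

end Constructors

/-! ### Pairing with test functions -/

section Pairing

variable {P Z : Type*} [TopologicalSpace P] [MeasurableSpace P] [BorelSpace P]
  [MeasurableSpace Z]

/-- The pairing of an averaging operator on a weighted `L²` space with a continuous function of
compact support, with respect to the unweighted measure. -/
theorem IsAveraging.integrable_mul_of_density {m : Measure P} [SigmaFinite m] {d : P → ℝ}
    (hd : Continuous d) (hpos : ∀ p, 0 < d p) {μ : Measure P}
    (hμ : μ = m.withDensity fun p => ENNReal.ofReal (d p)) [IsFiniteMeasureOnCompacts μ]
    [SecondCountableTopology P]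
    {ν : Measure Z} [IsProbabilityMeasure ν] {ρ : P → Z → ℝ} {Φ : P → Z → P} {R C : Z → ℝ}
    (h : IsAveraging μ ν ρ Φ R C) {f φ : P → ℂ} (hf : Measurable f) (hf2 : MemLp f 2 μ)
    (hφ : Continuous φ) (hφs : HasCompactSupport φ) :
    Integrable (fun q : P × Z => ρ q.1 q.2 • f (Φ q.1 q.2) * φ q.1) (m.prod ν) := by
  have hm : Measurable fun p => (d p).toNNReal := hd.measurable.real_toNNReal
  have hc : Continuous fun p => ((d p)⁻¹ : ℝ) := hd.inv₀ fun p => (hpos p).ne'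
  obtain ⟨ψ, hψ⟩ : ∃ ψ : P → ℂ, ψ = fun p => ((d p)⁻¹ : ℝ) • φ p := ⟨_, rfl⟩
  have hψc : Continuous ψ := by rw [hψ]; exact hc.smul hφ
  have hψs : HasCompactSupport ψ := by
    rw [hψ]; exact hφs.smul_left (f := fun p => ((d p)⁻¹ : ℝ))
  have hψ2 : MemLp ψ 2 μ := hψc.memLp_of_hasCompactSupport hψs
  have : SigmaFinite μ := by rw [hμ]; infer_instance
  have hint := h.integrable_mul hf hf2 hψ2
  rw [hμ, prod_withDensity_left hd.measurable.ennreal_ofReal] at hint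
  have hint2 := (integrable_withDensity_iff_integrable_smul (E := ℂ)
    (f := fun q : P × Z => (d q.1).toNNReal) (hm.comp measurable_fst) (μ := m.prod ν)
    (g := fun q => ρ q.1 q.2 • f (Φ q.1 q.2) * ψ q.1)).1 hint
  refine hint2.congr (Eventually.of_forall fun q => ?_)
  have hne : ((d q.1 : ℝ) : ℂ) ≠ 0 := by exact_mod_cast (hpos q.1).ne'
  have hψp : ψ q.1 = ((d q.1)⁻¹ : ℝ) • φ q.1 := by rw [hψ]
  change ((d q.1).toNNReal : ℝ) • (ρ q.1 q.2 • f (Φ q.1 q.2) * ψ q.1) = _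
  rw [hψp, Real.coe_toNNReal _ (hpos q.1).le, Complex.real_smul, Complex.real_smul (x := (d q.1)⁻¹),
    Complex.ofReal_inv, mul_left_comm, mul_inv_cancel_left₀ hne]

end Pairing

section PairingConcrete

variable {Z : Type*} [MeasurableSpace Z] {ν : Measure Z} [IsProbabilityMeasure ν]

theorem IsAveraging.integrable_mul_test {lam : ℝ} {ρ : ℝ → Z → ℝ} {Φ : ℝ → Z → ℝ} {R C : Z → ℝ}
    (h : IsAveraging (weightMeasure lam) ν ρ Φ R C) {f φ : ℝ → ℂ} (hf : Measurable f)
    (hf2 : MemLp f 2 (weightMeasure lam)) (hφ : Continuous φ) (hφs : HasCompactSupport φ) :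
    Integrable (fun q : ℝ × Z => ρ q.1 q.2 • f (Φ q.1 q.2) * φ q.1) (volume.prod ν) :=
  h.integrable_mul_of_density (continuous_weightDensity lam) (weightDensity_pos lam)
    (μ := weightMeasure lam) rfl hf hf2
    hφ hφs

theorem IsAveraging.integral_integral_mul {lam : ℝ} {ρ : ℝ → Z → ℝ} {Φ : ℝ → Z → ℝ} {R C : Z → ℝ}
    (h : IsAveraging (weightMeasure lam) ν ρ Φ R C) {f φ : ℝ → ℂ} (hf : Measurable f)
    (hf2 : MemLp f 2 (weightMeasure lam)) (hφ : Continuous φ) (hφs : HasCompactSupport φ) :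
    ∫ x, (∫ z, ρ x z • f (Φ x z) ∂ν) * φ x = ∫ z, (∫ x, ρ x z • f (Φ x z) * φ x) ∂ν := by
  rw [← integral_integral_swap (f := fun x z => ρ x z • f (Φ x z) * φ x)
    (h.integrable_mul_test hf hf2 hφ hφs)]
  simp only [integral_mul_const]

theorem IsAveraging.integrable_mul_test₂ {α β lam : ℝ} {ρ : ℝ × ℝ → Z → ℝ}
    {Φ : ℝ × ℝ → Z → ℝ × ℝ} {R C : Z → ℝ}
    (h : IsAveraging (weightMeasure₂ α β lam) ν ρ Φ R C) {f φ : ℝ × ℝ → ℂ} (hf : Measurable f)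
    (hf2 : MemLp f 2 (weightMeasure₂ α β lam)) (hφ : Continuous φ) (hφs : HasCompactSupport φ) :
    Integrable (fun q : (ℝ × ℝ) × Z => ρ q.1 q.2 • f (Φ q.1 q.2) * φ q.1)
      ((volume.restrict (Set.Ioo α β ×ˢ Set.univ)).prod ν) :=
  h.integrable_mul_of_density ((continuous_weightDensity lam).comp continuous_snd)
    (fun p => weightDensity_pos lam p.2) (weightMeasure₂_eq α β lam) hf hf2 hφ hφs

theorem IsAveraging.integral_integral_mul₂ {α β lam : ℝ} {ρ : ℝ × ℝ → Z → ℝ}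
    {Φ : ℝ × ℝ → Z → ℝ × ℝ} {R C : Z → ℝ}
    (h : IsAveraging (weightMeasure₂ α β lam) ν ρ Φ R C) {f φ : ℝ × ℝ → ℂ} (hf : Measurable f)
    (hf2 : MemLp f 2 (weightMeasure₂ α β lam)) (hφ : Continuous φ) (hφs : HasCompactSupport φ) :
    ∫ p in Set.Ioo α β ×ˢ Set.univ, (∫ z, ρ p z • f (Φ p z) ∂ν) * φ p =
      ∫ z, (∫ p in Set.Ioo α β ×ˢ Set.univ, ρ p z • f (Φ p z) * φ p) ∂ν := by
  rw [← integral_integral_swap (f := fun p z => ρ p z • f (Φ p z) * φ p)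
    (h.integrable_mul_test₂ hf hf2 hφ hφs)]
  simp only [integral_mul_const]

end PairingConcrete

/-! ### The standard Gaussian measure -/

/-- The standard Gaussian measure on `ℝ`. -/
noncomputable abbrev gauss : Measure ℝ := gaussianReal 0 1

theorem integrable_exp_abs_gauss (a : ℝ) : Integrable (fun z => Real.exp (a * |z|)) gauss :=
  integrable_exp_mul_abs (X := fun z : ℝ => z) (integrable_exp_mul_gaussianReal a)
    (integrable_exp_mul_gaussianReal (-a))

theorem integral_gauss_id : ∫ z, z ∂gauss = 0 := integral_id_gaussianReal

theorem integral_gauss_sq : ∫ z, z ^ 2 ∂gauss = 1 := by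
  have h := variance_fun_id_gaussianReal (μ := 0) (v := 1)
  rw [variance_of_integral_eq_zero aemeasurable_id' integral_id_gaussianReal] at h
  simpa using h

theorem abs_le_exp_abs (z : ℝ) : |z| ≤ Real.exp |z| :=
  (by linarith : |z| ≤ |z| + 1).trans (Real.add_one_le_exp _)

theorem integrable_gauss_id : Integrable (fun z : ℝ => z) gauss := by
  refine (integrable_exp_abs_gauss 1).mono' measurable_id.aestronglyMeasurable
    (Eventually.of_forall fun z => ?_)
  rw [one_mul]
  exact abs_le_exp_abs z

theorem gauss_map_mul (a : ℝ) (ha : 0 ≤ a) :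
    gauss.map (fun z => Real.sqrt a * z) = gaussianReal 0 a.toNNReal := by
  rw [gaussianReal_map_const_mul, mul_zero, mul_one]
  congr 1
  apply NNReal.eq
  rw [Real.coe_toNNReal _ ha]
  exact Real.sq_sqrt ha

/-- The sum of independent centred Gaussian variables of variances `a` and `b` is Gaussian of
variance `a + b`. -/
theorem gauss_prod_map (a b : ℝ) (ha : 0 ≤ a) (hb : 0 ≤ b) :
    (gauss.prod gauss).map (fun z : ℝ × ℝ => Real.sqrt a * z.1 + Real.sqrt b * z.2) =
      gauss.map (fun z => Real.sqrt (a + b) * z) := by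
  have m1 : Measurable fun z : ℝ => Real.sqrt a * z := measurable_const_mul _
  have m2 : Measurable fun z : ℝ => Real.sqrt b * z := measurable_const_mul _
  have h := Measure.map_prod_map gauss gauss m1 m2
  rw [gauss_map_mul a ha, gauss_map_mul b hb] at h
  have h2 : gaussianReal 0 a.toNNReal ∗ gaussianReal 0 b.toNNReal =
      (gauss.prod gauss).map (fun z : ℝ × ℝ => Real.sqrt a * z.1 + Real.sqrt b * z.2) := by
    rw [Measure.conv, h, Measure.map_map (by fun_prop) (m1.prodMap m2)]
    rfl
  rw [← h2, gaussianReal_conv_gaussianReal, gauss_map_mul _ (add_nonneg ha hb), add_zero,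
    Real.toNNReal_add ha hb]

theorem integral_gauss_gauss (a b : ℝ) (ha : 0 ≤ a) (hb : 0 ≤ b) {k : ℝ → ℂ} (hk : Measurable k)
    (hi : Integrable (fun z => k (Real.sqrt (a + b) * z)) gauss) :
    ∫ z, ∫ z', k (Real.sqrt a * z + Real.sqrt b * z') ∂gauss ∂gauss =
      ∫ z, k (Real.sqrt (a + b) * z) ∂gauss := by
  have hm1 : Measurable fun z : ℝ × ℝ => Real.sqrt a * z.1 + Real.sqrt b * z.2 := by fun_prop
  have hm2 : Measurable fun z : ℝ => Real.sqrt (a + b) * z := measurable_const_mul _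
  have h1 : Integrable k (gauss.map fun z => Real.sqrt (a + b) * z) :=
    (integrable_map_measure hk.aestronglyMeasurable hm2.aemeasurable).2 hi
  have h2 : Integrable (fun z : ℝ × ℝ => k (Real.sqrt a * z.1 + Real.sqrt b * z.2))
      (gauss.prod gauss) := by
    rw [← gauss_prod_map a b ha hb] at h1
    exact (integrable_map_measure hk.aestronglyMeasurable hm1.aemeasurable).1 h1
  rw [integral_integral (f := fun z z' => k (Real.sqrt a * z + Real.sqrt b * z')) h2,
    ← integral_map (φ := fun z : ℝ × ℝ => Real.sqrt a * z.1 + Real.sqrt b * z.2)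
      hm1.aemeasurable hk.aestronglyMeasurable, gauss_prod_map a b ha hb,
    integral_map hm2.aemeasurable hk.aestronglyMeasurable]

/-! ### Test functions and weak derivatives on `I × ℝ` -/

theorem measurableSet_strip (α β : ℝ) : MeasurableSet (Set.Ioo α β ×ˢ (Set.univ : Set ℝ)) :=
  measurableSet_Ioo.prod MeasurableSet.univ

theorem isOpen_strip (α β : ℝ) : IsOpen (Set.Ioo α β ×ˢ (Set.univ : Set ℝ)) :=
  isOpen_Ioo.prod isOpen_univ

theorem IsTest.eq_zero {α β : ℝ} {φ : ℝ × ℝ → ℂ} (h : IsTest α β φ) {p : ℝ × ℝ}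
    (hp : p ∉ Set.Ioo α β ×ˢ (Set.univ : Set ℝ)) : φ p = 0 :=
  image_eq_zero_of_notMem_tsupport fun h' => hp (h.support h')

theorem ae_strip {α β lam : ℝ} {q : ℝ × ℝ → Prop} (h : ∀ᵐ p ∂weightMeasure₂ α β lam, q p) :
    ∀ᵐ p ∂volume.restrict (Set.Ioo α β ×ˢ (Set.univ : Set ℝ)), q p :=
  (ac_weightMeasure₂ α β lam).ae_le h

theorem locallyIntegrableOn_of_memLp {α β lam : ℝ} {u : ℝ × ℝ → ℂ}
    (hu : MemLp u 2 (weightMeasure₂ α β lam)) :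
    LocallyIntegrableOn u (Set.Ioo α β ×ˢ Set.univ) volume := by
  rw [locallyIntegrableOn_iff (isOpen_strip α β).isLocallyClosed]
  intro K hKΩ hK
  have h1 : IntegrableOn u K (weightMeasure₂ α β lam) :=
    (hu.locallyIntegrable (by norm_num)).integrableOn_isCompact hK
  have hd : Continuous fun p : ℝ × ℝ => weightDensity lam p.2 :=
    (continuous_weightDensity lam).comp continuous_snd
  have hm : Measurable fun p : ℝ × ℝ => (weightDensity lam p.2).toNNReal :=
    hd.measurable.real_toNNReal
  rw [IntegrableOn, weightMeasure₂_eq, restrict_withDensity hK.measurableSet,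
    Measure.restrict_restrict hK.measurableSet, Set.inter_eq_left.2 hKΩ] at h1
  have h2 := (integrable_withDensity_iff_integrable_smul (E := ℂ) hm
    (μ := volume.restrict K) (g := u)).1 h1
  have h3 : IntegrableOn (fun p => (weightDensity lam p.2)⁻¹ •
      ((weightDensity lam p.2).toNNReal • u p)) K volume :=
    IntegrableOn.continuousOn_smul (f := fun p : ℝ × ℝ => (weightDensity lam p.2)⁻¹) h2
      (hd.inv₀ fun p => (weightDensity_pos lam p.2).ne').continuousOn hK
  refine h3.congr (Eventually.of_forall fun p => ?_)
  have hp := weightDensity_pos lam p.2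
  change (weightDensity lam p.2)⁻¹ • (((weightDensity lam p.2).toNNReal : ℝ) • u p) = u p
  rw [Real.coe_toNNReal _ hp.le, smul_smul, inv_mul_cancel₀ hp.ne', one_smul]

/-- Functions of `L²_lam(I × ℝ)` are determined by their pairings with test functions. -/
theorem ae_eq_of_integral_test {α β lam : ℝ} {u v : ℝ × ℝ → ℂ}
    (hu : MemLp u 2 (weightMeasure₂ α β lam)) (hv : MemLp v 2 (weightMeasure₂ α β lam))
    (h : ∀ φ, IsTest α β φ → ∫ p in Set.Ioo α β ×ˢ Set.univ, u p * φ p =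
      ∫ p in Set.Ioo α β ×ˢ Set.univ, v p * φ p) :
    u =ᵐ[weightMeasure₂ α β lam] v := by
  have h0 := (isOpen_strip α β).ae_eq_zero_of_integral_contDiff_smul_eq_zero
    (f := fun p => u p - v p) (μ := volume) (locallyIntegrableOn_of_memLp (hu.sub hv)) ?_
  · rw [weightMeasure₂_eq]
    refine (withDensity_absolutelyContinuous _ _).ae_le ?_
    refine (ae_restrict_iff' (measurableSet_strip α β)).2 ?_
    filter_upwards [h0] with p hp hpΩ
    exact sub_eq_zero.1 (hp hpΩ)
  · intro g hg hgs hgt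
    have hT : IsTest α β fun p => (g p : ℂ) := by
      refine ⟨Complex.ofRealCLM.contDiff.comp hg, hgs.comp_left Complex.ofReal_zero, ?_⟩
      refine (closure_mono ?_).trans hgt
      intro p hp
      simp only [Function.mem_support, ne_eq, Complex.ofReal_eq_zero] at hp ⊢
      exact hp
    have h1 := h _ hT
    rw [← sub_eq_zero, ← integral_sub (integrable_mul_test' hu hT) (integrable_mul_test' hv hT),
      setIntegral_eq_integral_of_forall_compl_eq_zero] at h1
    · rw [← h1]
      refine integral_congr_ae (Eventually.of_forall fun p => ?_)
      simp only [Complex.real_smul]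
      ring
    · intro p hp
      rw [hT.eq_zero hp, mul_zero, mul_zero, sub_zero]

theorem IsWeakPDeriv.congr {α β lam : ℝ} {i j : ℕ} {u u' g g' : ℝ × ℝ → ℂ}
    (h : IsWeakPDeriv α β i j u g) (hu : u =ᵐ[weightMeasure₂ α β lam] u')
    (hg : g =ᵐ[weightMeasure₂ α β lam] g') : IsWeakPDeriv α β i j u' g' := by
  intro φ hφ
  have h1 : ∫ p in Set.Ioo α β ×ˢ Set.univ, u' p * (dSigma^[i] (dX^[j] φ)) p =
      ∫ p in Set.Ioo α β ×ˢ Set.univ, u p * (dSigma^[i] (dX^[j] φ)) p :=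
    integral_congr_ae (by filter_upwards [ae_strip hu] with p hp; rw [hp])
  have h2 : ∫ p in Set.Ioo α β ×ˢ Set.univ, g' p * φ p =
      ∫ p in Set.Ioo α β ×ˢ Set.univ, g p * φ p :=
    integral_congr_ae (by filter_upwards [ae_strip hg] with p hp; rw [hp])
  rw [h1, h2, h φ hφ]

theorem isWeakPDeriv_zero (α β : ℝ) (u : ℝ × ℝ → ℂ) : IsWeakPDeriv α β 0 0 u u := by
  intro φ _
  simp

theorem IsWeakPDeriv.sigma_eq {α β : ℝ} {u g φ : ℝ × ℝ → ℂ} (h : IsWeakPDeriv α β 1 0 u g)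
    (hφ : IsTest α β φ) : ∫ p in Set.Ioo α β ×ˢ Set.univ, u p * dSigma φ p =
      -∫ p in Set.Ioo α β ×ˢ Set.univ, g p * φ p := by
  have := h φ hφ
  simpa using this

theorem IsWeakPDeriv.x_eq {α β : ℝ} {u g φ : ℝ × ℝ → ℂ} (h : IsWeakPDeriv α β 0 1 u g)
    (hφ : IsTest α β φ) : ∫ p in Set.Ioo α β ×ˢ Set.univ, u p * dX φ p =
      -∫ p in Set.Ioo α β ×ˢ Set.univ, g p * φ p := by
  have := h φ hφ
  simpa using this

theorem dSigma_dX_comm {φ : ℝ × ℝ → ℂ} (hφ : ContDiff ℝ ∞ φ) :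
    dSigma (dX φ) = dX (dSigma φ) := by
  funext p
  have hd : DifferentiableAt ℝ (fderiv ℝ φ) p :=
    (hφ.fderiv_right (m := ∞) (by simp)).differentiable (by simp) p
  have e : ∀ v w : ℝ × ℝ, fderiv ℝ (fun q => fderiv ℝ φ q v) p w =
      fderiv ℝ (fderiv ℝ φ) p w v := by
    intro v w
    rw [fderiv_clm_apply hd (differentiableAt_const v)]
    simp
  unfold dSigma dX
  rw [e, e]
  have hs : IsSymmSndFDerivAt ℝ φ p :=
    hφ.contDiffAt.isSymmSndFDerivAt (by simpa using WithTop.coe_le_coe.2 (le_top : (2 : ℕ∞) ≤ ⊤))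
  exact hs.eq _ _

/-- Weak derivatives of second order from those of first order. -/
theorem IsWeakPDeriv.sigma_sigma {α β : ℝ} {u v w : ℝ × ℝ → ℂ} (h : IsWeakPDeriv α β 1 0 u v)
    (h' : IsWeakPDeriv α β 1 0 v w) : IsWeakPDeriv α β 2 0 u w := by
  intro φ hφ
  have := h.sigma_eq hφ.dSigma
  rw [h'.sigma_eq hφ] at this
  simpa using this

theorem IsWeakPDeriv.x_x {α β : ℝ} {u v w : ℝ × ℝ → ℂ} (h : IsWeakPDeriv α β 0 1 u v)
    (h' : IsWeakPDeriv α β 0 1 v w) : IsWeakPDeriv α β 0 2 u w := by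
  intro φ hφ
  have := h.x_eq hφ.dX
  rw [h'.x_eq hφ] at this
  simpa using this

theorem IsWeakPDeriv.sigma_x {α β : ℝ} {u v w : ℝ × ℝ → ℂ} (h : IsWeakPDeriv α β 1 0 u v)
    (h' : IsWeakPDeriv α β 0 1 v w) : IsWeakPDeriv α β 1 1 u w := by
  intro φ hφ
  have := h.sigma_eq hφ.dX
  rw [h'.x_eq hφ] at this
  simpa using this

/-- Conversely, a weak derivative of second order is a weak derivative of one of first order. -/
theorem IsWeakPDeriv.of_sigma_sigma {α β : ℝ} {u v w : ℝ × ℝ → ℂ} (h : IsWeakPDeriv α β 1 0 u v)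
    (h' : IsWeakPDeriv α β 2 0 u w) : IsWeakPDeriv α β 1 0 v w := by
  intro φ hφ
  have h1 := h.sigma_eq hφ.dSigma
  have h2 := h' φ hφ
  simp only [Function.iterate_succ, Function.iterate_zero, Function.comp_apply, id] at h2 ⊢
  rw [h2] at h1
  linear_combination h1

theorem IsWeakPDeriv.of_x_x {α β : ℝ} {u v w : ℝ × ℝ → ℂ} (h : IsWeakPDeriv α β 0 1 u v)
    (h' : IsWeakPDeriv α β 0 2 u w) : IsWeakPDeriv α β 0 1 v w := by
  intro φ hφ
  have h1 := h.x_eq hφ.dX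
  have h2 := h' φ hφ
  simp only [Function.iterate_succ, Function.iterate_zero, Function.comp_apply, id] at h2 ⊢
  rw [h2] at h1
  linear_combination h1

theorem IsWeakPDeriv.x_of_sigma_x {α β : ℝ} {u v w : ℝ × ℝ → ℂ} (h : IsWeakPDeriv α β 1 0 u v)
    (h' : IsWeakPDeriv α β 1 1 u w) : IsWeakPDeriv α β 0 1 v w := by
  intro φ hφ
  have h1 := h.sigma_eq hφ.dX
  have h2 := h' φ hφ
  simp only [Function.iterate_succ, Function.iterate_zero, Function.comp_apply, id] at h2 ⊢
  rw [h2] at h1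
  linear_combination h1

theorem IsWeakPDeriv.sigma_of_sigma_x {α β : ℝ} {u v w : ℝ × ℝ → ℂ}
    (h : IsWeakPDeriv α β 0 1 u v) (h' : IsWeakPDeriv α β 1 1 u w) :
    IsWeakPDeriv α β 1 0 v w := by
  intro φ hφ
  have h1 := h.x_eq hφ.dSigma
  have h2 := h' φ hφ
  simp only [Function.iterate_succ, Function.iterate_zero, Function.comp_apply, id] at h2 ⊢
  rw [dSigma_dX_comm hφ.smooth] at h2
  rw [h2] at h1
  linear_combination h1

/-! ### Test functions along shears -/

/-- The chain rule along a differentiable curve, in terms of `dSigma` and `dX`. -/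
theorem hasDerivAt_comp_curve {φ : ℝ × ℝ → ℂ} {a b : ℝ → ℝ} {a' b' s : ℝ}
    (hφ : DifferentiableAt ℝ φ (a s, b s)) (ha : HasDerivAt a a' s) (hb : HasDerivAt b b' s) :
    HasDerivAt (fun r => φ (a r, b r)) (a' • dSigma φ (a s, b s) + b' • dX φ (a s, b s)) s := by
  have h := hφ.hasFDerivAt.comp_hasDerivAt s (ha.prodMk hb)
  have e : (a', b') = a' • ((1, 0) : ℝ × ℝ) + b' • ((0, 1) : ℝ × ℝ) := by simp
  rw [e, map_add, map_smul, map_smul] at h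
  exact h

theorem dSigma_eq_of_hasDerivAt {φ : ℝ × ℝ → ℂ} {p : ℝ × ℝ} {c : ℂ}
    (hφ : DifferentiableAt ℝ φ p) (h : HasDerivAt (fun σ => φ (σ, p.2)) c p.1) :
    dSigma φ p = c := by
  have h1 := hasDerivAt_comp_curve (φ := φ) (a := fun σ => σ) (b := fun _ => p.2) hφ
    (hasDerivAt_id p.1) (hasDerivAt_const p.1 p.2)
  simp only [one_smul, zero_smul, add_zero] at h1
  exact h1.unique h

theorem dX_eq_of_hasDerivAt {φ : ℝ × ℝ → ℂ} {p : ℝ × ℝ} {c : ℂ}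
    (hφ : DifferentiableAt ℝ φ p) (h : HasDerivAt (fun x => φ (p.1, x)) c p.2) :
    dX φ p = c := by
  have h1 := hasDerivAt_comp_curve (φ := φ) (a := fun _ => p.1) (b := fun x => x) hφ
    (hasDerivAt_const p.2 p.1) (hasDerivAt_id p.2)
  simp only [one_smul, zero_smul, zero_add] at h1
  exact h1.unique h

theorem IsTest.differentiableAt {α β : ℝ} {φ : ℝ × ℝ → ℂ} (h : IsTest α β φ) (p : ℝ × ℝ) :
    DifferentiableAt ℝ φ p := h.smooth.differentiable (by simp) p

theorem hasDerivAt_sigma {φ : ℝ × ℝ → ℂ} {p : ℝ × ℝ} (hφ : DifferentiableAt ℝ φ p) :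
    HasDerivAt (fun σ => φ (σ, p.2)) (dSigma φ p) p.1 := by
  have h1 := hasDerivAt_comp_curve (φ := φ) (a := fun σ => σ) (b := fun _ => p.2) hφ
    (hasDerivAt_id p.1) (hasDerivAt_const p.1 p.2)
  simpa only [one_smul, zero_smul, add_zero] using h1

theorem hasDerivAt_x {φ : ℝ × ℝ → ℂ} {p : ℝ × ℝ} (hφ : DifferentiableAt ℝ φ p) :
    HasDerivAt (fun x => φ (p.1, x)) (dX φ p) p.2 := by
  have h1 := hasDerivAt_comp_curve (φ := φ) (a := fun _ => p.1) (b := fun x => x) hφ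
    (hasDerivAt_const p.2 p.1) (hasDerivAt_id p.2)
  simpa only [one_smul, zero_smul, zero_add] using h1

/-- Multiplication of a test function by a smooth function of `σ`. -/
theorem IsTest.mul_sigma {α β : ℝ} {φ : ℝ × ℝ → ℂ} (h : IsTest α β φ) {ρ : ℝ → ℝ}
    (hρ : ContDiff ℝ ∞ ρ) : IsTest α β fun p => ρ p.1 • φ p where
  smooth := (hρ.comp contDiff_fst).smul h.smooth
  compact := h.compact.smul_left (f := fun p : ℝ × ℝ => ρ p.1)
  support := (closure_mono (Function.support_smul_subset_right (fun p : ℝ × ℝ => ρ p.1) φ)).trans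
    h.support

theorem dSigma_mul_sigma {φ : ℝ × ℝ → ℂ} (hφ : ContDiff ℝ ∞ φ) {ρ : ℝ → ℝ}
    (hρ : ContDiff ℝ ∞ ρ) (p : ℝ × ℝ) :
    dSigma (fun p => ρ p.1 • φ p) p = ρ p.1 • dSigma φ p + deriv ρ p.1 • φ p := by
  have hd : ContDiff ℝ ∞ fun p : ℝ × ℝ => ρ p.1 • φ p := (hρ.comp contDiff_fst).smul hφ
  refine dSigma_eq_of_hasDerivAt (hd.differentiable (by simp) p) ?_
  exact ((hρ.differentiable (by simp) p.1).hasDerivAt).smul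
    (hasDerivAt_sigma (hφ.differentiable (by simp) p))

theorem dX_mul_sigma {φ : ℝ × ℝ → ℂ} (hφ : ContDiff ℝ ∞ φ) {ρ : ℝ → ℝ}
    (hρ : ContDiff ℝ ∞ ρ) (p : ℝ × ℝ) :
    dX (fun p => ρ p.1 • φ p) p = ρ p.1 • dX φ p := by
  have hd : ContDiff ℝ ∞ fun p : ℝ × ℝ => ρ p.1 • φ p := (hρ.comp contDiff_fst).smul hφ
  refine dX_eq_of_hasDerivAt (hd.differentiable (by simp) p) ?_
  exact (hasDerivAt_x (hφ.differentiable (by simp) p)).const_smul (ρ p.1)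

/-- The map `shearMap θ m h` as a homeomorphism of the plane. -/
noncomputable def shearHomeomorph (θ : ℝ) {m : ℝ} (hm : m ≠ 0) {h : ℝ → ℝ} (hh : Continuous h) :
    ℝ × ℝ ≃ₜ ℝ × ℝ where
  toFun := shearMap θ m h
  invFun p := (θ + m⁻¹ * (p.1 - θ), p.2 + h (θ + m⁻¹ * (p.1 - θ)))
  left_inv p := by
    unfold shearMap
    have : θ + m⁻¹ * (θ + m * (p.1 - θ) - θ) = p.1 := by field_simp; ring
    ext
    · exact this
    · simp only [this]; ring
  right_inv p := by
    unfold shearMap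
    ext
    · simp only; field_simp; ring
    · simp only; ring
  continuous_toFun := by unfold shearMap; fun_prop
  continuous_invFun := by fun_prop

theorem shearHomeomorph_apply (θ : ℝ) {m : ℝ} (hm : m ≠ 0) {h : ℝ → ℝ} (hh : Continuous h)
    (p : ℝ × ℝ) : shearHomeomorph θ hm hh p = shearMap θ m h p := rfl

/-- Pushing a test function forward along the shear yields a test function `χ`, because the shear
maps `I × ℝ` into itself; the derivatives of `φ = χ ∘ shearMap θ m h` are given by the chain
rule. -/
theorem exists_test_pushforward {α β θ m : ℝ} (hαθ : α < θ) (hθβ : θ < β) (hm : 0 < m)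
    (hm1 : m ≤ 1) {h : ℝ → ℝ} (hh : ContDiff ℝ ∞ h) {φ : ℝ × ℝ → ℂ} (hφ : IsTest α β φ) :
    ∃ χ, IsTest α β χ ∧ (∀ p, φ p = χ (shearMap θ m h p)) ∧
      (∀ p, dX φ p = dX χ (shearMap θ m h p)) ∧
      ∀ p, dSigma φ p = m • dSigma χ (shearMap θ m h p) - deriv h p.1 • dX φ p := by
  have hχ : IsTest α β (φ ∘ (shearHomeomorph θ hm.ne' hh.continuous).symm) :=
    { smooth := by
        refine hφ.smooth.comp ?_
        change ContDiff ℝ ∞ fun p : ℝ × ℝ =>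
          (θ + m⁻¹ * (p.1 - θ), p.2 + h (θ + m⁻¹ * (p.1 - θ)))
        have h1 : ContDiff ℝ ∞ fun p : ℝ × ℝ => θ + m⁻¹ * (p.1 - θ) :=
          contDiff_const.add (contDiff_const.mul (contDiff_fst.sub contDiff_const))
        exact h1.prodMk (contDiff_snd.add (hh.comp h1))
      compact := hφ.compact.comp_homeomorph _
      support := by
        rw [tsupport_comp_eq_preimage]
        intro p hp
        have h1 := (hφ.support hp).1
        refine ⟨?_, Set.mem_univ _⟩
        have h2 := mem_Ioo_of_contraction hαθ hθβ hm hm1 h1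
        have h3 : shearMap θ m h ((shearHomeomorph θ hm.ne' hh.continuous).symm p) = p :=
          (shearHomeomorph θ hm.ne' hh.continuous).apply_symm_apply p
        have h4 := congrArg Prod.fst h3
        simp only [shearMap] at h4
        rwa [h4] at h2 }
  obtain ⟨χ, hχdef⟩ : ∃ χ, χ = φ ∘ (shearHomeomorph θ hm.ne' hh.continuous).symm := ⟨_, rfl⟩
  rw [← hχdef] at hχ
  have e0 : ∀ p, φ p = χ (shearMap θ m h p) := by
    intro p
    rw [hχdef, ← shearHomeomorph_apply θ hm.ne' hh.continuous, Function.comp_apply,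
      Homeomorph.symm_apply_apply]
  have e0' : ∀ a b, φ (a, b) = χ (θ + m * (a - θ), b - h a) := fun a b => e0 (a, b)
  have hdX : ∀ p, dX φ p = dX χ (shearMap θ m h p) := by
    intro p
    refine dX_eq_of_hasDerivAt (hφ.differentiableAt p) ?_
    simp only [e0']
    have := hasDerivAt_comp_curve (φ := χ) (a := fun _ => θ + m * (p.1 - θ))
      (b := fun x => x - h p.1) (s := p.2) (hχ.differentiableAt _) (hasDerivAt_const _ _)
      ((hasDerivAt_id _).sub_const _)
    simp only [one_smul, zero_smul, zero_add] at this
    exact this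
  refine ⟨χ, hχ, e0, hdX, fun p => ?_⟩
  rw [sub_eq_add_neg, ← neg_smul, hdX]
  refine dSigma_eq_of_hasDerivAt (hφ.differentiableAt p) ?_
  simp only [e0']
  refine hasDerivAt_comp_curve (φ := χ) (a := fun σ => θ + m * (σ - θ))
    (b := fun σ => p.2 - h σ) (s := p.1) (hχ.differentiableAt _) ?_ ?_
  · simpa using (((hasDerivAt_id p.1).sub_const θ).const_mul m).const_add θ
  · simpa using ((hh.differentiable (by simp) p.1).hasDerivAt).const_sub p.2

/-- Change of variables along a shear, for integrands supported in `I × ℝ`. -/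
theorem setIntegral_comp_shear {α β θ m : ℝ} (hm : 0 < m) {h : ℝ → ℝ} (hh : Continuous h)
    {G : ℝ × ℝ → ℂ} (h1 : ∀ p ∉ Set.Ioo α β ×ˢ (Set.univ : Set ℝ), G p = 0)
    (h2 : ∀ p ∉ Set.Ioo α β ×ˢ (Set.univ : Set ℝ), G (shearMap θ m h p) = 0) :
    ∫ p in Set.Ioo α β ×ˢ Set.univ, G (shearMap θ m h p) =
      m⁻¹ • ∫ p in Set.Ioo α β ×ˢ Set.univ, G p := by
  rw [setIntegral_eq_integral_of_forall_compl_eq_zero h1,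
    setIntegral_eq_integral_of_forall_compl_eq_zero h2,
    (measurePreserving_shearMap θ hm hh.measurable).integral_comp
      (shearHomeomorph θ hm.ne' hh).measurableEmbedding G, integral_smul_measure,
    ENNReal.toReal_ofReal (inv_pos.2 hm).le]

theorem memLp_comp_shear {α β θ m lam : ℝ} (hαθ : α < θ) (hθβ : θ < β) (hm : 0 < m)
    (hm1 : m ≤ 1) {h : ℝ → ℝ} (hh : Continuous h) {u : ℝ × ℝ → ℂ} (hu : Measurable u)
    (hu2 : MemLp u 2 (weightMeasure₂ α β lam)) :
    MemLp (fun p => u (shearMap θ m h p)) 2 (weightMeasure₂ α β lam) := by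
  obtain ⟨H, hH⟩ := isCompact_Icc.exists_bound_of_continuousOn (s := Set.Icc α β) hh.continuousOn
  have hA : IsAveraging (weightMeasure₂ α β lam) (Measure.dirac ()) (fun _ _ => 1)
      (fun p _ => shearMap θ m h p) (fun _ => 1)
      (fun _ => m⁻¹ * Real.exp (2 * |lam| * H)) :=
    isAveraging_shear lam hαθ hθβ (m := fun _ => m) (h := fun σ _ => h σ) (H := fun _ => H)
      measurable_const measurable_const (fun _ => hm) (fun _ => hm1)
      (hh.measurable.comp measurable_fst) measurable_const measurable_const (by simp)
      (fun σ hσ _ => hH σ (Set.Ioo_subset_Icc_self hσ)) (fun _ => le_rfl) (integrable_const _)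
  have := hA.memLp_integral hu hu2
  simpa using this

/-- The chain rule for the weak `∂_x` along a shear, in weak form. -/
theorem integral_comp_shear_dX {α β θ m : ℝ} (hαθ : α < θ) (hθβ : θ < β) (hm : 0 < m)
    (hm1 : m ≤ 1) {h ρ : ℝ → ℝ} (hh : ContDiff ℝ ∞ h) (hρ : ContDiff ℝ ∞ ρ) {u ux : ℝ × ℝ → ℂ}
    (hx : IsWeakPDeriv α β 0 1 u ux) {φ : ℝ × ℝ → ℂ} (hφ : IsTest α β φ) :
    ∫ p in Set.Ioo α β ×ˢ Set.univ, ρ p.1 • u (shearMap θ m h p) * dX φ p =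
      -∫ p in Set.Ioo α β ×ˢ Set.univ, ρ p.1 • ux (shearMap θ m h p) * φ p := by
  have hφ1 := hφ.mul_sigma hρ
  obtain ⟨χ, hχ, e0, hdX, -⟩ := exists_test_pushforward hαθ hθβ hm hm1 hh hφ1
  have e1 : ∀ p, ρ p.1 • dX φ p = dX χ (shearMap θ m h p) := fun p => by
    rw [← hdX, dX_mul_sigma hφ.smooth hρ]
  have c1 := setIntegral_comp_shear (α := α) (β := β) (θ := θ) hm hh.continuous
    (G := fun p => u p * dX χ p)
    (fun p hp => by rw [hχ.dX.eq_zero hp, mul_zero])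
    (fun p hp => by rw [← e1, hφ.dX.eq_zero hp, smul_zero, mul_zero])
  have c2 := setIntegral_comp_shear (α := α) (β := β) (θ := θ) hm hh.continuous
    (G := fun p => ux p * χ p)
    (fun p hp => by rw [hχ.eq_zero hp, mul_zero])
    (fun p hp => by rw [← e0, hφ.eq_zero hp, smul_zero, mul_zero])
  simp only [← e1] at c1
  simp only [← e0] at c2
  simp only [smul_mul_assoc, ← mul_smul_comm]
  rw [c1, c2, hx.x_eq hχ, smul_neg]

/-- The chain rule for the weak `∂_σ` along a shear, in weak form. -/
theorem integral_comp_shear_dSigma {α β θ m lam : ℝ} (hαθ : α < θ) (hθβ : θ < β) (hm : 0 < m)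
    (hm1 : m ≤ 1) {h ρ : ℝ → ℝ} (hh : ContDiff ℝ ∞ h) (hρ : ContDiff ℝ ∞ ρ)
    {u us ux : ℝ × ℝ → ℂ} (hu : Measurable u) (hu2 : MemLp u 2 (weightMeasure₂ α β lam))
    (hs : IsWeakPDeriv α β 1 0 u us) (hx : IsWeakPDeriv α β 0 1 u ux)
    {φ : ℝ × ℝ → ℂ} (hφ : IsTest α β φ) :
    ∫ p in Set.Ioo α β ×ˢ Set.univ, ρ p.1 • u (shearMap θ m h p) * dSigma φ p =
      -(∫ p in Set.Ioo α β ×ˢ Set.univ, (ρ p.1 * m) • us (shearMap θ m h p) * φ p)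
      - (∫ p in Set.Ioo α β ×ˢ Set.univ,
          (-(ρ p.1 * deriv h p.1)) • ux (shearMap θ m h p) * φ p)
      - ∫ p in Set.Ioo α β ×ˢ Set.univ, deriv ρ p.1 • u (shearMap θ m h p) * φ p := by
  have hρ' : ContDiff ℝ ∞ (deriv ρ) := (contDiff_infty_iff_deriv.1 hρ).2
  have hh' : ContDiff ℝ ∞ (deriv h) := (contDiff_infty_iff_deriv.1 hh).2
  have hφ1 := hφ.mul_sigma hρ
  have hφ3 := hφ.mul_sigma hρ'
  obtain ⟨χ, hχ, e0, -, hds'⟩ := exists_test_pushforward hαθ hθβ hm hm1 hh hφ1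
  have hds : ∀ p, ρ p.1 • dSigma φ p = m • dSigma χ (shearMap θ m h p) -
      deriv h p.1 • ρ p.1 • dX φ p - deriv ρ p.1 • φ p := fun p => by
    rw [eq_sub_iff_add_eq, ← dSigma_mul_sigma hφ.smooth hρ, hds', dX_mul_sigma hφ.smooth hρ]
  -- the three parts of the integrand
  have hU := memLp_comp_shear hαθ hθβ hm hm1 hh.continuous hu hu2
  have i2 := integrable_mul_test' hU ((hφ.dX.mul_sigma hρ).mul_sigma hh')
  have i3 := integrable_mul_test' hU hφ3
  have i1 := integrable_mul_test' hU (hφ.dSigma.mul_sigma hρ)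
  have c1 := setIntegral_comp_shear (α := α) (β := β) (θ := θ) hm hh.continuous
    (G := fun p => u p * dSigma χ p)
    (fun p hp => by rw [hχ.dSigma.eq_zero hp, mul_zero])
    (fun p hp => by
      have h1 := hds p
      rw [hφ.dSigma.eq_zero hp, hφ.dX.eq_zero hp, hφ.eq_zero hp] at h1
      simp only [smul_zero, sub_zero] at h1
      rw [(smul_eq_zero.1 h1.symm).resolve_left hm.ne', mul_zero])
  have c2 := setIntegral_comp_shear (α := α) (β := β) (θ := θ) hm hh.continuous
    (G := fun p => us p * χ p)
    (fun p hp => by rw [hχ.eq_zero hp, mul_zero])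
    (fun p hp => by rw [← e0, hφ.eq_zero hp, smul_zero, mul_zero])
  have hxpart := integral_comp_shear_dX hαθ hθβ hm hm1 hh (hh'.mul hρ) hx hφ
  have hsum : ∫ p in Set.Ioo α β ×ˢ Set.univ, ρ p.1 • u (shearMap θ m h p) * dSigma φ p =
      m • (∫ p in Set.Ioo α β ×ˢ Set.univ, u (shearMap θ m h p) * dSigma χ (shearMap θ m h p))
      - (∫ p in Set.Ioo α β ×ˢ Set.univ,
          u (shearMap θ m h p) * (deriv h p.1 • ρ p.1 • dX φ p))
      - ∫ p in Set.Ioo α β ×ˢ Set.univ, u (shearMap θ m h p) * (deriv ρ p.1 • φ p) := by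
    have i4 : Integrable (fun p => m • (u (shearMap θ m h p) * dSigma χ (shearMap θ m h p)))
        (volume.restrict (Set.Ioo α β ×ˢ Set.univ)) := by
      refine ((i1.add i2).add i3).congr (Eventually.of_forall fun p => ?_)
      have h1 := hds p
      simp only [Pi.add_apply]
      rw [h1, ← mul_smul_comm]
      ring
    rw [← integral_smul, ← integral_sub i4 i2, ← integral_sub (f := fun p =>
      m • (u (shearMap θ m h p) * dSigma χ (shearMap θ m h p)) -
        u (shearMap θ m h p) * (deriv h p.1 • ρ p.1 • dX φ p)) (i4.sub i2) i3]
    refine integral_congr_ae (Eventually.of_forall fun p => ?_)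
    simp only
    rw [smul_mul_assoc, ← mul_smul_comm, hds p, ← mul_smul_comm]
    ring
  rw [hsum, c1, hs.sigma_eq hχ]
  have r1 : ∫ p in Set.Ioo α β ×ˢ Set.univ, (ρ p.1 * m) • us (shearMap θ m h p) * φ p =
      ∫ p in Set.Ioo α β ×ˢ Set.univ, us p * χ p := by
    have : (∫ p in Set.Ioo α β ×ˢ Set.univ, (ρ p.1 * m) • us (shearMap θ m h p) * φ p) =
        m • ∫ p in Set.Ioo α β ×ˢ Set.univ, us (shearMap θ m h p) * χ (shearMap θ m h p) := by
      rw [← integral_smul]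
      refine integral_congr_ae (Eventually.of_forall fun p => ?_)
      simp only [← e0, Complex.real_smul]
      push_cast
      ring
    rw [this, c2, smul_smul, mul_inv_cancel₀ hm.ne', one_smul]
  have r2 : ∫ p in Set.Ioo α β ×ˢ Set.univ,
      u (shearMap θ m h p) * (deriv h p.1 • ρ p.1 • dX φ p) =
      ∫ p in Set.Ioo α β ×ˢ Set.univ,
          (-(ρ p.1 * deriv h p.1)) • ux (shearMap θ m h p) * φ p := by
    have : ∫ p in Set.Ioo α β ×ˢ Set.univ,
        u (shearMap θ m h p) * (deriv h p.1 • ρ p.1 • dX φ p) =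
        ∫ p in Set.Ioo α β ×ˢ Set.univ,
          (deriv h p.1 * ρ p.1) • u (shearMap θ m h p) * dX φ p := by
      refine integral_congr_ae (Eventually.of_forall fun p => ?_)
      simp only [Complex.real_smul]
      push_cast
      ring
    rw [this, hxpart, ← integral_neg]
    refine integral_congr_ae (Eventually.of_forall fun p => ?_)
    simp only [Complex.real_smul]
    push_cast
    ring
  have r3 : ∫ p in Set.Ioo α β ×ˢ Set.univ, u (shearMap θ m h p) * (deriv ρ p.1 • φ p) =
      ∫ p in Set.Ioo α β ×ˢ Set.univ, deriv ρ p.1 • u (shearMap θ m h p) * φ p := by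
    refine integral_congr_ae (Eventually.of_forall fun p => ?_)
    simp only [smul_mul_assoc, mul_smul_comm]
  rw [r1, r2, r3, smul_smul, mul_inv_cancel₀ hm.ne', one_smul]

/-! ### The chain rule for averaging operators -/

section AveragedChainRule

variable {Z : Type*} [MeasurableSpace Z] {ν : Measure Z} [IsProbabilityMeasure ν]
  {α β θ m lam : ℝ}

theorem integral_add_add {X : Type*} [MeasurableSpace X] {μ : Measure X} {f g k : X → ℂ}
    (hf : Integrable f μ) (hg : Integrable g μ) (hk : Integrable k μ) :
    ∫ a, (f a + g a + k a) ∂μ = ∫ a, f a ∂μ + ∫ a, g a ∂μ + ∫ a, k a ∂μ := by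
  rw [← integral_add hf hg, ← integral_add (f := fun a => f a + g a) (hf.add hg) hk]

theorem integral_neg_sub_sub {X : Type*} [MeasurableSpace X] {μ : Measure X} {f g k : X → ℂ}
    (hf : Integrable f μ) (hg : Integrable g μ) (hk : Integrable k μ) :
    ∫ a, (-f a - g a - k a) ∂μ = -∫ a, f a ∂μ - ∫ a, g a ∂μ - ∫ a, k a ∂μ := by
  rw [← integral_neg, ← integral_sub (f := fun a => -f a) hf.neg hg,
    ← integral_sub (f := fun a => -f a - g a) (hf.neg.sub hg) hk]

/-- `∂_x` commutes with averages along shears. -/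
theorem isWeakPDeriv_average_x (hαθ : α < θ) (hθβ : θ < β) (hm : 0 < m) (hm1 : m ≤ 1)
    {h ρ : ℝ → Z → ℝ} {R C : Z → ℝ} (hh : ∀ z, ContDiff ℝ ∞ fun σ => h σ z)
    (hρ : ∀ z, ContDiff ℝ ∞ fun σ => ρ σ z)
    (hA : IsAveraging (weightMeasure₂ α β lam) ν (fun p z => ρ p.1 z)
      (fun p z => shearMap θ m (fun σ => h σ z) p) R C)
    {u ux : ℝ × ℝ → ℂ} (hu : Measurable u) (hu2 : MemLp u 2 (weightMeasure₂ α β lam))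
    (hux : Measurable ux) (hux2 : MemLp ux 2 (weightMeasure₂ α β lam))
    (hx : IsWeakPDeriv α β 0 1 u ux) :
    IsWeakPDeriv α β 0 1
      (fun p => ∫ z, ρ p.1 z • u (shearMap θ m (fun σ => h σ z) p) ∂ν)
      (fun p => ∫ z, ρ p.1 z • ux (shearMap θ m (fun σ => h σ z) p) ∂ν) := by
  intro φ hφ
  simp only [Function.iterate_zero, Function.iterate_one, id]
  rw [hA.integral_integral_mul₂ hu hu2 hφ.dX.smooth.continuous hφ.dX.compact,
    hA.integral_integral_mul₂ hux hux2 hφ.smooth.continuous hφ.compact]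
  simp only [integral_comp_shear_dX hαθ hθβ hm hm1 (hh _) (hρ _) hx hφ]
  rw [integral_neg]
  simp

/-- The weak `∂_σ` of an average along shears. -/
theorem isWeakPDeriv_average_sigma (hαθ : α < θ) (hθβ : θ < β) (hm : 0 < m) (hm1 : m ≤ 1)
    {h ρ : ℝ → Z → ℝ} {R C R₁ C₁ R₂ C₂ R₃ C₃ : Z → ℝ}
    (hh : ∀ z, ContDiff ℝ ∞ fun σ => h σ z) (hρ : ∀ z, ContDiff ℝ ∞ fun σ => ρ σ z)
    (hA : IsAveraging (weightMeasure₂ α β lam) ν (fun p z => ρ p.1 z)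
      (fun p z => shearMap θ m (fun σ => h σ z) p) R C)
    (hA₁ : IsAveraging (weightMeasure₂ α β lam) ν (fun p z => ρ p.1 z * m)
      (fun p z => shearMap θ m (fun σ => h σ z) p) R₁ C₁)
    (hA₂ : IsAveraging (weightMeasure₂ α β lam) ν
      (fun p z => -(ρ p.1 z * deriv (fun σ => h σ z) p.1))
      (fun p z => shearMap θ m (fun σ => h σ z) p) R₂ C₂)
    (hA₃ : IsAveraging (weightMeasure₂ α β lam) ν (fun p z => deriv (fun σ => ρ σ z) p.1)
      (fun p z => shearMap θ m (fun σ => h σ z) p) R₃ C₃)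
    {u us ux : ℝ × ℝ → ℂ} (hu : Measurable u) (hu2 : MemLp u 2 (weightMeasure₂ α β lam))
    (hus : Measurable us) (hus2 : MemLp us 2 (weightMeasure₂ α β lam))
    (hux : Measurable ux) (hux2 : MemLp ux 2 (weightMeasure₂ α β lam))
    (hs : IsWeakPDeriv α β 1 0 u us) (hx : IsWeakPDeriv α β 0 1 u ux) :
    IsWeakPDeriv α β 1 0
      (fun p => ∫ z, ρ p.1 z • u (shearMap θ m (fun σ => h σ z) p) ∂ν)
      (fun p => (∫ z, (ρ p.1 z * m) • us (shearMap θ m (fun σ => h σ z) p) ∂ν) +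
        (∫ z, (-(ρ p.1 z * deriv (fun σ => h σ z) p.1)) •
          ux (shearMap θ m (fun σ => h σ z) p) ∂ν) +
        ∫ z, deriv (fun σ => ρ σ z) p.1 • u (shearMap θ m (fun σ => h σ z) p) ∂ν) := by
  intro φ hφ
  have hc := hφ.smooth.continuous
  have hk := hφ.compact
  have j1 := (hA₁.integrable_mul_test₂ hus hus2 hc hk).integral_prod_right
  have j2 := (hA₂.integrable_mul_test₂ hux hux2 hc hk).integral_prod_right
  have j3 := (hA₃.integrable_mul_test₂ hu hu2 hc hk).integral_prod_right
  have i1 := integrable_mul_test' (hA₁.memLp_integral hus hus2) hφ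
  have i2 := integrable_mul_test' (hA₂.memLp_integral hux hux2) hφ
  have i3 := integrable_mul_test' (hA₃.memLp_integral hu hu2) hφ
  simp only [Function.iterate_zero, Function.iterate_one, id]
  rw [hA.integral_integral_mul₂ hu hu2 hφ.dSigma.smooth.continuous hφ.dSigma.compact]
  simp only [integral_comp_shear_dSigma hαθ hθβ hm hm1 (hh _) (hρ _) hu hu2 hs hx hφ]
  simp only [add_mul]
  rw [integral_add_add i1 i2 i3,
    hA₁.integral_integral_mul₂ hus hus2 hc hk, hA₂.integral_integral_mul₂ hux hux2 hc hk,
    hA₃.integral_integral_mul₂ hu hu2 hc hk]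
  rw [integral_neg_sub_sub j1 j2 j3]
  ring

end AveragedChainRule

/-! ### The fundamental theorem of calculus for weak derivatives -/

theorem integral_unitInterval (f : ℝ → ℂ) : ∫ r : unitInterval, f r = ∫ r in (0 : ℝ)..1, f r := by
  have h := integral_subtype (s := unitInterval) measurableSet_Icc f
  rw [h, intervalIntegral.integral_of_le zero_le_one, ← integral_Icc_eq_integral_Ioc]

/-- The fundamental theorem of calculus for the pairing of `u` with a family of test functions. -/
theorem integral_mul_sub_eq {α β lam : ℝ} {u : ℝ × ℝ → ℂ} (hu : Measurable u)
    (hu2 : MemLp u 2 (weightMeasure₂ α β lam)) {χ ψ : ℝ → ℝ × ℝ → ℂ} {K : Set (ℝ × ℝ)}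
    (hK : IsCompact K) (hKΩ : K ⊆ Set.Ioo α β ×ˢ Set.univ)
    (hχ : ∀ r p, HasDerivAt (fun r => χ r p) (ψ r p) r)
    (hψ : Continuous (Function.uncurry ψ)) (hψK : ∀ r ∈ unitInterval, ∀ p ∉ K, ψ r p = 0)
    (h0 : IsTest α β (χ 0)) (h1 : IsTest α β (χ 1)) :
    (∫ p in Set.Ioo α β ×ˢ Set.univ, u p * χ 1 p) - ∫ p in Set.Ioo α β ×ˢ Set.univ, u p * χ 0 p =
      ∫ r : unitInterval, ∫ p in Set.Ioo α β ×ˢ Set.univ, u p * ψ r p := by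
  obtain ⟨M, hM⟩ := (isCompact_Icc.prod hK : IsCompact (Set.Icc (0 : ℝ) 1 ×ˢ K)
    ).exists_bound_of_continuousOn hψ.continuousOn
  have hψm : Measurable fun q : (ℝ × ℝ) × unitInterval => ψ q.2 q.1 :=
    (hψ.comp (by fun_prop : Continuous fun q : (ℝ × ℝ) × unitInterval =>
      ((q.2 : ℝ), q.1))).measurable
  have hint : Integrable (fun q : (ℝ × ℝ) × unitInterval => u q.1 * ψ q.2 q.1)
      ((volume.restrict (Set.Ioo α β ×ˢ Set.univ)).prod volume) := by
    have hK1 : IntegrableOn u K volume :=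
      (locallyIntegrableOn_of_memLp hu2).integrableOn_compact_subset hKΩ hK
    have hK2 : Integrable (K.indicator u) (volume.restrict (Set.Ioo α β ×ˢ Set.univ)) :=
      (hK1.integrable_indicator hK.measurableSet).restrict
    have hK3 := (hK2.comp_fst (volume : Measure unitInterval)).norm.const_mul M
    refine hK3.mono' ((hu.comp measurable_fst).mul hψm).aestronglyMeasurable
      (Eventually.of_forall fun q => ?_)
    by_cases hq : q.1 ∈ K
    · rw [Set.indicator_of_mem hq, norm_mul, mul_comm]
      exact mul_le_mul_of_nonneg_right (hM ((q.2 : ℝ), q.1) ⟨q.2.2, hq⟩) (norm_nonneg _)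
    · rw [hψK q.2 q.2.2 q.1 hq, Set.indicator_of_notMem hq]
      simp
  rw [← integral_sub (integrable_mul_test' hu2 h1) (integrable_mul_test' hu2 h0),
    ← integral_integral_swap (f := fun p (r : unitInterval) => u p * ψ r p) hint]
  refine integral_congr_ae (Eventually.of_forall fun p => ?_)
  have hFTC : ∫ r in (0 : ℝ)..1, ψ r p = χ 1 p - χ 0 p :=
    intervalIntegral.integral_eq_sub_of_hasDerivAt (fun r _ => hχ r p)
      ((hψ.comp (by fun_prop : Continuous fun r : ℝ => (r, p))).intervalIntegrable _ _)
  simp only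
  rw [integral_const_mul, integral_unitInterval (fun r => ψ r p), hFTC, mul_sub]

theorem shearMap_one (θ : ℝ) (h : ℝ → ℝ) (p : ℝ × ℝ) :
    shearMap θ 1 h p = (p.1, p.2 - h p.1) := by
  unfold shearMap
  ext <;> simp

theorem IsTest.comp_shear {α β : ℝ} {φ : ℝ × ℝ → ℂ} (hφ : IsTest α β φ) {h : ℝ → ℝ}
    (hh : ContDiff ℝ ∞ h) : IsTest α β fun p => φ (p.1, p.2 + h p.1) where
  smooth := hφ.smooth.comp (contDiff_fst.prodMk (contDiff_snd.add (hh.comp contDiff_fst)))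
  compact := by
    have hc := hφ.compact.comp_homeomorph
      (shearHomeomorph 0 one_ne_zero (hh.neg.continuous : Continuous fun σ => -h σ))
    convert hc using 1
    funext p
    simp [Function.comp_apply, shearHomeomorph_apply, shearMap_one]
  support := by
    have hcont : Continuous fun p : ℝ × ℝ => (p.1, p.2 + h p.1) :=
      continuous_fst.prodMk (continuous_snd.add (hh.continuous.comp continuous_fst))
    refine (tsupport_comp_subset_preimage φ hcont).trans fun p hp => ?_
    exact ⟨(hφ.support hp).1, Set.mem_univ _⟩

/-- The fundamental theorem of calculus for the weak `∂_x`, along a shear. -/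
theorem comp_shear_sub_eq {α β θ lam : ℝ} (hαθ : α < θ) (hθβ : θ < β) {h : ℝ → ℝ}
    (hh : ContDiff ℝ ∞ h) {u ux : ℝ × ℝ → ℂ}
    (hu : Measurable u) (hu2 : MemLp u 2 (weightMeasure₂ α β lam))
    (hux : Measurable ux) (hux2 : MemLp ux 2 (weightMeasure₂ α β lam))
    (hx : IsWeakPDeriv α β 0 1 u ux) :
    ∀ᵐ p ∂weightMeasure₂ α β lam, u (p.1, p.2 - h p.1) - u p =
      ∫ r : unitInterval, (-h p.1) • ux (p.1, p.2 - r * h p.1) := by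
  obtain ⟨H, hH⟩ := isCompact_Icc.exists_bound_of_continuousOn (s := Set.Icc α β)
    hh.continuous.continuousOn
  have hH' : ∀ σ ∈ Set.Ioo α β, |h σ| ≤ H := fun σ hσ => hH σ (Set.Ioo_subset_Icc_self hσ)
  have hA : IsAveraging (weightMeasure₂ α β lam) (volume : Measure unitInterval)
      (fun p _ => -h p.1) (fun p r => shearMap θ 1 (fun σ => (r : ℝ) * h σ) p) (fun _ => H)
      (fun _ => 1⁻¹ * Real.exp (2 * |lam| * H)) := by
    refine isAveraging_shear lam hαθ hθβ (m := fun _ => 1) 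
      (h := fun σ (r : unitInterval) => (r : ℝ) * h σ)
      (H := fun _ => H) ?_ measurable_const (fun _ => one_pos) (fun _ => le_rfl) ?_
      measurable_const measurable_const ?_ ?_ (fun _ => le_rfl) ?_
    · exact (hh.continuous.measurable.comp (measurable_fst.comp measurable_fst)).neg
    · exact (measurable_subtype_coe.comp measurable_snd).mul
        (hh.continuous.measurable.comp measurable_fst)
    · intro p hp _
      rw [abs_neg]
      exact hH' _ hp
    · intro σ hσ r
      rw [abs_mul, abs_of_nonneg r.2.1]
      exact (mul_le_of_le_one_left (abs_nonneg _) r.2.2).trans (hH' σ hσ)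
    · exact integrable_const _
  have hcomp := memLp_comp_shear (lam := lam) hαθ hθβ one_pos le_rfl hh.continuous hu hu2
  have hrhs := hA.memLp_integral hux hux2
  simp only [shearMap_one] at hA hcomp hrhs
  refine ae_eq_of_integral_test (hcomp.sub hu2) hrhs fun φ hφ => ?_
  have hrh : ∀ r : ℝ, ContDiff ℝ ∞ fun σ => r * h σ := fun r => contDiff_const.mul hh
  rw [hA.integral_integral_mul₂ hux hux2 hφ.smooth.continuous hφ.compact]
  -- the pairing of `u` with `φ` transported along the shears
  have hcont : Continuous fun q : ℝ × ℝ × ℝ => (q.2.1, q.2.2 + q.1 * h q.2.1) := by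
    have := hh.continuous
    fun_prop
  have hFTC := integral_mul_sub_eq hu hu2 (χ := fun r p => φ (p.1, p.2 + r * h p.1))
    (ψ := fun r p => h p.1 • dX φ (p.1, p.2 + r * h p.1))
    (K := (fun q : ℝ × ℝ × ℝ => (q.2.1, q.2.2 - q.1 * h q.2.1)) '' (Set.Icc 0 1 ×ˢ tsupport φ))
    ((isCompact_Icc.prod hφ.compact).image (by have := hh.continuous; fun_prop)) ?_ ?_ ?_ ?_ ?_ ?_
  rotate_left
  · rintro _ ⟨q, hq, rfl⟩
    exact ⟨(hφ.support hq.2).1, Set.mem_univ _⟩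
  · intro r p
    have := hasDerivAt_comp_curve (φ := φ) (a := fun _ => p.1) (b := fun r => p.2 + r * h p.1)
      (s := r) (hφ.differentiableAt _) (hasDerivAt_const _ _)
      (((hasDerivAt_id r).mul_const (h p.1)).const_add p.2)
    simpa only [one_mul, zero_smul, zero_add] using this
  · exact (hh.continuous.comp (continuous_fst.comp continuous_snd)).smul
      (hφ.dX.smooth.continuous.comp hcont)
  · intro r hr p hp
    by_contra hne
    refine hp ⟨(r, (p.1, p.2 + r * h p.1)), ⟨hr, ?_⟩, by simp⟩
    by_contra hn
    refine hne ?_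
    have hz : dX φ (p.1, p.2 + r * h p.1) = 0 :=
      image_eq_zero_of_notMem_tsupport
        fun h' => hn (tsupport_fderiv_apply_subset ℝ ((0, 1) : ℝ × ℝ) h')
    simp only [hz, smul_zero]
  · exact hφ.comp_shear (hrh 0)
  · exact hφ.comp_shear (hrh 1)
  simp only [zero_mul, add_zero, one_mul, Prod.mk.eta] at hFTC
  have hshift : ∫ p in Set.Ioo α β ×ˢ Set.univ, u (p.1, p.2 - h p.1) * φ p =
      ∫ p in Set.Ioo α β ×ˢ Set.univ, u p * φ (p.1, p.2 + h p.1) := by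
    have hT := hφ.comp_shear hh
    have := setIntegral_comp_shear (α := α) (β := β) (θ := θ) one_pos hh.continuous
      (G := fun p => u p * φ (p.1, p.2 + h p.1))
      (fun p hp => by rw [hT.eq_zero hp, mul_zero])
      (fun p hp => by
        rw [shearMap_one]
        simp only [sub_add_cancel, Prod.mk.eta]
        rw [hφ.eq_zero hp, mul_zero])
    simpa [shearMap_one] using this
  have hlhs : ∫ p in Set.Ioo α β ×ˢ Set.univ, (u (p.1, p.2 - h p.1) - u p) * φ p =
      (∫ p in Set.Ioo α β ×ˢ Set.univ, u p * φ (p.1, p.2 + h p.1)) -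
        ∫ p in Set.Ioo α β ×ˢ Set.univ, u p * φ p := by
    rw [← hshift, ← integral_sub (integrable_mul_test' hcomp hφ) (integrable_mul_test' hu2 hφ)]
    simp only [sub_mul]
  refine hlhs.trans (hFTC.trans ?_)
  refine integral_congr_ae (Eventually.of_forall fun r => ?_)
  have hT := hφ.comp_shear (hrh r)
  have hT2 := hT.mul_sigma hh
  have e1 : ∀ p, h p.1 • dX φ (p.1, p.2 + r * h p.1) =
      dX (fun p => h p.1 • φ (p.1, p.2 + r * h p.1)) p := by
    intro p
    rw [dX_mul_sigma hT.smooth hh]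
    congr 1
    refine (dX_eq_of_hasDerivAt (hT.differentiableAt p) ?_).symm
    have := hasDerivAt_comp_curve (φ := φ) (a := fun _ => p.1) (b := fun x => x + r * h p.1)
      (s := p.2) (hφ.differentiableAt _) (hasDerivAt_const _ _) ((hasDerivAt_id _).add_const _)
    simpa only [one_smul, zero_smul, zero_add] using this
  simp only [e1]
  rw [hx.x_eq hT2]
  have := setIntegral_comp_shear (α := α) (β := β) (θ := θ) one_pos (hrh r).continuous
    (G := fun p => ux p * (h p.1 • φ (p.1, p.2 + r * h p.1)))
    (fun p hp => by rw [hT2.eq_zero hp, mul_zero])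
    (fun p hp => by
      rw [shearMap_one]
      simp only [sub_add_cancel, Prod.mk.eta]
      rw [hφ.eq_zero hp, smul_zero, mul_zero])
  simp only [shearMap_one, sub_add_cancel, Prod.mk.eta, inv_one, one_smul] at this
  rw [← this, ← integral_neg]
  refine integral_congr_ae (Eventually.of_forall fun p => ?_)
  simp only [neg_smul, smul_mul_assoc, mul_smul_comm, neg_mul]

theorem IsTest.comp_dilation {α β θ E : ℝ} (hαθ : α < θ) (hθβ : θ < β) (hE : 1 ≤ E)
    {φ : ℝ × ℝ → ℂ} (hφ : IsTest α β φ) :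
    IsTest α β fun p => φ (θ + E * (p.1 - θ), p.2) := by
  have hE0 : 0 < E := one_pos.trans_le hE
  obtain ⟨χ, hχ, e0, -, -⟩ := exists_test_pushforward hαθ hθβ (inv_pos.2 hE0)
    (inv_le_one_of_one_le₀ hE) (contDiff_const (c := (0 : ℝ))) hφ
  convert hχ using 1
  funext p
  rw [e0]
  unfold shearMap
  congr 1
  ext
  · simp only; field_simp; ring
  · simp

/-- The fundamental theorem of calculus for the weak `∂_σ`, along the contraction towards `θ`. -/
theorem comp_contraction_sub_eq {α β θ lam c : ℝ} (hαθ : α < θ) (hθβ : θ < β) (hc : 0 ≤ c)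
    {u us : ℝ × ℝ → ℂ} (hu : Measurable u) (hu2 : MemLp u 2 (weightMeasure₂ α β lam))
    (hus : Measurable us) (hus2 : MemLp us 2 (weightMeasure₂ α β lam))
    (hs : IsWeakPDeriv α β 1 0 u us) :
    ∀ᵐ p ∂weightMeasure₂ α β lam, u (θ + Real.exp (-c) * (p.1 - θ), p.2) - u p =
      ∫ r : unitInterval, (-(c * Real.exp (-(r * c)) * (p.1 - θ))) •
        us (θ + Real.exp (-(r * c)) * (p.1 - θ), p.2) := by
  have h0c : ContDiff ℝ ∞ fun _ : ℝ => (0 : ℝ) := contDiff_const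
  have hexp : ∀ r : unitInterval, Real.exp (-(r * c)) ≤ 1 := fun r =>
    Real.exp_le_one_iff.2 (neg_nonpos.2 (mul_nonneg r.2.1 hc))
  have hexp' : ∀ r : unitInterval, Real.exp (-c) ≤ Real.exp (-(r * c)) := fun r =>
    Real.exp_le_exp.2 (neg_le_neg (mul_le_of_le_one_left hc r.2.2))
  have hA : IsAveraging (weightMeasure₂ α β lam) (volume : Measure unitInterval)
      (fun p r => -(c * Real.exp (-(r * c)) * (p.1 - θ)))
      (fun p r => shearMap θ (Real.exp (-(r * c))) (fun _ => 0) p) (fun _ => c * 1 * (β - α))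
      (fun _ => (Real.exp (-c))⁻¹ * Real.exp (2 * |lam| * 0)) := by
    refine isAveraging_shear lam hαθ hθβ (m := fun r : unitInterval => Real.exp (-(r * c)))
      (h := fun σ (r : unitInterval) => 0)
      (H := fun _ => 0) ?_ ?_ (fun _ => Real.exp_pos _) hexp measurable_const
      measurable_const measurable_const ?_ ?_ ?_ ?_
    · exact Continuous.measurable (by fun_prop)
    · exact Continuous.measurable (by fun_prop)
    · intro p hp r
      rw [abs_neg, abs_mul, abs_mul, abs_of_nonneg hc, abs_of_pos (Real.exp_pos _)]
      have : |p.1 - θ| ≤ β - α := abs_le.2 ⟨by linarith [hp.1], by linarith [hp.2]⟩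
      gcongr
      exact hexp r
    · simp
    · intro r
      gcongr
      exact mul_le_of_le_one_left hc r.2.2
    · exact integrable_const _
  have hcomp := memLp_comp_shear (lam := lam) hαθ hθβ (Real.exp_pos (-c))
    (Real.exp_le_one_iff.2 (neg_nonpos.2 hc)) (continuous_const (y := (0 : ℝ))) hu hu2
  have hrhs := hA.memLp_integral hus hus2
  have hsm : ∀ m p, shearMap θ m (fun _ => 0) p = (θ + m * (p.1 - θ), p.2) := by
    intro m p
    simp [shearMap]
  simp only [hsm] at hA hcomp hrhs
  refine ae_eq_of_integral_test (hcomp.sub hu2) hrhs fun φ hφ => ?_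
  rw [hA.integral_integral_mul₂ hus hus2 hφ.smooth.continuous hφ.compact]
  have hE : ∀ r ∈ unitInterval, 1 ≤ Real.exp (r * c) := fun r hr =>
    Real.one_le_exp (mul_nonneg hr.1 hc)
  have hinv : ∀ r a, θ + Real.exp (r * c) * (θ + Real.exp (-(r * c)) * (a - θ) - θ) = a := by
    intro r a
    rw [Real.exp_neg]
    have := (Real.exp_pos (r * c)).ne'
    field_simp
    ring
  have hinv' : ∀ r a, θ + Real.exp (-(r * c)) * (θ + Real.exp (r * c) * (a - θ) - θ) = a := by
    intro r a
    rw [Real.exp_neg]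
    have := (Real.exp_pos (r * c)).ne'
    field_simp
    ring
  have hTest : ∀ r ∈ unitInterval,
      IsTest α β fun p => φ (θ + Real.exp (r * c) * (p.1 - θ), p.2) := fun r hr =>
    hφ.comp_dilation hαθ hθβ (hE r hr)
  have hT : ∀ r ∈ unitInterval, IsTest α β fun p =>
      Real.exp (r * c) • φ (θ + Real.exp (r * c) * (p.1 - θ), p.2) := fun r hr =>
    (hTest r hr).mul_sigma (ρ := fun _ => Real.exp (r * c)) contDiff_const
  -- the pairing of `u` with `φ` transported along the contractions, with the Jacobian factor
  have hFTC := integral_mul_sub_eq hu hu2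
    (χ := fun r p => Real.exp (r * c) • φ (θ + Real.exp (r * c) * (p.1 - θ), p.2))
    (ψ := fun r p => Real.exp (r * c) • ((Real.exp (r * c) * c * (p.1 - θ)) •
        dSigma φ (θ + Real.exp (r * c) * (p.1 - θ), p.2)) +
      (Real.exp (r * c) * c) • φ (θ + Real.exp (r * c) * (p.1 - θ), p.2))
    (K := (fun q : ℝ × ℝ × ℝ => (θ + Real.exp (-(q.1 * c)) * (q.2.1 - θ), q.2.2)) ''
      (Set.Icc 0 1 ×ˢ tsupport φ))
    ((isCompact_Icc.prod hφ.compact).image (by fun_prop)) ?_ ?_ ?_ ?_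
    (hT 0 (by simp)) (hT 1 (by simp))
  rotate_left
  · rintro _ ⟨q, hq, rfl⟩
    exact ⟨mem_Ioo_of_contraction hαθ hθβ (Real.exp_pos _) (hexp ⟨q.1, hq.1⟩)
      (hφ.support hq.2).1, Set.mem_univ _⟩
  · intro r p
    have hexpd : HasDerivAt (fun r => Real.exp (r * c)) (Real.exp (r * c) * c) r := by
      simpa using ((hasDerivAt_id r).mul_const c).exp
    have := hasDerivAt_comp_curve (φ := φ) (a := fun r => θ + Real.exp (r * c) * (p.1 - θ))
      (b := fun _ => p.2)
      (s := r) (hφ.differentiableAt _) ((hexpd.mul_const (p.1 - θ)).const_add θ)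
      (hasDerivAt_const _ _)
    simp only [zero_smul, add_zero] at this
    exact hexpd.smul this
  · have h1 : Continuous fun q : ℝ × ℝ × ℝ => (θ + Real.exp (q.1 * c) * (q.2.1 - θ), q.2.2) := by
      fun_prop
    have h2 := hφ.dSigma.smooth.continuous.comp h1
    have h3 := hφ.smooth.continuous.comp h1
    have h4 : Continuous fun q : ℝ × ℝ × ℝ => Real.exp (q.1 * c) := by fun_prop
    have h5 : Continuous fun q : ℝ × ℝ × ℝ => Real.exp (q.1 * c) * c * (q.2.1 - θ) := by fun_prop
    have h6 : Continuous fun q : ℝ × ℝ × ℝ => Real.exp (q.1 * c) * c := by fun_prop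
    exact (h4.smul (h5.smul h2)).add (h6.smul h3)
  · intro r hr p hp
    have hn : (θ + Real.exp (r * c) * (p.1 - θ), p.2) ∉ tsupport φ := by
      intro hm
      refine hp ⟨(r, (θ + Real.exp (r * c) * (p.1 - θ), p.2)), ⟨hr, hm⟩, ?_⟩
      simp only [hinv', Prod.mk.eta]
    have hz : dSigma φ (θ + Real.exp (r * c) * (p.1 - θ), p.2) = 0 :=
      image_eq_zero_of_notMem_tsupport
        fun h' => hn (tsupport_fderiv_apply_subset ℝ ((1, 0) : ℝ × ℝ) h')
    simp only [hz, image_eq_zero_of_notMem_tsupport hn, smul_zero, add_zero]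
  simp only [zero_mul, Real.exp_zero, one_mul, one_smul, add_sub_cancel, Prod.mk.eta] at hFTC
  have hshift : ∫ p in Set.Ioo α β ×ˢ Set.univ,
        u (θ + Real.exp (-c) * (p.1 - θ), p.2) * φ p =
      ∫ p in Set.Ioo α β ×ˢ Set.univ,
        u p * Real.exp c • φ (θ + Real.exp c * (p.1 - θ), p.2) := by
    have hT1 := hTest 1 (by simp)
    simp only [one_mul] at hT1
    have hi1 := hinv 1
    simp only [one_mul] at hi1
    have := setIntegral_comp_shear (α := α) (β := β) (θ := θ) (Real.exp_pos (-c))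
      (continuous_const (y := (0 : ℝ)))
      (G := fun p => u p * φ (θ + Real.exp c * (p.1 - θ), p.2))
      (fun p hp => by rw [hT1.eq_zero hp, mul_zero])
      (fun p hp => by
        rw [hsm]
        simp only [hi1, Prod.mk.eta]
        rw [hφ.eq_zero hp, mul_zero])
    simp only [hsm, hi1, Prod.mk.eta, ← Real.exp_neg, neg_neg] at this
    rw [this, ← integral_smul]
    simp only [mul_smul_comm]
  have hlhs : ∫ p in Set.Ioo α β ×ˢ Set.univ,
        (u (θ + Real.exp (-c) * (p.1 - θ), p.2) - u p) * φ p =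
      (∫ p in Set.Ioo α β ×ˢ Set.univ,
        u p * Real.exp c • φ (θ + Real.exp c * (p.1 - θ), p.2)) -
        ∫ p in Set.Ioo α β ×ˢ Set.univ, u p * φ p := by
    rw [← hshift, ← integral_sub (integrable_mul_test' hcomp hφ) (integrable_mul_test' hu2 hφ)]
    simp only [sub_mul]
  refine hlhs.trans (hFTC.trans ?_)
  refine integral_congr_ae (Eventually.of_forall fun r => ?_)
  have hTr := hTest r r.2
  obtain ⟨ρ, hρdef⟩ : ∃ ρ : ℝ → ℝ, ρ = fun σ => Real.exp (r * c) * c * (σ - θ) := ⟨_, rfl⟩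
  have hρ : ContDiff ℝ ∞ ρ := by
    rw [hρdef]; exact contDiff_const.mul (contDiff_id.sub contDiff_const)
  have hρ' : ∀ σ, deriv ρ σ = Real.exp (r * c) * c := by
    intro σ
    rw [hρdef]
    simp
  have hT2 := hTr.mul_sigma hρ
  have e1 : ∀ p, Real.exp (r * c) • ((Real.exp (r * c) * c * (p.1 - θ)) •
        dSigma φ (θ + Real.exp (r * c) * (p.1 - θ), p.2)) +
      (Real.exp (r * c) * c) • φ (θ + Real.exp (r * c) * (p.1 - θ), p.2) =
      dSigma (fun p => ρ p.1 • φ (θ + Real.exp (r * c) * (p.1 - θ), p.2)) p := by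
    intro p
    rw [dSigma_mul_sigma hTr.smooth hρ, hρ']
    congr 1
    have hd : dSigma (fun p => φ (θ + Real.exp (r * c) * (p.1 - θ), p.2)) p =
        Real.exp (r * c) • dSigma φ (θ + Real.exp (r * c) * (p.1 - θ), p.2) := by
      refine dSigma_eq_of_hasDerivAt (hTr.differentiableAt p) ?_
      have := hasDerivAt_comp_curve (φ := φ) (a := fun σ => θ + Real.exp (r * c) * (σ - θ))
        (b := fun _ => p.2) (s := p.1) (hφ.differentiableAt _)
        ((((hasDerivAt_id p.1).sub_const θ).const_mul (Real.exp (r * c))).const_add θ)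
        (hasDerivAt_const _ _)
      simpa only [mul_one, zero_smul, add_zero] using this
    rw [hd, hρdef, smul_comm]
  simp only [e1]
  rw [hs.sigma_eq hT2]
  have := setIntegral_comp_shear (α := α) (β := β) (θ := θ) (Real.exp_pos (-(r * c)))
    (continuous_const (y := (0 : ℝ)))
    (G := fun p => us p * (ρ p.1 • φ (θ + Real.exp (r * c) * (p.1 - θ), p.2)))
    (fun p hp => by rw [hT2.eq_zero hp, mul_zero])
    (fun p hp => by
      rw [hsm]
      simp only [hinv, Prod.mk.eta]
      rw [hφ.eq_zero hp, smul_zero, mul_zero])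
  simp only [hsm, hinv, Prod.mk.eta, ← Real.exp_neg, neg_neg] at this
  have h' := (eq_inv_smul_iff₀ (Real.exp_pos (r * c)).ne').2 this.symm
  rw [h', ← integral_smul, ← integral_neg]
  refine integral_congr_ae (Eventually.of_forall fun p => ?_)
  have hρp : ρ (θ + Real.exp (-(r * c)) * (p.1 - θ)) = c * (p.1 - θ) := by
    rw [hρdef, Real.exp_neg]
    have := (Real.exp_pos (r * c)).ne'
    field_simp
    ring
  simp only [hρp, ← Real.exp_neg, Complex.real_smul]
  push_cast
  ring

/-! ### Taylor's formula for averages along shears -/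

/-- An almost everywhere identity which holds for each value of a parameter holds for almost all
values of the parameter simultaneously. -/
theorem ae_ae_eq_of_forall_ae {P Z : Type*} [MeasurableSpace P] [MeasurableSpace Z]
    {μ : Measure P} {ν : Measure Z} [SFinite μ] [SFinite ν] {F G : P × Z → ℂ}
    (hF : Measurable F) (hG : Measurable G) (h : ∀ z, ∀ᵐ p ∂μ, F (p, z) = G (p, z)) :
    ∀ᵐ p ∂μ, ∀ᵐ z ∂ν, F (p, z) = G (p, z) :=
  (Measure.ae_ae_comm (p := fun p z => F (p, z) = G (p, z)) (measurableSet_eq_fun hF hG)).2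
    (Eventually.of_forall h)

section Taylor

variable {Z : Type*} [MeasurableSpace Z] {ν : Measure Z}

theorem isAveraging_of_bounds {α β θ : ℝ} (lam : ℝ) (hαθ : α < θ) (hθβ : θ < β)
    {ρ : ℝ × ℝ → Z → ℝ} {m : Z → ℝ} {h : ℝ → Z → ℝ} {H : Z → ℝ} {K m₀ : ℝ}
    (hρ : Measurable (Function.uncurry ρ)) (hm : Measurable m) (hm₀ : 0 < m₀)
    (hm0 : ∀ z, m₀ ≤ m z) (hm1 : ∀ z, m z ≤ 1) (hh : Measurable (Function.uncurry h))
    (hHm : Measurable H)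
    (hρR : ∀ p : ℝ × ℝ, p.1 ∈ Set.Ioo α β → ∀ z, |ρ p z| ≤ K * Real.exp (2 * H z))
    (hH : ∀ σ ∈ Set.Ioo α β, ∀ z, |h σ z| ≤ H z)
    (hi : Integrable (fun z => Real.exp ((4 + 2 * |lam|) * H z)) ν) :
    IsAveraging (weightMeasure₂ α β lam) ν ρ (fun p z => shearMap θ (m z) (fun σ => h σ z) p)
      (fun z => K * Real.exp (2 * H z)) (fun z => m₀⁻¹ * Real.exp (2 * |lam| * H z)) := by
  refine isAveraging_shear lam hαθ hθβ hρ hm (fun z => hm₀.trans_le (hm0 z)) hm1 hh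
    (by fun_prop) (by fun_prop) hρR hH ?_ ?_
  · intro z
    gcongr
    exact hm0 z
  · have h1 := hi.const_mul (K ^ 2 * m₀⁻¹)
    refine h1.congr (Eventually.of_forall fun z => ?_)
    simp only
    rw [show (4 + 2 * |lam|) * H z = 2 * H z + 2 * H z + 2 * |lam| * H z by ring, Real.exp_add,
      Real.exp_add]
    ring

variable [IsProbabilityMeasure ν]

/-- The first order Taylor formula with integral remainder, simultaneously for almost all values
of a parameter. -/
theorem ae_shear_sub_eq {α β θ lam : ℝ} (hαθ : α < θ) (hθβ : θ < β) {h : ℝ → Z → ℝ}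
    (hh : ∀ z, ContDiff ℝ ∞ fun σ => h σ z) (hhm : Measurable (Function.uncurry h))
    {u ux : ℝ × ℝ → ℂ} (hu : Measurable u) (hu2 : MemLp u 2 (weightMeasure₂ α β lam))
    (hux : Measurable ux) (hux2 : MemLp ux 2 (weightMeasure₂ α β lam))
    (hx : IsWeakPDeriv α β 0 1 u ux) :
    ∀ᵐ p ∂weightMeasure₂ α β lam, ∀ᵐ z ∂ν, u (p.1, p.2 - h p.1 z) - u p =
      ∫ r : unitInterval, (-h p.1 z) • ux (p.1, p.2 - r * h p.1 z) := by
  have hh1 : Measurable fun q : (ℝ × ℝ) × Z => h q.1.1 q.2 :=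
    hhm.comp ((measurable_fst.comp measurable_fst).prodMk measurable_snd)
  have hh2 : Measurable fun q : ((ℝ × ℝ) × Z) × unitInterval => h q.1.1.1 q.1.2 :=
    hh1.comp measurable_fst
  refine ae_ae_eq_of_forall_ae (F := fun q => u (q.1.1, q.1.2 - h q.1.1 q.2) - u q.1)
    (G := fun q => ∫ r : unitInterval, (-h q.1.1 q.2) • ux (q.1.1, q.1.2 - r * h q.1.1 q.2))
    ?_ ?_ fun z => comp_shear_sub_eq hαθ hθβ (hh z) hu hu2 hux hux2 hx
  · exact (hu.comp ((measurable_fst.comp measurable_fst).prodMk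
      ((measurable_snd.comp measurable_fst).sub hh1))).sub (hu.comp measurable_fst)
  · refine (StronglyMeasurable.integral_prod_right'
      (f := fun q : ((ℝ × ℝ) × Z) × unitInterval => (-h q.1.1.1 q.1.2) •
        ux (q.1.1.1, q.1.1.2 - q.2 * h q.1.1.1 q.1.2))
      (Measurable.stronglyMeasurable ?_)).measurable
    exact hh2.neg.smul (hux.comp ((measurable_fst.comp (measurable_fst.comp
      measurable_fst)).prodMk ((measurable_snd.comp (measurable_fst.comp measurable_fst)).sub
        ((measurable_subtype_coe.comp measurable_snd).mul hh2))))

theorem le_exp_two_mul {a H : ℝ} (h : |a| ≤ H) : |a| ≤ Real.exp (2 * H) := by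
  have := Real.add_one_le_exp (2 * H)
  linarith [abs_nonneg a]

theorem sq_le_exp_two_mul {a H : ℝ} (h : |a| ≤ H) : a ^ 2 ≤ Real.exp (2 * H) := by
  have h1 := Real.add_one_le_exp H
  have h2 : |a| ≤ Real.exp H := by linarith [abs_nonneg a]
  rw [two_mul, Real.exp_add, ← sq, ← sq_abs]
  gcongr

/-- The second order Taylor formula with integral remainder, averaged over the shears
`(σ, x) ↦ (σ, x - h σ z)`. -/
theorem integral_shear_sub_eq {α β θ lam : ℝ} (hαθ : α < θ) (hθβ : θ < β) {h : ℝ → Z → ℝ}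
    {H : Z → ℝ} (hh : ∀ z, ContDiff ℝ ∞ fun σ => h σ z) (hhm : Measurable (Function.uncurry h))
    (hHm : Measurable H) (hH : ∀ σ ∈ Set.Ioo α β, ∀ z, |h σ z| ≤ H z)
    (hi : Integrable (fun z => Real.exp ((4 + 2 * |lam|) * H z)) ν)
    {u ux uxx : ℝ × ℝ → ℂ} (hu : Measurable u) (hu2 : MemLp u 2 (weightMeasure₂ α β lam))
    (hux : Measurable ux) (hux2 : MemLp ux 2 (weightMeasure₂ α β lam))
    (huxx : Measurable uxx) (huxx2 : MemLp uxx 2 (weightMeasure₂ α β lam))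
    (hx : IsWeakPDeriv α β 0 1 u ux) (hxx : IsWeakPDeriv α β 0 1 ux uxx) :
    ∀ᵐ p ∂weightMeasure₂ α β lam, ∫ z, (u (p.1, p.2 - h p.1 z) - u p) ∂ν =
      (-∫ z, h p.1 z ∂ν) • ux p + ∫ q : (Z × unitInterval) × unitInterval,
        (h p.1 q.1.1 ^ 2 * q.1.2) • uxx (p.1, p.2 - q.2 * (q.1.2 * h p.1 q.1.1))
        ∂((ν.prod volume).prod volume) := by
  have m1 : Measurable fun q : (ℝ × ℝ) × (Z × unitInterval) => h q.1.1 q.2.1 :=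
    hhm.comp ((measurable_fst.comp measurable_fst).prodMk (measurable_fst.comp measurable_snd))
  have hexp1 : ∀ z, |h θ z| ≤ H z := fun z => hH θ ⟨hαθ, hθβ⟩ z
  have hH0 : ∀ z, 0 ≤ H z := fun z => (abs_nonneg _).trans (hexp1 z)
  have hle : ∀ (r : unitInterval) (a b : ℝ), |a| ≤ b → |(r : ℝ) * a| ≤ b := by
    intro r a b hab
    rw [abs_mul, abs_of_nonneg r.2.1]
    exact (mul_le_of_le_one_left (abs_nonneg _) r.2.2).trans hab
  -- the two remainders are averages of the kind considered above
  have hA₁ := isAveraging_of_bounds (ν := ν.prod (volume : Measure unitInterval)) lam hαθ hθβ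
    (ρ := fun p q => -h p.1 q.1) (m := fun _ => 1) (h := fun σ q => (q.2 : ℝ) * h σ q.1)
    (H := fun q => H q.1) (K := 1) (m₀ := 1) m1.neg measurable_const one_pos (fun _ => le_rfl)
    (fun _ => le_rfl) ((measurable_subtype_coe.comp (measurable_snd.comp measurable_snd)).mul
      (hhm.comp (measurable_fst.prodMk (measurable_fst.comp measurable_snd))))
    (hHm.comp measurable_fst)
    (fun p hp q => by
      rw [abs_neg, one_mul]
      exact le_exp_two_mul (hH _ hp _))
    (fun σ hσ q => hle _ _ _ (hH σ hσ _)) (hi.comp_fst _)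
  have hA₂ := isAveraging_of_bounds
    (ν := (ν.prod (volume : Measure unitInterval)).prod (volume : Measure unitInterval))
    lam hαθ hθβ
    (ρ := fun p q => h p.1 q.1.1 ^ 2 * (q.1.2 : ℝ)) (m := fun _ => 1)
    (h := fun σ q => (q.2 : ℝ) * (q.1.2 * h σ q.1.1))
    (H := fun q => H q.1.1) (K := 1) (m₀ := 1)
    (((hhm.comp ((measurable_fst.comp measurable_fst).prodMk
      (measurable_fst.comp (measurable_fst.comp measurable_snd)))).pow_const 2).mul
      (measurable_subtype_coe.comp (measurable_snd.comp (measurable_fst.comp measurable_snd))))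
    measurable_const one_pos (fun _ => le_rfl) (fun _ => le_rfl)
    ((measurable_subtype_coe.comp (measurable_snd.comp measurable_snd)).mul
      ((measurable_subtype_coe.comp
        (measurable_snd.comp (measurable_fst.comp measurable_snd))).mul
        (hhm.comp (measurable_fst.prodMk
          (measurable_fst.comp (measurable_fst.comp measurable_snd))))))
    (hHm.comp (measurable_fst.comp measurable_fst))
    (fun p hp q => by
      rw [one_mul, abs_mul, abs_of_nonneg q.1.2.2.1, abs_of_nonneg (sq_nonneg _)]
      exact (mul_le_of_le_one_right (sq_nonneg _) q.1.2.2.2).trans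
        (sq_le_exp_two_mul (hH _ hp _)))
    (fun σ hσ q => hle _ _ _ (hle _ _ _ (hH σ hσ _))) ((hi.comp_fst _).comp_fst _)
  simp only [shearMap_one] at hA₁ hA₂
  have t1 := ae_shear_sub_eq (ν := ν) hαθ hθβ hh hhm hu hu2 hux hux2 hx
  have t2 := ae_shear_sub_eq (ν := ν.prod (volume : Measure unitInterval)) hαθ hθβ
    (h := fun σ q => (q.2 : ℝ) * h σ q.1) (fun q => contDiff_const.mul (hh q.1))
    ((measurable_subtype_coe.comp (measurable_snd.comp measurable_snd)).mul
      (hhm.comp (measurable_fst.prodMk (measurable_fst.comp measurable_snd))))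
    hux hux2 huxx huxx2 hxx
  have hhi : ∀ σ ∈ Set.Ioo α β, Integrable (fun z => h σ z) ν := by
    intro σ hσ
    refine hi.mono' (hhm.comp (measurable_const.prodMk measurable_id)).aestronglyMeasurable
      (Eventually.of_forall fun z => ?_)
    refine (le_exp_two_mul (hH σ hσ z)).trans (Real.exp_le_exp.2 ?_)
    nlinarith [hH0 z, abs_nonneg lam, mul_nonneg (abs_nonneg lam) (hH0 z)]
  filter_upwards [t1, t2, ae_fst_mem α β lam, hA₁.ae_integrable hux hux2,
    hA₂.ae_integrable huxx huxx2] with p h1 h2 hp hI1 hI2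
  rw [integral_prod _ hI2]
  have hI2' := hI2.integral_prod_left
  rw [integral_prod _ hI2']
  have hI2'' := hI2'.integral_prod_left
  have key : ∀ᵐ z ∂ν, u (p.1, p.2 - h p.1 z) - u p = (-h p.1 z) • ux p +
      ∫ r : unitInterval, ∫ r' : unitInterval, (h p.1 z ^ 2 * r) •
        uxx (p.1, p.2 - r' * (r * h p.1 z)) := by
    filter_upwards [h1, Measure.ae_ae_of_ae_prod h2, hI1.prod_right_ae, hI2'.prod_right_ae]
      with z hz1 hz2 hz3 hz4
    have e : (-h p.1 z) • ux p = ∫ _ : unitInterval, (-h p.1 z) • ux p := by simp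
    rw [hz1, e, ← sub_eq_iff_eq_add', ← integral_sub hz3 (integrable_const _)]
    refine integral_congr_ae ?_
    filter_upwards [hz2] with r hr
    rw [← smul_sub, hr, ← integral_smul]
    refine integral_congr_ae (Eventually.of_forall fun r' => ?_)
    simp only [smul_smul]
    congr 1
    ring
  rw [integral_congr_ae key, integral_add (f := fun z => (-h p.1 z) • ux p)
    ((hhi _ hp).neg.smul_const _) hI2'', integral_smul_const, integral_neg]

end Taylor

/-! ### Weak derivatives on the line -/

theorem ac_weightMeasure (lam : ℝ) : volume ≪ weightMeasure lam :=
  withDensity_absolutelyContinuous'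
    (continuous_weightDensity lam).measurable.ennreal_ofReal.aemeasurable
    (Eventually.of_forall fun x => by simp [weightDensity_pos])

theorem integral_mul_congr {lam : ℝ} {f g : ℝ → ℂ} (h : f =ᵐ[weightMeasure lam] g) (φ : ℝ → ℂ) :
    ∫ x, f x * φ x = ∫ x, g x * φ x := by
  refine integral_congr_ae ?_
  filter_upwards [(ac_weightMeasure lam).ae_le h] with x hx
  rw [hx]

theorem IsWeakDeriv.congr {lam : ℝ} {n : ℕ} {f f' g g' : ℝ → ℂ} (h : IsWeakDeriv n f g)
    (hf : f =ᵐ[weightMeasure lam] f') (hg : g =ᵐ[weightMeasure lam] g') :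
    IsWeakDeriv n f' g' := by
  intro φ hφ hφs
  rw [← integral_mul_congr hf, ← integral_mul_congr hg]
  exact h φ hφ hφs

theorem IsWeakDeriv.integral_mul_deriv {f g φ : ℝ → ℂ} (h : IsWeakDeriv 1 f g)
    (hφ : ContDiff ℝ ∞ φ) (hφs : HasCompactSupport φ) :
    ∫ x, f x * deriv φ x = -∫ x, g x * φ x := by
  simpa using h φ hφ hφs

theorem contDiff_deriv {φ : ℝ → ℂ} (hφ : ContDiff ℝ ∞ φ) : ContDiff ℝ ∞ (deriv φ) :=
  ((contDiff_infty_iff_deriv (𝕜 := ℝ)).1 hφ).2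

theorem IsWeakDeriv.two {f g k : ℝ → ℂ} (h : IsWeakDeriv 1 f g) (h' : IsWeakDeriv 1 g k) :
    IsWeakDeriv 2 f k := by
  intro φ hφ hφs
  rw [show iteratedDeriv 2 φ = deriv (deriv φ) by rw [iteratedDeriv_succ, iteratedDeriv_one],
    h.integral_mul_deriv (contDiff_deriv hφ) hφs.deriv, h'.integral_mul_deriv hφ hφs]
  simp

theorem IsWeakDeriv.of_two {f g k : ℝ → ℂ} (h : IsWeakDeriv 1 f g) (h' : IsWeakDeriv 2 f k) :
    IsWeakDeriv 1 g k := by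
  intro φ hφ hφs
  have h1 := h' φ hφ hφs
  rw [show iteratedDeriv 2 φ = deriv (deriv φ) by rw [iteratedDeriv_succ, iteratedDeriv_one],
    h.integral_mul_deriv (contDiff_deriv hφ) hφs.deriv] at h1
  rw [neg_eq_iff_eq_neg] at h1
  rw [iteratedDeriv_one, h1]
  simp

theorem iterate_dX_apply {α β : ℝ} {φ : ℝ × ℝ → ℂ} (hφ : IsTest α β φ) (n : ℕ) (σ x : ℝ) :
    (dX^[n] φ) (σ, x) = iteratedDeriv n (fun y => φ (σ, y)) x := by
  induction n generalizing x with
  | zero => simp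
  | succ k ih =>
    have hk : IsTest α β (dX^[k] φ) := hφ.pderiv 0 k
    rw [Function.iterate_succ_apply', iteratedDeriv_succ]
    refine dX_eq_of_hasDerivAt (hk.differentiableAt _) ?_
    simp only [ih]
    refine DifferentiableAt.hasDerivAt ?_
    have : (fun y => (dX^[k] φ) (σ, y)) = iteratedDeriv k fun y => φ (σ, y) := funext ih
    rw [← this]
    exact (hasDerivAt_x (hk.differentiableAt (σ, x))).differentiableAt

/-- A weak derivative on the line is a weak `∂_x` on a strip, for functions constant in `σ`. -/
theorem IsWeakDeriv.comp_snd {α β lam : ℝ} {n : ℕ} {f g : ℝ → ℂ}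
    (hf : MemLp f 2 (weightMeasure lam)) (hg : MemLp g 2 (weightMeasure lam))
    (h : IsWeakDeriv n f g) :
    IsWeakPDeriv α β 0 n (fun p => f p.2) (fun p => g p.2) := by
  intro φ hφ
  have hf2 : MemLp (fun p : ℝ × ℝ => f p.2) 2 (weightMeasure₂ α β lam) := hf.comp_snd _
  have hg2 : MemLp (fun p : ℝ × ℝ => g p.2) 2 (weightMeasure₂ α β lam) := hg.comp_snd _
  have i1 := integrable_mul_test' hf2 (hφ.pderiv 0 n)
  have i2 := integrable_mul_test' hg2 hφ
  have hμ : (volume : Measure (ℝ × ℝ)).restrict (Set.Ioo α β ×ˢ Set.univ) =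
      (volume.restrict (Set.Ioo α β)).prod volume := by
    rw [Measure.volume_eq_prod, ← Measure.prod_restrict, Measure.restrict_univ]
  rw [hμ] at i1 i2 ⊢
  rw [integral_prod _ i1, integral_prod _ i2, ← integral_const_mul]
  refine integral_congr_ae (Eventually.of_forall fun σ => ?_)
  simp only [Function.iterate_zero, id_eq, iterate_dX_apply hφ, zero_add]
  refine h (fun y => φ (σ, y)) (hφ.smooth.comp (contDiff_const.prodMk contDiff_id)) ?_
  refine HasCompactSupport.intro (hφ.compact.isCompact.image continuous_snd) fun y hy => ?_
  exact image_eq_zero_of_notMem_tsupport fun hm => hy ⟨(σ, y), hm, rfl⟩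

theorem exists_of_ae_snd {lam : ℝ} {q : ℝ → Prop}
    (h : ∀ᵐ p ∂weightMeasure₂ (-1) 1 lam, q p.2) : ∀ᵐ x ∂weightMeasure lam, q x := by
  have hne : NeZero ((volume : Measure ℝ).restrict (Set.Ioo (-1) 1)) := by
    refine ⟨fun h0 => ?_⟩
    have := congrArg (fun m => m Set.univ) h0
    simp at this
    norm_num at this
  exact (Measure.ae_ae_of_ae_prod h).exists.choose_spec

/-- The pairing with a test function is an inner product of the weighted space. -/
theorem exists_integral_mul_eq_inner (lam : ℝ) {φ : ℝ → ℂ} (hφ : Continuous φ)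
    (hφs : HasCompactSupport φ) :
    ∃ k : L2R lam, ∀ f : L2R lam, ∫ x, f x * φ x = inner ℂ k f := by
  have hw := continuous_weightDensity lam
  have hc : Continuous fun x => (weightDensity lam x)⁻¹ :=
    hw.inv₀ fun x => (weightDensity_pos lam x).ne'
  have h1 : Continuous fun x => (weightDensity lam x)⁻¹ • (starRingEnd ℂ) (φ x) :=
    hc.smul (Complex.continuous_conj.comp hφ)
  have h0 : HasCompactSupport fun x => (starRingEnd ℂ) (φ x) := hφs.comp_left (map_zero _)
  have h2 : HasCompactSupport fun x => (weightDensity lam x)⁻¹ • (starRingEnd ℂ) (φ x) :=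
    h0.smul_left (f := fun x => (weightDensity lam x)⁻¹)
  have h3 := h1.memLp_of_hasCompactSupport (p := 2) (μ := weightMeasure lam) h2
  refine ⟨h3.toLp _, fun f => ?_⟩
  rw [L2.inner_def]
  have e : ∫ x, inner ℂ ((h3.toLp _ : L2R lam) x) (f x) ∂weightMeasure lam =
      ∫ x, f x * ((weightDensity lam x)⁻¹ • φ x) ∂weightMeasure lam := by
    refine integral_congr_ae ?_
    filter_upwards [h3.coeFn_toLp] with x hx
    rw [hx, RCLike.inner_apply]
    simp
  rw [e]
  refine Eq.trans ?_ (integral_withDensity_eq_integral_smul hw.measurable.real_toNNReal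
    fun x => f x * ((weightDensity lam x)⁻¹ • φ x)).symm
  refine integral_congr_ae (Eventually.of_forall fun x => ?_)
  have hne : ((weightDensity lam x : ℝ) : ℂ) ≠ 0 := by exact_mod_cast (weightDensity_pos lam x).ne'
  change f x * φ x = ((weightDensity lam x).toNNReal : ℝ) • (f x * _)
  rw [Real.coe_toNNReal _ (weightDensity_pos lam x).le, Complex.real_smul, Complex.real_smul,
    Complex.ofReal_inv, mul_left_comm, mul_inv_cancel_left₀ hne]

theorem tendsto_integral_mul {lam : ℝ} {ι : Type*} {l : Filter ι} {F : ι → L2R lam} {f : L2R lam}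
    (hF : Tendsto F l (𝓝 f)) {φ : ℝ → ℂ} (hφ : Continuous φ) (hφs : HasCompactSupport φ) :
    Tendsto (fun i => ∫ x, F i x * φ x) l (𝓝 (∫ x, f x * φ x)) := by
  obtain ⟨k, hk⟩ := exists_integral_mul_eq_inner lam hφ hφs
  simp only [hk]
  exact tendsto_const_nhds.inner hF

/-- Weak derivatives are closed under convergence in the weighted `L²` norm. -/
theorem isWeakDeriv_of_tendsto {lam : ℝ} {ι : Type*} {l : Filter ι} [l.NeBot] {n : ℕ}
    {F G : ι → L2R lam} {f g : L2R lam} (hF : Tendsto F l (𝓝 f)) (hG : Tendsto G l (𝓝 g))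
    (h : ∀ᶠ i in l, IsWeakDeriv n (F i) (G i)) : IsWeakDeriv n f g := by
  intro φ hφ hφs
  have hs : HasCompactSupport (iteratedDeriv n φ) := by
    clear h
    induction n with
    | zero => simpa using hφs
    | succ k ih =>
      rw [iteratedDeriv_succ]
      exact ih.deriv
  have h1 := tendsto_integral_mul hF
    (hφ.continuous_iteratedDeriv n (by exact_mod_cast le_top)) hs
  have h2 := (tendsto_integral_mul hG hφ.continuous hφs).const_mul ((-1 : ℂ) ^ n)
  refine tendsto_nhds_unique h1 (h2.congr' ?_)
  filter_upwards [h] with i hi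
  exact (hi φ hφ hφs).symm

/-! ### Gaussian averages of translates -/

section Shift

variable {Z : Type*} [MeasurableSpace Z] {ν : Measure Z}

theorem isAveraging_shift_of_bounds (lam : ℝ) {ρ : ℝ → Z → ℝ} {h H : Z → ℝ} {K : ℝ}
    (hρ : Measurable (Function.uncurry ρ)) (hh : Measurable h) (hHm : Measurable H)
    (hρR : ∀ x z, |ρ x z| ≤ K * Real.exp (2 * H z)) (hH : ∀ z, |h z| ≤ H z)
    (hi : Integrable (fun z => Real.exp ((4 + 2 * |lam|) * H z)) ν) :
    IsAveraging (weightMeasure lam) ν ρ (fun x z => x - h z)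
      (fun z => K * Real.exp (2 * H z)) (fun z => Real.exp (2 * |lam| * H z)) := by
  refine isAveraging_shift lam hρ hh (by fun_prop) (by fun_prop) hρR ?_ ?_
  · intro z
    gcongr
    exact hH z
  · refine (hi.const_mul (K ^ 2)).congr (Eventually.of_forall fun z => ?_)
    simp only
    rw [show (4 + 2 * |lam|) * H z = 2 * H z + 2 * H z + 2 * |lam| * H z by ring, Real.exp_add,
      Real.exp_add]
    ring

variable [IsProbabilityMeasure ν]

/-- Averages of translates commute with the weak derivative. -/
theorem isWeakDeriv_average {lam : ℝ} {h R C : Z → ℝ} {ρ : Z → ℝ}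
    (hA : IsAveraging (weightMeasure lam) ν (fun _ z => ρ z) (fun x z => x - h z) R C)
    {u u' : ℝ → ℂ} (hu : Measurable u) (hu2 : MemLp u 2 (weightMeasure lam))
    (hu' : Measurable u') (hu2' : MemLp u' 2 (weightMeasure lam)) (hd : IsWeakDeriv 1 u u') :
    IsWeakDeriv 1 (fun x => ∫ z, ρ z • u (x - h z) ∂ν) (fun x => ∫ z, ρ z • u' (x - h z) ∂ν) := by
  intro φ hφ hφs
  rw [iteratedDeriv_one, hA.integral_integral_mul hu hu2 (contDiff_deriv hφ).continuous hφs.deriv,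
    hA.integral_integral_mul hu' hu2' hφ.continuous hφs, ← integral_const_mul]
  refine integral_congr_ae (Eventually.of_forall fun z => ?_)
  have hs : HasCompactSupport fun x => φ (x + h z) :=
    hφs.comp_homeomorph (Homeomorph.addRight (h z))
  have := hd.integral_mul_deriv (φ := fun x => φ (x + h z))
    (hφ.comp (contDiff_id.add contDiff_const)) hs
  simp only [deriv_comp_add_const] at this
  have e1 := integral_sub_right_eq_self (μ := volume) (fun x => u x * deriv φ (x + h z)) (h z)
  have e2 := integral_sub_right_eq_self (μ := volume) (fun x => u' x * φ (x + h z)) (h z)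
  simp only [sub_add_cancel] at e1 e2
  simp only [smul_mul_assoc, integral_smul]
  rw [e1, e2, this]
  simp

/-- The second order Taylor formula with integral remainder, averaged over translates. -/
theorem integral_translate_sub_eq {lam : ℝ} {h H : Z → ℝ} (hhm : Measurable h)
    (hHm : Measurable H) (hH : ∀ z, |h z| ≤ H z)
    (hi : Integrable (fun z => Real.exp ((4 + 2 * |lam|) * H z)) ν)
    {u u₁ u₂ : ℝ → ℂ} (hu : Measurable u) (hu2 : MemLp u 2 (weightMeasure lam))
    (hu₁ : Measurable u₁) (hu₁2 : MemLp u₁ 2 (weightMeasure lam))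
    (hu₂ : Measurable u₂) (hu₂2 : MemLp u₂ 2 (weightMeasure lam))
    (h1 : IsWeakDeriv 1 u u₁) (h2 : IsWeakDeriv 1 u₁ u₂) :
    ∀ᵐ x ∂weightMeasure lam, ∫ z, (u (x - h z) - u x) ∂ν =
      (-∫ z, h z ∂ν) • u₁ x + ∫ q : (Z × unitInterval) × unitInterval,
        (h q.1.1 ^ 2 * q.1.2) • u₂ (x - q.2 * (q.1.2 * h q.1.1)) ∂((ν.prod volume).prod volume) :=
  exists_of_ae_snd (integral_shear_sub_eq (α := -1) (β := 1) (θ := 0) (lam := lam)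
    (h := fun _ z => h z) (by norm_num) (by norm_num) (fun _ => contDiff_const)
    (hhm.comp measurable_snd) hHm (fun _ _ => hH) hi
    (hu.comp measurable_snd) (hu2.comp_snd _) (hu₁.comp measurable_snd) (hu₁2.comp_snd _)
    (hu₂.comp measurable_snd) (hu₂2.comp_snd _) (h1.comp_snd hu2 hu₁2) (h2.comp_snd hu₁2 hu₂2))

end Shift

/-- Gaussian integration by parts. -/
theorem integral_gauss_deriv {G G' : ℝ → ℂ} (hG : ∀ z, HasDerivAt G (G' z) z)
    (i0 : Integrable G gauss) (i1 : Integrable G' gauss)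
    (i2 : Integrable (fun z : ℝ => z • G z) gauss) :
    ∫ z, G' z ∂gauss = ∫ z : ℝ, z • G z ∂gauss := by
  have key : ∀ f : ℝ → ℂ, Integrable f gauss →
      Integrable (fun z => (gaussianPDFReal 0 1 z : ℂ) * f z) := by
    intro f hf
    rw [show gauss = volume.withDensity (gaussianPDF 0 1) from
      gaussianReal_of_var_ne_zero _ one_ne_zero, integrable_withDensity_iff_integrable_smul'
      (measurable_gaussianPDF _ _) (ae_of_all _ fun _ => gaussianPDF_lt_top)] at hf
    simpa only [toReal_gaussianPDF, Complex.real_smul] using hf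
  have hd : ∀ z, HasDerivAt (fun z => (gaussianPDFReal 0 1 z : ℂ))
      ((-z * gaussianPDFReal 0 1 z : ℝ) : ℂ) z := by
    intro z
    refine HasDerivAt.ofReal_comp ?_
    rw [gaussianPDFReal_def]
    have h1 : HasDerivAt (fun x : ℝ => -(x - 0) ^ 2 / (2 * ((1 : NNReal) : ℝ))) (-z) z := by
      refine ((((hasDerivAt_id z).sub_const 0).pow 2).neg.div_const
        (2 * ((1 : NNReal) : ℝ))).congr_deriv ?_
      simp only [id_eq, NNReal.coe_one, sub_zero, Nat.cast_ofNat]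
      ring
    refine (h1.exp.const_mul (√(2 * Real.pi * ((1 : NNReal) : ℝ)))⁻¹).congr_deriv ?_
    simp only
    ring
  rw [integral_gaussianReal_eq_integral_smul one_ne_zero,
    integral_gaussianReal_eq_integral_smul one_ne_zero]
  simp only [Complex.real_smul]
  have i2' : Integrable (fun z : ℝ => ((-z * gaussianPDFReal 0 1 z : ℝ) : ℂ) * G z) := by
    refine (key _ i2).neg.congr (Eventually.of_forall fun z => ?_)
    simp only [Pi.neg_apply, Complex.real_smul]
    push_cast
    ring
  rw [integral_mul_deriv_eq_deriv_mul_of_integrable (fun z _ => hd z) (fun z _ => hG z)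
    (key _ i1) i2' (key _ i0), ← integral_neg]
  refine integral_congr_ae (Eventually.of_forall fun z => ?_)
  simp only
  push_cast
  ring

/-! ### The semigroup generated by `∂_x² - ∂_x` on the line -/

/-- The Gaussian displacement `a + √(2a) z`: the operator `e^{aB}` averages the translates
`x ↦ x - gaussShift a z` over a standard Gaussian variable `z`. -/
noncomputable def gaussShift (a z : ℝ) : ℝ := a + Real.sqrt (2 * a) * z

theorem measurable_gaussShift (a : ℝ) : Measurable (gaussShift a) := by
  unfold gaussShift; fun_prop

theorem abs_gaussShift_le {a : ℝ} (ha : 0 ≤ a) (z : ℝ) :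
    |gaussShift a z| ≤ (a + Real.sqrt (2 * a)) * (1 + |z|) := by
  have h1 := Real.sqrt_nonneg (2 * a)
  calc |gaussShift a z| ≤ |a| + |Real.sqrt (2 * a) * z| := abs_add_le _ _
    _ = a + Real.sqrt (2 * a) * |z| := by rw [abs_of_nonneg ha, abs_mul, abs_of_nonneg h1]
    _ ≤ (a + Real.sqrt (2 * a)) * (1 + |z|) := by
      nlinarith [abs_nonneg z, mul_nonneg ha (abs_nonneg z)]

theorem tendsto_gaussShift_bound :
    Tendsto (fun a : ℝ => a + Real.sqrt (2 * a)) (𝓝[>] 0) (𝓝 0) := by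
  have : Continuous fun a : ℝ => a + Real.sqrt (2 * a) := by fun_prop
  simpa using (this.tendsto 0).mono_left nhdsWithin_le_nhds

theorem gaussShift_bound_le {a : ℝ} (h1 : a ≤ 1) : a + Real.sqrt (2 * a) ≤ 3 := by
  have : Real.sqrt (2 * a) ≤ 2 := Real.sqrt_le_iff.2 ⟨by norm_num, by linarith⟩
  linarith

theorem integrable_exp_affine_gauss (a A : ℝ) :
    Integrable (fun z => Real.exp (a * (A * (1 + |z|)))) gauss := by
  refine ((integrable_exp_abs_gauss (a * A)).const_mul (Real.exp (a * A))).congr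
    (Eventually.of_forall fun z => ?_)
  simp only
  rw [← Real.exp_add]
  congr 1
  ring

theorem one_le_exp_affine {A : ℝ} (hA : 0 ≤ A) (z : ℝ) : 1 ≤ Real.exp (2 * (A * (1 + |z|))) :=
  Real.one_le_exp (by positivity)

/-- The averages over Gaussian translates with a bounded coefficient. -/
theorem isAveraging_gaussShift (lam : ℝ) {s A : ℝ} (hs : 0 ≤ s) (hA : s + Real.sqrt (2 * s) ≤ A) :
    IsAveraging (weightMeasure lam) gauss (fun _ _ => 1) (fun x z => x - gaussShift s z)
      (fun z => 1 * Real.exp (2 * (A * (1 + |z|))))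
      (fun z => Real.exp (2 * |lam| * (A * (1 + |z|)))) := by
  have hA0 : 0 ≤ A := (add_nonneg hs (Real.sqrt_nonneg _)).trans hA
  refine isAveraging_shift_of_bounds (H := fun z => A * (1 + |z|)) lam measurable_const
    (measurable_gaussShift s) (by fun_prop) (fun _ z => ?_) (fun z => ?_)
    (integrable_exp_affine_gauss _ _)
  · simpa using one_le_exp_affine hA0 z
  · exact (abs_gaussShift_le hs z).trans (by gcongr)

theorem exists_gaussian_translation (lam : ℝ) :
    ∃ E : ℝ → L2R lam →L[ℂ] L2R lam, ∀ s, 0 ≤ s → ∀ f,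
      E s f =ᵐ[weightMeasure lam] fun x => ∫ z, f (x - gaussShift s z) ∂gauss := by
  have : ∀ s, ∃ T : L2R lam →L[ℂ] L2R lam, 0 ≤ s → ∀ f,
      T f =ᵐ[weightMeasure lam] fun x => ∫ z, f (x - gaussShift s z) ∂gauss := by
    intro s
    by_cases hs : 0 ≤ s
    · obtain ⟨T, hT, -⟩ := (isAveraging_gaussShift lam hs le_rfl).exists_clm
      exact ⟨T, fun _ f => by simpa only [one_smul] using hT f⟩
    · exact ⟨0, fun h => absurd h hs⟩
  choose E hE using this
  exact ⟨E, hE⟩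

section ExpB

variable {lam : ℝ} {E : ℝ → L2R lam →L[ℂ] L2R lam}

theorem measurable_Lp {P : Type*} [MeasurableSpace P] {μ : Measure P} (f : Lp ℂ 2 μ) :
    Measurable f := (Lp.stronglyMeasurable f).measurable

/-- Gaussian averages of translates form a `c₀` semigroup. -/
theorem isC0Semigroup_gaussian_translation
    (hE : ∀ s, 0 ≤ s → ∀ f,
      E s f =ᵐ[weightMeasure lam] fun x => ∫ z, f (x - gaussShift s z) ∂gauss) :
    IsC0Semigroup E where
  map_add := by
    intro s t hs ht
    refine ContinuousLinearMap.ext fun f => Lp.ext ?_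
    filter_upwards [hE (s + t) (add_nonneg hs ht) f, hE s hs (E t f),
      (isAveraging_gaussShift lam hs le_rfl).ae_comp (hE t ht f),
      (isAveraging_gaussShift lam (add_nonneg hs ht) le_rfl).ae_integrable (measurable_Lp f)
        (Lp.memLp f)] with x h1 h2 h3 h4
    rw [ContinuousLinearMap.comp_apply, h1, h2, integral_congr_ae h3]
    have := integral_gauss_gauss (2 * s) (2 * t) (by positivity) (by positivity)
      (k := fun w => f (x - (s + t) - w))
      ((measurable_Lp f).comp (measurable_const.sub measurable_id)) (by
        refine h4.congr (Eventually.of_forall fun z => ?_)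
        simp only [gaussShift, one_smul]
        congr 1
        ring_nf)
    refine Eq.trans ?_ (this.symm.trans ?_)
    · refine integral_congr_ae (Eventually.of_forall fun z => ?_)
      simp only [gaussShift]
      congr 1
      ring_nf
    · refine integral_congr_ae (Eventually.of_forall fun z => ?_)
      refine integral_congr_ae (Eventually.of_forall fun z' => ?_)
      simp only [gaussShift]
      congr 1
      ring
  map_zero := by
    refine ContinuousLinearMap.ext fun f => Lp.ext ?_
    filter_upwards [hE 0 le_rfl f] with x hx
    rw [hx]
    simp [gaussShift]
  tendsto := by
    intro f
    have h01 : ∀ᶠ t : ℝ in 𝓝[>] 0, t ∈ Set.Ioo (0 : ℝ) 1 := Ioo_mem_nhdsGT one_pos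
    refine tendsto_averaging (ν := gauss) (ρ := fun _ _ _ => 1) (ρ₀ := fun _ _ => 1)
      (Φ := fun t x z => x - gaussShift t z)
      (R := fun z => 1 * Real.exp (2 * (3 * (1 + |z|))))
      (C := fun z => Real.exp (2 * |lam| * (3 * (1 + |z|))))
      (η := fun t z => (t + Real.sqrt (2 * t)) * (1 + |z|)) ?_ ?_ ?_ measurable_const ?_ ?_ f
      (F := fun t => E t f) ?_ ?_
    · filter_upwards [h01] with t ht
      exact isAveraging_gaussShift lam ht.1.le (gaussShift_bound_le ht.2.le)
    · intro z
      simpa using tendsto_gaussShift_bound.mul_const (1 + |z|)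
    · filter_upwards [h01] with t ht
      refine Eventually.of_forall fun x z => ?_
      rw [Real.dist_eq, sub_sub_cancel_left, abs_neg]
      exact abs_gaussShift_le ht.1.le z
    · refine Eventually.of_forall fun x z => ?_
      simpa using one_le_exp_affine (A := 3) (by norm_num) z
    · exact Eventually.of_forall fun x z => tendsto_const_nhds
    · filter_upwards [h01] with t ht
      simpa only [one_smul] using hE t ht.1.le f
    · exact Eventually.of_forall fun x => by simp

theorem isWeakDeriv_gaussian_translation
    (hE : ∀ s, 0 ≤ s → ∀ f, E s f =ᵐ[weightMeasure lam] fun x => ∫ z, f (x - gaussShift s z) ∂gauss)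
    {s : ℝ} (hs : 0 ≤ s) {u u₁ : L2R lam} (h : IsWeakDeriv 1 u u₁) :
    IsWeakDeriv 1 (E s u) (E s u₁) := by
  have := isWeakDeriv_average (isAveraging_gaussShift lam hs le_rfl) (measurable_Lp u)
    (Lp.memLp u) (measurable_Lp u₁) (Lp.memLp u₁) h
  simp only [one_smul] at this
  exact this.congr (hE s hs u).symm (hE s hs u₁).symm

theorem locallyIntegrable_Lp (f : L2R lam) : LocallyIntegrable f volume := by
  rw [locallyIntegrable_iff]
  intro K hK
  have h1 : IntegrableOn f K (weightMeasure lam) :=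
    ((Lp.memLp f).locallyIntegrable (by norm_num)).integrableOn_isCompact hK
  have hd := continuous_weightDensity lam
  have h2 := (integrable_withDensity_iff_integrable_smul (E := ℂ) hd.measurable.real_toNNReal
    (μ := volume.restrict K) (g := f)).1 (by
      have : (volume.restrict K).withDensity (fun x => ((weightDensity lam x).toNNReal : ℝ≥0∞)) =
          (weightMeasure lam).restrict K := (restrict_withDensity hK.measurableSet _).symm
      rw [this]
      exact h1)
  have h3 : IntegrableOn (fun x => (weightDensity lam x)⁻¹ •
      ((weightDensity lam x).toNNReal • f x)) K volume :=
    IntegrableOn.continuousOn_smul (f := fun x => (weightDensity lam x)⁻¹) h2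
      (hd.inv₀ fun x => (weightDensity_pos lam x).ne').continuousOn hK
  refine h3.congr (Eventually.of_forall fun x => ?_)
  have hp := weightDensity_pos lam x
  change (weightDensity lam x)⁻¹ • (((weightDensity lam x).toNNReal : ℝ) • f x) = f x
  rw [Real.coe_toNNReal _ hp.le, smul_smul, inv_mul_cancel₀ hp.ne', one_smul]

/-- `e^{sB}`, `s > 0`, maps into functions with a weak derivative; integrating by parts in the
Gaussian variable moves the derivative onto the Gaussian density. -/
theorem exists_isWeakDeriv_gaussian_translation
    (hE : ∀ s, 0 ≤ s → ∀ f, E s f =ᵐ[weightMeasure lam] fun x => ∫ z, f (x - gaussShift s z) ∂gauss)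
    {s : ℝ} (hs : 0 < s) : ∃ D : L2R lam → L2R lam, ∀ f, IsWeakDeriv 1 (E s f) (D f) := by
  obtain ⟨q, hq⟩ : ∃ q, q = Real.sqrt (2 * s) := ⟨_, rfl⟩
  have hq0 : 0 < q := hq ▸ Real.sqrt_pos.2 (by positivity)
  obtain ⟨A, hAdef⟩ : ∃ A, A = s + q := ⟨_, rfl⟩
  have hA0 : 0 < A := hAdef ▸ add_pos hs hq0
  have hA1 := isAveraging_gaussShift lam hs.le (A := A) (by rw [hAdef, hq])
  have hz : ∀ z : ℝ, |z| ≤ A⁻¹ * Real.exp (2 * (A * (1 + |z|))) := by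
    intro z
    rw [inv_mul_eq_div, le_div_iff₀ hA0]
    have := Real.add_one_le_exp (2 * (A * (1 + |z|)))
    nlinarith [abs_nonneg z, mul_nonneg hA0.le (abs_nonneg z)]
  have hAz : IsAveraging (weightMeasure lam) gauss (fun _ z => z) (fun x z => x - gaussShift s z)
      (fun z => A⁻¹ * Real.exp (2 * (A * (1 + |z|))))
      (fun z => Real.exp (2 * |lam| * (A * (1 + |z|)))) := by
    refine isAveraging_shift_of_bounds (H := fun z => A * (1 + |z|)) lam measurable_snd
      (measurable_gaussShift s) (by fun_prop) (fun _ z => hz z) (fun z => ?_)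
      (integrable_exp_affine_gauss _ _)
    rw [hAdef, hq]
    exact abs_gaussShift_le hs.le z
  obtain ⟨T, hT, -⟩ := hAz.exists_clm
  refine ⟨fun f => (-q⁻¹) • T f, fun f φ hφ hφs => ?_⟩
  have mf := measurable_Lp f
  have mf2 := Lp.memLp f
  have e1 := hA1.integral_integral_mul mf mf2 (contDiff_deriv hφ).continuous hφs.deriv
  have e2 := hAz.integral_integral_mul mf mf2 hφ.continuous hφs
  have i1 := (hA1.integrable_mul_test mf mf2 (contDiff_deriv hφ).continuous
    hφs.deriv).integral_prod_right
  have i0 := (hA1.integrable_mul_test mf mf2 hφ.continuous hφs).integral_prod_right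
  have i2 := (hAz.integrable_mul_test mf mf2 hφ.continuous hφs).integral_prod_right
  simp only [one_smul, smul_mul_assoc, integral_smul] at e1 e2 i0 i1 i2
  have shift : ∀ (ψ : ℝ → ℂ) (a : ℝ), ∫ x, f (x - a) * ψ x = ∫ y, f y * ψ (y + a) := by
    intro ψ a
    simpa using integral_sub_right_eq_self (μ := volume) (fun y => f y * ψ (y + a)) a
  -- the derivative of the pairing with respect to the Gaussian variable
  have hd : ∀ z, HasDerivAt (fun z => ∫ x, f (x - gaussShift s z) * φ x)
      (q • ∫ x, f (x - gaussShift s z) * deriv φ x) z := by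
    intro z
    have hφm : ContDiff ℝ 1 fun w => φ (-w) := (hφ.comp contDiff_neg).of_le (by simp)
    have hsm : HasCompactSupport fun w => φ (-w) := hφs.comp_homeomorph (Homeomorph.neg ℝ)
    have h1 := hsm.hasDerivAt_convolution_right (ContinuousLinearMap.mul ℝ ℂ) (μ := volume)
      (locallyIntegrable_Lp f) hφm (-gaussShift s z)
    have h2 : HasDerivAt (fun z => -gaussShift s z) (-q) z := by
      have h2 : HasDerivAt (fun z => s + q * z) q z := by
        simpa using ((hasDerivAt_id z).const_mul q).const_add s
      unfold gaussShift
      rw [← hq]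
      exact h2.neg
    have h3 := h1.scomp z h2
    simp only [Function.comp_def, convolution_def, ContinuousLinearMap.mul_apply', deriv_comp_neg,
      mul_neg, integral_neg] at h3
    simp only [shift]
    have hneg : ∀ z y, -(-gaussShift s z - y) = y + gaussShift s z := fun z y => by ring
    simp only [hneg, neg_smul, smul_neg, neg_neg] at h3
    exact h3
  have stein := integral_gauss_deriv hd i0 (i1.smul q) i2
  rw [integral_smul] at stein
  rw [iteratedDeriv_one, integral_mul_congr (hE s hs.le f), e1,
    integral_mul_congr (Lp.coeFn_smul (-q⁻¹) (T f))]
  simp only [Pi.smul_apply, smul_mul_assoc, integral_smul]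
  rw [integral_mul_congr (hT f), e2, ← stein]
  simp [hq0.ne']

/-- `e^{sB}`, `s > 0`, maps into `H²_lam(ℝ)`. -/
theorem exists_isWeakDeriv_two_gaussian_translation
    (hE : ∀ s, 0 ≤ s → ∀ f, E s f =ᵐ[weightMeasure lam] fun x => ∫ z, f (x - gaussShift s z) ∂gauss)
    {s : ℝ} (hs : 0 < s) (u : L2R lam) :
    ∃ u₁ u₂ : L2R lam, IsWeakDeriv 1 (E s u) u₁ ∧ IsWeakDeriv 2 (E s u) u₂ := by
  obtain ⟨D, hD⟩ := exists_isWeakDeriv_gaussian_translation hE (half_pos hs)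
  have e : E s u = E (s / 2) (E (s / 2) u) := by
    have := (isC0Semigroup_gaussian_translation hE).map_add (s / 2) (s / 2) (half_pos hs).le
      (half_pos hs).le
    rw [add_halves] at this
    rw [this, ContinuousLinearMap.comp_apply]
  have h1 := isWeakDeriv_gaussian_translation hE (half_pos hs).le (hD u)
  rw [e]
  exact ⟨_, _, h1, h1.two (hD (D u))⟩

end ExpB

theorem integral_unitInterval_id : ∫ r : unitInterval, (r : ℝ) = 1 / 2 := by
  rw [show ∫ r : unitInterval, (r : ℝ) = ∫ r in Set.Icc (0 : ℝ) 1, r from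
    integral_subtype_comap measurableSet_Icc fun r : ℝ => r, integral_Icc_eq_integral_Ioc,
    ← intervalIntegral.integral_of_le zero_le_one, integral_id]
  norm_num

theorem integral_sq_mul_gauss :
    ∫ q : (ℝ × unitInterval) × unitInterval, 2 * q.1.1 ^ 2 * (q.1.2 : ℝ)
      ∂((gauss.prod volume).prod volume) = 1 := by
  have h1 := integral_fun_fst (μ := gauss.prod (volume : Measure unitInterval))
    (ν := (volume : Measure unitInterval)) (f := fun q => 2 * q.1 ^ 2 * (q.2 : ℝ))
  have h2 := integral_prod_mul (μ := gauss) (ν := (volume : Measure unitInterval))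
    (fun z => 2 * z ^ 2) (fun r => (r : ℝ))
  rw [h1, h2, integral_const_mul, integral_gauss_sq, integral_unitInterval_id]
  simp

/-! ### The generator on the line and its domain -/

section ExpB

variable {lam : ℝ} {E : ℝ → L2R lam →L[ℂ] L2R lam}

theorem eventually_mem_Ioo_one : ∀ᶠ t : ℝ in 𝓝[>] 0, t ∈ Set.Ioo (0 : ℝ) 1 :=
  Ioo_mem_nhdsGT one_pos

theorem inv_mul_gaussShift_sq {t : ℝ} (ht : 0 < t) (z : ℝ) :
    t⁻¹ * gaussShift t z ^ 2 = (Real.sqrt t + Real.sqrt 2 * z) ^ 2 := by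
  have h1 := Real.sq_sqrt ht.le
  unfold gaussShift
  rw [Real.sqrt_mul (by norm_num) t]
  have h2 : t + Real.sqrt 2 * Real.sqrt t * z = Real.sqrt t * (Real.sqrt t + Real.sqrt 2 * z) := by
    rw [mul_add, ← sq, h1]; ring
  rw [h2, mul_pow, h1, inv_mul_cancel_left₀ ht.ne']

theorem integral_gaussShift (a : ℝ) : ∫ z, gaussShift a z ∂gauss = a := by
  unfold gaussShift
  rw [integral_add (integrable_const _) (integrable_gauss_id.const_mul _), integral_const_mul,
    integral_gauss_id]
  simp

theorem abs_mul_gaussShift_le {t : ℝ} (h0 : 0 ≤ t) (r : unitInterval) (z : ℝ) :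
    |(r : ℝ) * gaussShift t z| ≤ (t + Real.sqrt (2 * t)) * (1 + |z|) := by
  rw [abs_mul, abs_of_nonneg r.2.1]
  exact (mul_le_of_le_one_left (abs_nonneg _) r.2.2).trans (abs_gaussShift_le h0 z)

/-- On `H²_lam(ℝ)` the generator is `B`. -/
theorem generatorMapsTo_of_BMapsTo
    (hE : ∀ s, 0 ≤ s → ∀ f, E s f =ᵐ[weightMeasure lam] fun x => ∫ z, f (x - gaussShift s z) ∂gauss)
    {u v : L2R lam} (h : BMapsTo u v) : GeneratorMapsTo E u v := by
  obtain ⟨u₁, u₂, h1, h2, rfl⟩ := h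
  have h12 := h1.of_two h2
  suffices hs : Tendsto (fun t : ℝ => (t : ℂ)⁻¹ • (E t u - u) + u₁) (𝓝[>] 0) (𝓝 u₂) by
    have := hs.sub (tendsto_const_nhds (x := u₁))
    simp only [add_sub_cancel_right] at this
    exact this
  have hsq : ∀ t ∈ Set.Ioo (0 : ℝ) 1, ∀ z, (Real.sqrt t + Real.sqrt 2 * z) ^ 2 ≤
      Real.exp (2 * (3 * (1 + |z|))) := by
    intro t ht z
    have h1 : Real.sqrt t ≤ 1 := Real.sqrt_le_one.2 ht.2.le
    have h2 : Real.sqrt 2 ≤ 2 := Real.sqrt_le_iff.2 ⟨by norm_num, by norm_num⟩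
    refine sq_le_exp_two_mul ((abs_add_le _ _).trans ?_)
    rw [abs_mul, abs_of_nonneg (Real.sqrt_nonneg _), abs_of_nonneg (Real.sqrt_nonneg _)]
    nlinarith [abs_nonneg z]
  have mh : ∀ t, Measurable fun q : (ℝ × unitInterval) × unitInterval =>
      (q.2 : ℝ) * (q.1.2 * gaussShift t q.1.1) := fun t =>
    (measurable_subtype_coe.comp measurable_snd).mul
      ((measurable_subtype_coe.comp (measurable_snd.comp measurable_fst)).mul
        ((measurable_gaussShift t).comp (measurable_fst.comp measurable_fst)))
  have mr : Measurable fun q : (ℝ × unitInterval) × unitInterval => (q.1.2 : ℝ) :=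
    measurable_subtype_coe.comp (measurable_snd.comp measurable_fst)
  have mz : Measurable fun q : (ℝ × unitInterval) × unitInterval => q.1.1 :=
    measurable_fst.comp measurable_fst
  have hle : ∀ t ∈ Set.Ioo (0 : ℝ) 1, ∀ q : (ℝ × unitInterval) × unitInterval,
      |(q.2 : ℝ) * (q.1.2 * gaussShift t q.1.1)| ≤
        (t + Real.sqrt (2 * t)) * (1 + |q.1.1|) := by
    intro t ht q
    rw [abs_mul, abs_of_nonneg q.2.2.1]
    exact (mul_le_of_le_one_left (abs_nonneg _) q.2.2.2).trans
      (abs_mul_gaussShift_le ht.1.le _ _)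
  have hle3 : ∀ t ∈ Set.Ioo (0 : ℝ) 1, ∀ z, (t + Real.sqrt (2 * t)) * (1 + |z|) ≤ 3 * (1 + |z|) :=
    fun t ht z => by
      gcongr
      exact gaussShift_bound_le ht.2.le
  refine tendsto_averaging
    (ν := (gauss.prod (volume : Measure unitInterval)).prod (volume : Measure unitInterval))
    (ρ := fun t _ q => (Real.sqrt t + Real.sqrt 2 * q.1.1) ^ 2 * q.1.2)
    (ρ₀ := fun _ q => 2 * q.1.1 ^ 2 * q.1.2)
    (Φ := fun t x q => x - q.2 * (q.1.2 * gaussShift t q.1.1))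
    (R := fun q => 1 * Real.exp (2 * (3 * (1 + |q.1.1|))))
    (C := fun q => Real.exp (2 * |lam| * (3 * (1 + |q.1.1|))))
    (η := fun t q => (t + Real.sqrt (2 * t)) * (1 + |q.1.1|)) ?_ ?_ ?_ ?_ ?_ ?_ u₂ ?_ ?_
  · filter_upwards [eventually_mem_Ioo_one] with t ht
    refine isAveraging_shift_of_bounds (H := fun q => 3 * (1 + |q.1.1|)) lam ?_ (mh t)
      (by fun_prop) ?_ (fun q => (hle t ht q).trans (hle3 t ht _))
      (((integrable_exp_affine_gauss _ _).comp_fst (volume : Measure unitInterval)).comp_fst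
        (volume : Measure unitInterval))
    · exact (((mz.const_mul _).const_add _).pow_const 2 |>.mul mr).comp measurable_snd
    · intro x q
      rw [one_mul, abs_mul, abs_of_nonneg q.1.2.2.1, abs_of_nonneg (sq_nonneg _)]
      exact (mul_le_of_le_one_right (sq_nonneg _) q.1.2.2.2).trans (hsq t ht _)
  · intro q
    simpa using tendsto_gaussShift_bound.mul_const (1 + |q.1.1|)
  · filter_upwards [eventually_mem_Ioo_one] with t ht
    refine Eventually.of_forall fun x q => ?_
    rw [Real.dist_eq, sub_sub_cancel_left, abs_neg]
    exact hle t ht q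
  · exact (((mz.pow_const 2).const_mul 2).mul mr).comp measurable_snd
  · refine Eventually.of_forall fun x q => ?_
    rw [one_mul, abs_mul, abs_of_nonneg q.1.2.2.1, abs_of_nonneg (by positivity)]
    refine (mul_le_of_le_one_right (by positivity) q.1.2.2.2).trans ?_
    have h2 : (2 : ℝ) * q.1.1 ^ 2 = (Real.sqrt 2 * q.1.1) ^ 2 := by
      rw [mul_pow, Real.sq_sqrt (by norm_num)]
    rw [h2]
    refine sq_le_exp_two_mul ?_
    have h2 : Real.sqrt 2 ≤ 2 := Real.sqrt_le_iff.2 ⟨by norm_num, by norm_num⟩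
    rw [abs_mul, abs_of_nonneg (Real.sqrt_nonneg _)]
    nlinarith [abs_nonneg q.1.1]
  · refine Eventually.of_forall fun x q => ?_
    have : Continuous fun t : ℝ => (Real.sqrt t + Real.sqrt 2 * q.1.1) ^ 2 * (q.1.2 : ℝ) := by
      fun_prop
    have h0 := (this.tendsto 0).mono_left (nhdsWithin_le_nhds (s := Set.Ioi 0))
    simpa [mul_pow] using h0
  · filter_upwards [eventually_mem_Ioo_one] with t ht
    have hA := isAveraging_gaussShift lam ht.1.le le_rfl
    filter_upwards [Lp.coeFn_add ((t : ℂ)⁻¹ • (E t u - u)) u₁,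
      Lp.coeFn_smul ((t : ℂ)⁻¹) (E t u - u), Lp.coeFn_sub (E t u) u, hE t ht.1.le u,
      hA.ae_integrable (measurable_Lp u) (Lp.memLp u),
      integral_translate_sub_eq (ν := gauss) (lam := lam) (h := gaussShift t)
        (H := fun z => 3 * (1 + |z|)) (measurable_gaussShift t) (by fun_prop)
        (fun z => (abs_gaussShift_le ht.1.le z).trans (hle3 t ht z))
        (integrable_exp_affine_gauss _ _) (measurable_Lp u) (Lp.memLp u) (measurable_Lp u₁)
        (Lp.memLp u₁) (measurable_Lp u₂) (Lp.memLp u₂) h1 h12] with x e1 e2 e3 e4 e5 e6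
    simp only [one_smul] at e5
    rw [integral_sub e5 (integrable_const _), integral_gaussShift] at e6
    rw [e1, Pi.add_apply, e2, Pi.smul_apply, e3, Pi.sub_apply, e4]
    simp only [integral_const, probReal_univ, one_smul] at e6
    rw [e6]
    have ht0 : (t : ℂ) ≠ 0 := by exact_mod_cast ht.1.ne'
    have e7 : ∀ q : (ℝ × unitInterval) × unitInterval,
        (Real.sqrt t + Real.sqrt 2 * q.1.1) ^ 2 * (q.1.2 : ℝ) =
          t⁻¹ * (gaussShift t q.1.1 ^ 2 * q.1.2) := by
      intro q
      rw [← inv_mul_gaussShift_sq ht.1, mul_assoc]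
    simp only [e7, mul_smul t⁻¹, integral_smul]
    rw [smul_eq_mul, Complex.real_smul, Complex.real_smul]
    push_cast
    field_simp
    ring
  · refine Eventually.of_forall fun x => ?_
    simp only [integral_sq_mul_gauss, one_smul]

/-- Bounded operators which recover the first derivative of a function `u` of `H²_lam(ℝ)` from
`u` and `B u`. They come from Taylor's formula `u(x - h) - u(x) = -h u'(x) + h² (R u'')(x)` for
one small step `h`, in which `u'' = B u + u'`: the operator `1 - h R` is invertible. -/
theorem exists_deriv_eq (lam : ℝ) : ∃ P Q : L2R lam →L[ℂ] L2R lam, ∀ u u₁ u₂ : L2R lam,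
    IsWeakDeriv 1 u u₁ → IsWeakDeriv 2 u u₂ → u₁ = P u + Q (u₂ - u₁) := by
  obtain ⟨c, hc⟩ : ∃ c, c = Real.sqrt (∫ _ : (Unit × unitInterval) × unitInterval,
    (1 * Real.exp (2 * 1)) ^ 2 * Real.exp (2 * |lam| * 1)
      ∂(((Measure.dirac ()).prod volume).prod volume)) := ⟨_, rfl⟩
  have hc0 : 0 ≤ c := hc ▸ Real.sqrt_nonneg _
  obtain ⟨h, hh⟩ : ∃ h, h = (c + 1)⁻¹ := ⟨_, rfl⟩
  have hh0 : 0 < h := by rw [hh]; positivity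
  have hh1 : h ≤ 1 := by rw [hh]; exact inv_le_one_of_one_le₀ (by linarith)
  have hle : ∀ (r r' : unitInterval), |(r : ℝ) * (r' * h)| ≤ 1 := by
    intro r r'
    rw [abs_of_nonneg (mul_nonneg r.2.1 (mul_nonneg r'.2.1 hh0.le))]
    exact mul_le_one₀ r.2.2 (mul_nonneg r'.2.1 hh0.le) (mul_le_one₀ r'.2.2 hh0.le hh1)
  have mr : Measurable fun q : (Unit × unitInterval) × unitInterval => (q.1.2 : ℝ) :=
    measurable_subtype_coe.comp (measurable_snd.comp measurable_fst)
  have hA : IsAveraging (weightMeasure lam)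
      (((Measure.dirac ()).prod (volume : Measure unitInterval)).prod
        (volume : Measure unitInterval))
      (fun _ q => (q.1.2 : ℝ)) (fun x q => x - q.2 * (q.1.2 * h))
      (fun _ => 1 * Real.exp (2 * 1)) (fun _ => Real.exp (2 * |lam| * 1)) := by
    refine isAveraging_shift_of_bounds (H := fun _ => 1) lam (mr.comp measurable_snd)
      ((measurable_subtype_coe.comp measurable_snd).mul (mr.mul_const h)) measurable_const
      (fun x q => ?_) (fun q => hle _ _) (integrable_const _)
    rw [abs_of_nonneg q.1.2.2.1, one_mul]
    exact q.1.2.2.2.trans (Real.one_le_exp (by norm_num))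
  have hA' : IsAveraging (weightMeasure lam) (Measure.dirac ()) (fun _ _ => 1)
      (fun x _ => x - h) (fun _ => 1 * Real.exp (2 * 1)) (fun _ => Real.exp (2 * |lam| * 1)) := by
    refine isAveraging_shift_of_bounds (H := fun _ => 1) lam measurable_const measurable_const
      measurable_const (fun _ _ => ?_) (fun _ => ?_) (integrable_const _)
    · rw [abs_one, one_mul]
      exact Real.one_le_exp (by norm_num)
    · rwa [abs_of_pos hh0]
  obtain ⟨R, hR, hRn⟩ := hA.exists_clm
  obtain ⟨T, hT, -⟩ := hA'.exists_clm
  rw [← hc] at hRn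
  have hn : ‖h • R‖ < 1 := by
    have h1 : ‖R‖ ≤ c := R.opNorm_le_bound hc0 hRn
    rw [norm_smul, Real.norm_of_nonneg hh0.le]
    calc h * ‖R‖ ≤ h * c := by gcongr
      _ < h * (c + 1) := by gcongr; linarith
      _ = 1 := by rw [hh]; exact inv_mul_cancel₀ (by positivity)
  obtain ⟨W, hW⟩ : ∃ W : L2R lam →L[ℂ] L2R lam, W * (1 - h • R) = 1 :=
    ⟨_, Units.inv_mul (Units.oneSub (h • R) hn)⟩
  refine ⟨W * (h⁻¹ • (1 - T)), W * (h • R), fun u u₁ u₂ h1 h2 => ?_⟩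
  have taylor : T u - u = -(h • u₁) + h ^ 2 • R u₂ := by
    refine Lp.ext ?_
    filter_upwards [Lp.coeFn_sub (T u) u, Lp.coeFn_add (-(h • u₁)) (h ^ 2 • R u₂),
      Lp.coeFn_neg (h • u₁), Lp.coeFn_smul h u₁, Lp.coeFn_smul (h ^ 2) (R u₂), hT u, hR u₂,
      integral_translate_sub_eq (ν := Measure.dirac ()) (lam := lam) (h := fun _ => h)
        (H := fun _ => 1) measurable_const measurable_const
        (fun _ => (abs_of_pos hh0).trans_le hh1) (integrable_const _) (measurable_Lp u)
        (Lp.memLp u) (measurable_Lp u₁) (Lp.memLp u₁) (measurable_Lp u₂) (Lp.memLp u₂) h1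
        (h1.of_two h2)] with x e1 e2 e3 e4 e5 e6 e7 e8
    simp only [integral_const, probReal_univ, one_smul, mul_smul (h ^ 2), integral_smul] at e6 e8
    rw [e1, e2, Pi.sub_apply, Pi.add_apply, e3, Pi.neg_apply, e4, Pi.smul_apply, e5, Pi.smul_apply,
      e6, e7, e8, neg_smul]
  have key : (1 - h • R) u₁ = (h⁻¹ • (1 - T)) u + (h • R) (u₂ - u₁) := by
    have e : u - T u = h • u₁ - h ^ 2 • R u₂ := by
      rw [← neg_sub, taylor]; abel
    change u₁ - h • R u₁ = h⁻¹ • (u - T u) + h • R (u₂ - u₁)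
    rw [e, map_sub, smul_sub, smul_sub, smul_smul, smul_smul, inv_mul_cancel₀ hh0.ne', one_smul,
      sq, inv_mul_cancel_left₀ hh0.ne']
    abel
  have hW' : W ((1 - h • R) u₁) = u₁ := DFunLike.congr_fun hW u₁
  change u₁ = W ((h⁻¹ • (1 - T)) u) + W ((h • R) (u₂ - u₁))
  rw [← map_add, ← key, hW']

/-- The generator is exactly `B`, with domain `H²_lam(ℝ)`. For `u` in the domain of the generator,
`e^{εB} u` lies in `H²_lam(ℝ)` by smoothing; its derivatives are controlled by `e^{εB} u` and
`e^{εB} (B u)`, so they converge as `ε ↘ 0`, and weak derivatives are closed. -/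
theorem isExpB_gaussian_translation
    (hE : ∀ s, 0 ≤ s → ∀ f,
      E s f =ᵐ[weightMeasure lam] fun x => ∫ z, f (x - gaussShift s z) ∂gauss) :
    IsExpB E := by
  have hC := isC0Semigroup_gaussian_translation hE
  refine ⟨hC, fun u v => ⟨fun hg => ?_, generatorMapsTo_of_BMapsTo hE⟩⟩
  have hcomm : ∀ ε : ℝ, 0 < ε → GeneratorMapsTo E (E ε u) (E ε v) := by
    intro ε hε
    refine (((E ε).continuous.tendsto v).comp hg).congr' ?_
    filter_upwards [self_mem_nhdsWithin] with t ht
    have h1 := hC.map_add ε t hε.le (le_of_lt ht)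
    have h2 := hC.map_add t ε (le_of_lt ht) hε.le
    rw [add_comm, h1] at h2
    simp only [Function.comp_apply, map_smul, map_sub]
    rw [← ContinuousLinearMap.comp_apply, h2, ContinuousLinearMap.comp_apply]
  obtain ⟨P, Q, hPQ⟩ := exists_deriv_eq lam
  have hsm : ∀ ε : ℝ, 0 < ε → IsWeakDeriv 1 (E ε u) (P (E ε u) + Q (E ε v) : L2R lam) ∧
      IsWeakDeriv 2 (E ε u) (E ε v + (P (E ε u) + Q (E ε v)) : L2R lam) := by
    intro ε hε
    obtain ⟨u₁, u₂, h1, h2⟩ := exists_isWeakDeriv_two_gaussian_translation hE hε u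
    have h3 : E ε v = u₂ - u₁ := tendsto_nhds_unique (hcomm ε hε)
      (generatorMapsTo_of_BMapsTo hE ⟨u₁, u₂, h1, h2, rfl⟩)
    have h4 : P (E ε u) + Q (E ε v) = u₁ := by rw [h3]; exact (hPQ _ _ _ h1 h2).symm
    rw [h4, h3, sub_add_cancel]
    exact ⟨h1, h2⟩
  have tu := hC.tendsto u
  have tv := hC.tendsto v
  have t1 := ((P.continuous.tendsto u).comp tu).add ((Q.continuous.tendsto v).comp tv)
  refine ⟨P u + Q v, v + (P u + Q v), isWeakDeriv_of_tendsto tu t1 ?_,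
    isWeakDeriv_of_tendsto tu (tv.add t1) ?_, by abel⟩
  · filter_upwards [self_mem_nhdsWithin] with t ht using (hsm t ht).1
  · filter_upwards [self_mem_nhdsWithin] with t ht using (hsm t ht).2

end ExpB

/-! ### The functions `δ_t` and `𝔇` -/

theorem flow_eq (κ θ t σ : ℝ) : flow κ θ t σ = θ + Real.exp (-κ * t) * (σ - θ) := by
  unfold flow; ring

/-- `𝔇(t, σ)` is the integral of `δ_s(σ)² / 2` over `0 ≤ s ≤ t`. -/
theorem hasDerivAt_frakD {κ : ℝ} (hκ : κ ≠ 0) (θ σ t : ℝ) :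
    HasDerivAt (fun t => frakD κ θ t σ) (flow κ θ t σ ^ 2 / 2) t := by
  have h1 : HasDerivAt (fun t => Real.exp (-2 * κ * t)) (Real.exp (-2 * κ * t) * (-2 * κ)) t := by
    simpa using ((hasDerivAt_id t).const_mul (-2 * κ)).exp
  have h2 : HasDerivAt (fun t => Real.exp (-κ * t)) (Real.exp (-κ * t) * -κ) t := by
    simpa using ((hasDerivAt_id t).const_mul (-κ)).exp
  have h3 := (((h1.const_sub 1).const_mul ((θ - σ) ^ 2 / (4 * κ))).sub
    ((h2.const_sub 1).const_mul (θ * (θ - σ) / κ))).add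
      ((hasDerivAt_id t).const_mul (1 / 2 * θ ^ 2))
  unfold frakD
  refine h3.congr_deriv ?_
  have h4 : Real.exp (-2 * κ * t) = Real.exp (-κ * t) ^ 2 := by
    rw [← Real.exp_nat_mul]; congr 1; push_cast; ring
  rw [h4]
  unfold flow
  field_simp
  ring

theorem frakD_zero (κ θ σ : ℝ) : frakD κ θ 0 σ = 0 := by
  simp [frakD]

theorem frakD_eq_integral {κ : ℝ} (hκ : κ ≠ 0) (θ σ t : ℝ) :
    frakD κ θ t σ = ∫ s in (0 : ℝ)..t, flow κ θ s σ ^ 2 / 2 := by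
  have hc : Continuous fun s => flow κ θ s σ ^ 2 / 2 := by unfold flow; fun_prop
  rw [intervalIntegral.integral_eq_sub_of_hasDerivAt (fun s _ => hasDerivAt_frakD hκ θ σ s)
    (hc.intervalIntegrable _ _), frakD_zero, sub_zero]

/-- The cocycle identity of `𝔇` along the flow `δ`. -/
theorem frakD_add {κ : ℝ} (hκ : κ ≠ 0) (θ s t σ : ℝ) :
    frakD κ θ (s + t) σ = frakD κ θ s σ + frakD κ θ t (flow κ θ s σ) := by
  have e1 : Real.exp (-κ * (s + t)) = Real.exp (-κ * s) * Real.exp (-κ * t) := by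
    rw [← Real.exp_add]; congr 1; ring
  have e2 : ∀ r, Real.exp (-2 * κ * r) = Real.exp (-κ * r) ^ 2 := by
    intro r
    rw [← Real.exp_nat_mul]; congr 1; push_cast; ring
  unfold frakD flow
  rw [e2, e2, e2, e1]
  field_simp
  ring

theorem flow_flow (κ θ s t σ : ℝ) : flow κ θ t (flow κ θ s σ) = flow κ θ (s + t) σ := by
  have e1 : Real.exp (-κ * (s + t)) = Real.exp (-κ * s) * Real.exp (-κ * t) := by
    rw [← Real.exp_add]; congr 1; ring
  unfold flow
  rw [e1]
  ring

/-- The quadratic polynomial `𝔇(t, ·)` has no real zero: `δ_s(σ)` cannot vanish for all `s`. -/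
theorem frakD_pos {κ θ t : ℝ} (hκ : 0 < κ) (hθ : 0 < θ) (ht : 0 < t) (σ : ℝ) :
    0 < frakD κ θ t σ := by
  have hc : Continuous fun s => flow κ θ s σ ^ 2 / 2 := by unfold flow; fun_prop
  rw [frakD_eq_integral hκ.ne']
  refine intervalIntegral.integral_pos ht hc.continuousOn (fun s _ => by positivity) ?_
  by_cases hσ : σ = 0
  · refine ⟨t, ⟨ht.le, le_rfl⟩, ?_⟩
    have h1 : Real.exp (-κ * t) < 1 := Real.exp_lt_one_iff.2 (by nlinarith)
    have h2 : 0 < flow κ θ t σ := by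
      unfold flow
      rw [hσ, zero_mul, add_zero]
      exact mul_pos hθ (by linarith)
    positivity
  · refine ⟨0, ⟨le_rfl, ht.le⟩, ?_⟩
    have h2 : flow κ θ 0 σ = σ := by simp [flow]
    rw [h2]
    positivity

section Bounds

variable {κ θ α β t σ : ℝ}

theorem exp_neg_mul_le_one (hκ : 0 < κ) (ht : 0 ≤ t) : Real.exp (-κ * t) ≤ 1 :=
  Real.exp_le_one_iff.2 (by nlinarith)

theorem flow_mem (hκ : 0 < κ) (hαθ : α < θ) (hθβ : θ < β) (ht : 0 ≤ t) (hσ : σ ∈ Set.Ioo α β) :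
    flow κ θ t σ ∈ Set.Ioo α β := by
  rw [flow_eq]
  exact mem_Ioo_of_contraction hαθ hθβ (Real.exp_pos _) (exp_neg_mul_le_one hκ ht) hσ

theorem le_frakD (hκ : 0 < κ) (hα : 0 < α) (hαθ : α < θ) (hθβ : θ < β) (ht : 0 ≤ t)
    (hσ : σ ∈ Set.Ioo α β) : α ^ 2 / 2 * t ≤ frakD κ θ t σ := by
  have hc : Continuous fun s => flow κ θ s σ ^ 2 / 2 := by unfold flow; fun_prop
  have h := intervalIntegral.integral_mono_on (f := fun _ => α ^ 2 / 2) (μ := volume) ht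
    (continuous_const.intervalIntegrable _ _) (hc.intervalIntegrable _ _) fun s hs => by
      have := (flow_mem hκ hαθ hθβ hs.1 hσ).1
      gcongr
  rw [frakD_eq_integral hκ.ne']
  refine le_trans (le_of_eq ?_) h
  simp; ring

theorem frakD_le (hκ : 0 < κ) (hα : 0 < α) (hαθ : α < θ) (hθβ : θ < β) (ht : 0 ≤ t)
    (hσ : σ ∈ Set.Ioo α β) : frakD κ θ t σ ≤ β ^ 2 / 2 * t := by
  have hc : Continuous fun s => flow κ θ s σ ^ 2 / 2 := by unfold flow; fun_prop
  have h := intervalIntegral.integral_mono_on (g := fun _ => β ^ 2 / 2) (μ := volume) ht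
    (hc.intervalIntegrable _ _) (continuous_const.intervalIntegrable _ _) fun s hs => by
      have h1 := flow_mem hκ hαθ hθβ hs.1 hσ
      have h2 : 0 ≤ flow κ θ s σ := (hα.trans h1.1).le
      have h3 := h1.2.le
      gcongr
  rw [frakD_eq_integral hκ.ne']
  refine h.trans (le_of_eq ?_)
  simp; ring

theorem frakD_nonneg (hκ : 0 < κ) (hα : 0 < α) (hαθ : α < θ) (hθβ : θ < β) (ht : 0 ≤ t)
    (hσ : σ ∈ Set.Ioo α β) : 0 ≤ frakD κ θ t σ :=
  le_trans (by positivity) (le_frakD hκ hα hαθ hθβ ht hσ)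

end Bounds

/-- `∂_σ 𝔇(t, σ)`. -/
noncomputable def frakD₁ (κ θ t σ : ℝ) : ℝ :=
  (σ - θ) / (2 * κ) * (1 - Real.exp (-2 * κ * t)) + θ / κ * (1 - Real.exp (-κ * t))

/-- `∂_σ² 𝔇(t, σ)`, which does not depend on `σ`. -/
noncomputable def frakD₂ (κ t : ℝ) : ℝ := (1 - Real.exp (-2 * κ * t)) / (2 * κ)

theorem hasDerivAt_frakD_sigma {κ : ℝ} (hκ : κ ≠ 0) (θ t σ : ℝ) :
    HasDerivAt (fun σ => frakD κ θ t σ) (frakD₁ κ θ t σ) σ := by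
  have h1 := (hasDerivAt_id σ).const_sub θ
  have h2 := ((((h1.pow 2).div_const (4 * κ)).mul_const (1 - Real.exp (-2 * κ * t))).sub
    (((h1.const_mul θ).div_const κ).mul_const (1 - Real.exp (-κ * t)))).add_const
      (1 / 2 * θ ^ 2 * t)
  refine h2.congr_deriv ?_
  unfold frakD₁
  simp only [id_eq, Nat.cast_ofNat, Nat.add_one_sub_one, pow_one]
  field_simp
  ring

theorem hasDerivAt_frakD₁ {κ : ℝ} (hκ : κ ≠ 0) (θ t σ : ℝ) :
    HasDerivAt (fun σ => frakD₁ κ θ t σ) (frakD₂ κ t) σ := by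
  have h2 := ((((hasDerivAt_id σ).sub_const θ).div_const (2 * κ)).mul_const
    (1 - Real.exp (-2 * κ * t))).add_const (θ / κ * (1 - Real.exp (-κ * t)))
  refine h2.congr_deriv ?_
  unfold frakD₂
  field_simp

theorem one_sub_exp_mem {κ t : ℝ} (hκ : 0 < κ) (ht : 0 ≤ t) :
    0 ≤ 1 - Real.exp (-κ * t) ∧ 1 - Real.exp (-κ * t) ≤ κ * t := by
  have h1 := exp_neg_mul_le_one hκ ht
  have h2 := Real.add_one_le_exp (-κ * t)
  constructor <;> linarith

theorem frakD₂_mem {κ t : ℝ} (hκ : 0 < κ) (ht : 0 ≤ t) : 0 ≤ frakD₂ κ t ∧ frakD₂ κ t ≤ t := by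
  have h := one_sub_exp_mem (κ := 2 * κ) (by positivity) ht
  rw [← neg_mul] at h
  unfold frakD₂
  refine ⟨div_nonneg h.1 (by positivity), (div_le_iff₀ (by positivity)).2 (h.2.trans_eq (by ring))⟩

theorem abs_frakD₁_le {κ θ α β t σ : ℝ} (hκ : 0 < κ) (hα : 0 < α) (hαθ : α < θ) (hθβ : θ < β)
    (ht : 0 ≤ t) (hσ : σ ∈ Set.Ioo α β) : |frakD₁ κ θ t σ| ≤ 2 * β * t := by
  have h1 := one_sub_exp_mem hκ ht
  have h2 := frakD₂_mem hκ ht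
  have e : frakD₁ κ θ t σ = (σ - θ) * frakD₂ κ t + θ * ((1 - Real.exp (-κ * t)) / κ) := by
    unfold frakD₁ frakD₂; ring
  have h3 : 0 ≤ (1 - Real.exp (-κ * t)) / κ ∧ (1 - Real.exp (-κ * t)) / κ ≤ t :=
    ⟨div_nonneg h1.1 hκ.le, (div_le_iff₀ hκ).2 (h1.2.trans_eq (by ring))⟩
  have h4 : |σ - θ| ≤ β := abs_le.2 ⟨by linarith [hσ.1], by linarith [hσ.2]⟩
  have hθ : 0 < θ := hα.trans hαθ
  calc |frakD₁ κ θ t σ| ≤ |(σ - θ) * frakD₂ κ t| + |θ * ((1 - Real.exp (-κ * t)) / κ)| := by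
        rw [e]; exact abs_add_le _ _
    _ = |σ - θ| * frakD₂ κ t + θ * ((1 - Real.exp (-κ * t)) / κ) := by
        rw [abs_mul, abs_mul, abs_of_nonneg h2.1, abs_of_nonneg h3.1, abs_of_pos hθ]
    _ ≤ β * t + β * t := by
        have hβ : 0 < β := hθ.trans hθβ
        gcongr
        exacts [h2.1, h2.2, h3.1, h3.2]
    _ = 2 * β * t := by ring

/-! ### The random displacement in `x` and its derivatives in `σ` -/

/-- The displacement `𝔇(t, σ) + √(2 𝔇(t, σ)) z` of the operator `e^{𝔇(t)B}`. -/
noncomputable def drift (κ θ t σ z : ℝ) : ℝ := gaussShift (frakD κ θ t σ) z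

/-- `∂_σ` of the displacement `drift`, for `t > 0`. -/
noncomputable def drift₁ (κ θ t σ z : ℝ) : ℝ :=
  frakD₁ κ θ t σ + frakD₁ κ θ t σ / Real.sqrt (2 * frakD κ θ t σ) * z

/-- `∂_σ²` of the displacement `drift`, for `t > 0`. -/
noncomputable def drift₂ (κ θ t σ z : ℝ) : ℝ :=
  frakD₂ κ t + (frakD₂ κ t - frakD₁ κ θ t σ ^ 2 / (2 * frakD κ θ t σ)) /
    Real.sqrt (2 * frakD κ θ t σ) * z

theorem measurable_frakD (κ θ t : ℝ) : Measurable (frakD κ θ t) := by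
  unfold frakD; fun_prop

theorem measurable_frakD₁ (κ θ t : ℝ) : Measurable (frakD₁ κ θ t) := by
  unfold frakD₁; fun_prop

theorem measurable_drift (κ θ t : ℝ) : Measurable (Function.uncurry (drift κ θ t)) := by
  have := measurable_frakD κ θ t
  unfold drift gaussShift Function.uncurry
  fun_prop

theorem measurable_drift₁ (κ θ t : ℝ) : Measurable (Function.uncurry (drift₁ κ θ t)) := by
  have := measurable_frakD κ θ t
  have := measurable_frakD₁ κ θ t
  unfold drift₁ Function.uncurry
  fun_prop

theorem measurable_drift₂ (κ θ t : ℝ) : Measurable (Function.uncurry (drift₂ κ θ t)) := by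
  have := measurable_frakD κ θ t
  have := measurable_frakD₁ κ θ t
  unfold drift₂ Function.uncurry
  fun_prop

section Drift

variable {κ θ t : ℝ}

theorem hasDerivAt_sqrt_frakD (hκ : 0 < κ) (hθ : 0 < θ) (ht : 0 < t) (σ : ℝ) :
    HasDerivAt (fun σ => Real.sqrt (2 * frakD κ θ t σ))
      (frakD₁ κ θ t σ / Real.sqrt (2 * frakD κ θ t σ)) σ := by
  have hp := frakD_pos hκ hθ ht σ
  refine (((hasDerivAt_frakD_sigma hκ.ne' θ t σ).const_mul 2).sqrt (by positivity)).congr_deriv ?_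
  rw [mul_div_mul_left _ _ two_ne_zero]

theorem hasDerivAt_drift (hκ : 0 < κ) (hθ : 0 < θ) (ht : 0 < t) (z σ : ℝ) :
    HasDerivAt (fun σ => drift κ θ t σ z) (drift₁ κ θ t σ z) σ :=
  (hasDerivAt_frakD_sigma hκ.ne' θ t σ).add ((hasDerivAt_sqrt_frakD hκ hθ ht σ).mul_const z)

theorem hasDerivAt_drift₁ (hκ : 0 < κ) (hθ : 0 < θ) (ht : 0 < t) (z σ : ℝ) :
    HasDerivAt (fun σ => drift₁ κ θ t σ z) (drift₂ κ θ t σ z) σ := by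
  have hp := frakD_pos hκ hθ ht σ
  have hs : 0 < Real.sqrt (2 * frakD κ θ t σ) := Real.sqrt_pos.2 (by positivity)
  have h1 := hasDerivAt_frakD₁ hκ.ne' θ t σ
  refine (h1.add ((h1.div (hasDerivAt_sqrt_frakD hκ hθ ht σ) hs.ne').mul_const z)).congr_deriv ?_
  unfold drift₂
  have h2 := Real.sq_sqrt (show 0 ≤ 2 * frakD κ θ t σ by positivity)
  rw [h2, ← h2]
  rw [Real.sqrt_sq hs.le]
  field_simp

theorem contDiff_drift (hκ : 0 < κ) (hθ : 0 < θ) (ht : 0 < t) (z : ℝ) :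
    ContDiff ℝ ∞ fun σ => drift κ θ t σ z := by
  have h1 : ContDiff ℝ ∞ fun σ => frakD κ θ t σ := by unfold frakD; fun_prop
  have h2 : ContDiff ℝ ∞ fun σ => Real.sqrt (2 * frakD κ θ t σ) :=
    (contDiff_const.mul h1).sqrt fun σ => (mul_pos two_pos (frakD_pos hκ hθ ht σ)).ne'
  exact h1.add (h2.mul contDiff_const)

theorem contDiff_drift₁ (hκ : 0 < κ) (hθ : 0 < θ) (ht : 0 < t) (z : ℝ) :
    ContDiff ℝ ∞ fun σ => drift₁ κ θ t σ z := by
  have h := ((contDiff_infty_iff_deriv (𝕜 := ℝ)).1 (contDiff_drift hκ hθ ht z)).2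
  rwa [funext fun σ => (hasDerivAt_drift hκ hθ ht z σ).deriv] at h

/-- Uniformly on the strip, the displacement and its derivatives are of the order `√t`, `t ↘ 0`. -/
theorem exists_drift_bound {α β : ℝ} (hκ : 0 < κ) (hα : 0 < α) (hαθ : α < θ) (hθβ : θ < β) :
    ∃ M, 1 ≤ M ∧ ∀ t, 0 < t → ∀ σ ∈ Set.Ioo α β, ∀ z,
      |drift κ θ t σ z| ≤ M * (t + Real.sqrt t) * (1 + |z|) ∧
      |drift₁ κ θ t σ z| ≤ M * (t + Real.sqrt t) * (1 + |z|) ∧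
      |drift₂ κ θ t σ z| ≤ M * (t + Real.sqrt t) * (1 + |z|) := by
  have hβ : 0 < β := hα.trans (hαθ.trans hθβ)
  have key : ∀ a b s r z K L M : ℝ, |a| ≤ K * s → |b| ≤ L * r → 0 ≤ s → 0 ≤ r → K ≤ M → L ≤ M →
      0 ≤ M → |a + b * z| ≤ M * (s + r) * (1 + |z|) := by
    intro a b s r z K L M ha hb hs hr hK hL hM
    have h1 : |a| ≤ M * s := ha.trans (by gcongr)
    have h2 : |b| ≤ M * r := hb.trans (by gcongr)
    calc |a + b * z| ≤ |a| + |b| * |z| := by rw [← abs_mul]; exact abs_add_le _ _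
      _ ≤ M * s + M * r * |z| := by gcongr
      _ ≤ M * (s + r) * (1 + |z|) := by
        have := abs_nonneg z
        nlinarith [mul_nonneg hM hs, mul_nonneg hM hr, mul_nonneg (mul_nonneg hM hs) this]
  obtain ⟨M, hM⟩ : ∃ M, M = 1 + β ^ 2 / 2 + β + 2 * β + 2 * β / α + (1 + 4 * β ^ 2 / α ^ 2) / α :=
    ⟨_, rfl⟩
  have p1 : 0 ≤ β ^ 2 / 2 := by positivity
  have p2 : 0 ≤ 2 * β / α := by positivity
  have p3 : 0 ≤ (1 + 4 * β ^ 2 / α ^ 2) / α := by positivity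
  refine ⟨M, by rw [hM]; linarith, fun t ht σ hσ z => ?_⟩
  have hs := Real.sqrt_pos.2 ht
  have hss := Real.sq_sqrt ht.le
  have d0 := frakD_nonneg hκ hα hαθ hθβ ht.le hσ
  have d1 := le_frakD hκ hα hαθ hθβ ht.le hσ
  have d2 := frakD_le hκ hα hαθ hθβ ht.le hσ
  have d3 := abs_frakD₁_le hκ hα hαθ hθβ ht.le hσ
  have d4 := frakD₂_mem hκ ht.le
  have q1 : α * Real.sqrt t ≤ Real.sqrt (2 * frakD κ θ t σ) := by
    refine Real.le_sqrt_of_sq_le ?_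
    rw [mul_pow, hss]; linarith
  have q2 : Real.sqrt (2 * frakD κ θ t σ) ≤ β * Real.sqrt t := by
    refine Real.sqrt_le_iff.2 ⟨by positivity, ?_⟩
    rw [mul_pow, hss]; linarith
  have q0 : 0 < Real.sqrt (2 * frakD κ θ t σ) := lt_of_lt_of_le (by positivity) q1
  have q3 : |frakD₁ κ θ t σ / Real.sqrt (2 * frakD κ θ t σ)| ≤ 2 * β / α * Real.sqrt t := by
    rw [abs_div, abs_of_pos q0, div_le_iff₀ q0]
    calc |frakD₁ κ θ t σ| ≤ 2 * β * t := d3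
      _ = 2 * β / α * Real.sqrt t * (α * Real.sqrt t) := by
        rw [← hss, Real.sqrt_sq hs.le]; field_simp
      _ ≤ _ := by gcongr
  have q4 : |(frakD₂ κ t - frakD₁ κ θ t σ ^ 2 / (2 * frakD κ θ t σ)) /
      Real.sqrt (2 * frakD κ θ t σ)| ≤ (1 + 4 * β ^ 2 / α ^ 2) / α * Real.sqrt t := by
    rw [abs_div, abs_of_pos q0, div_le_iff₀ q0]
    have e : frakD₁ κ θ t σ ^ 2 / (2 * frakD κ θ t σ) =
        |frakD₁ κ θ t σ / Real.sqrt (2 * frakD κ θ t σ)| ^ 2 := by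
      rw [sq_abs, div_pow, Real.sq_sqrt (by positivity)]
    have h2 : |frakD₁ κ θ t σ / Real.sqrt (2 * frakD κ θ t σ)| ^ 2 ≤
        4 * β ^ 2 / α ^ 2 * t := by
      refine (pow_le_pow_left₀ (abs_nonneg _) q3 2).trans_eq ?_
      rw [mul_pow, hss]; ring
    calc |frakD₂ κ t - frakD₁ κ θ t σ ^ 2 / (2 * frakD κ θ t σ)|
        ≤ |frakD₂ κ t| + |frakD₁ κ θ t σ ^ 2 / (2 * frakD κ θ t σ)| := abs_sub _ _
      _ ≤ t + 4 * β ^ 2 / α ^ 2 * t := by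
        rw [e, abs_of_nonneg d4.1, abs_of_nonneg (sq_nonneg _)]
        exact add_le_add d4.2 h2
      _ = (1 + 4 * β ^ 2 / α ^ 2) / α * Real.sqrt t * (α * Real.sqrt t) := by
        rw [← hss, Real.sqrt_sq hs.le]; field_simp
      _ ≤ _ := by gcongr
  refine ⟨?_, ?_, ?_⟩
  · exact key _ _ t (Real.sqrt t) z (β ^ 2 / 2) β M (by rwa [abs_of_nonneg d0])
      (by rwa [abs_of_pos q0]) ht.le hs.le (by rw [hM]; linarith) (by rw [hM]; linarith)
      (by rw [hM]; linarith)
  · exact key _ _ t (Real.sqrt t) z (2 * β) _ M d3 q3 ht.le hs.le (by rw [hM]; linarith)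
      (by rw [hM]; linarith) (by rw [hM]; linarith)
  · exact key _ _ t (Real.sqrt t) z 1 _ M (by rw [abs_of_nonneg d4.1, one_mul]; exact d4.2) q4
      ht.le hs.le (by rw [hM]; linarith) (by rw [hM]; linarith) (by rw [hM]; linarith)

end Drift

/-! ### The operators `e^{tA}`, `e^{𝔇(t)B}` and their product -/

section Operators

variable {κ θ α β lam t : ℝ}

theorem drift_bound_zero (κ θ σ z : ℝ) : drift κ θ 0 σ z = 0 := by
  simp [drift, frakD_zero, gaussShift]

/-- A bound of the displacement which is good for one fixed `t ≥ 0`. -/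
theorem exists_drift_bound_at (hκ : 0 < κ) (hα : 0 < α) (hαθ : α < θ) (hθβ : θ < β)
    (ht : 0 ≤ t) : ∃ A, 0 ≤ A ∧ ∀ σ ∈ Set.Ioo α β, ∀ z, |drift κ θ t σ z| ≤ A * (1 + |z|) := by
  obtain ⟨M, hM1, hM⟩ := exists_drift_bound hκ hα hαθ hθβ
  rcases ht.eq_or_lt with rfl | ht
  · exact ⟨0, le_rfl, fun σ _ z => by simp [drift_bound_zero]⟩
  · exact ⟨M * (t + Real.sqrt t), by positivity, fun σ hσ z => (hM t ht σ hσ z).1⟩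

theorem isAveraging_drift (lam : ℝ) (hαθ : α < θ) (hθβ : θ < β) {m m₀ A K : ℝ} (hm₀ : 0 < m₀)
    (hm : m₀ ≤ m) (hm1 : m ≤ 1)
    (hA : ∀ σ ∈ Set.Ioo α β, ∀ z, |drift κ θ t σ z| ≤ A * (1 + |z|))
    {ρ : ℝ × ℝ → ℝ → ℝ} (hρ : Measurable (Function.uncurry ρ))
    (hρb : ∀ p : ℝ × ℝ, p.1 ∈ Set.Ioo α β → ∀ z,
      |ρ p z| ≤ K * Real.exp (2 * (A * (1 + |z|)))) :
    IsAveraging (weightMeasure₂ α β lam) gauss ρ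
      (fun p z => shearMap θ m (fun σ => drift κ θ t σ z) p)
      (fun z => K * Real.exp (2 * (A * (1 + |z|))))
      (fun z => m₀⁻¹ * Real.exp (2 * |lam| * (A * (1 + |z|)))) :=
  isAveraging_of_bounds lam hαθ hθβ (H := fun z => A * (1 + |z|)) (m := fun _ => m) hρ
    measurable_const hm₀ (fun _ => hm) (fun _ => hm1) (measurable_drift κ θ t) (by fun_prop)
    hρb hA (integrable_exp_affine_gauss _ _)

theorem isAveraging_drift_one (lam : ℝ) (hαθ : α < θ) (hθβ : θ < β) {m A : ℝ} (hm : 0 < m)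
    (hm1 : m ≤ 1) (hA0 : 0 ≤ A)
    (hA : ∀ σ ∈ Set.Ioo α β, ∀ z, |drift κ θ t σ z| ≤ A * (1 + |z|)) :
    IsAveraging (weightMeasure₂ α β lam) gauss (fun _ _ => 1)
      (fun p z => shearMap θ m (fun σ => drift κ θ t σ z) p)
      (fun z => 1 * Real.exp (2 * (A * (1 + |z|))))
      (fun z => m⁻¹ * Real.exp (2 * |lam| * (A * (1 + |z|)))) :=
  isAveraging_drift lam hαθ hθβ hm le_rfl hm1 hA measurable_const fun p _ z => by
    simpa using one_le_exp_affine hA0 z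

theorem shearMap_flow (κ θ t : ℝ) (h : ℝ → ℝ) (p : ℝ × ℝ) :
    shearMap θ (Real.exp (-κ * t)) h p = (flow κ θ t p.1, p.2 - h p.1) := by
  rw [flow_eq]; rfl

theorem exists_expA (lam : ℝ) (hκ : 0 < κ) (hαθ : α < θ) (hθβ : θ < β) :
    ∃ EA : ℝ → L2IR α β lam →L[ℂ] L2IR α β lam,
      ∀ t, 0 ≤ t → ∀ u, IsExpA κ θ t u (EA t u) := by
  have : ∀ t, ∃ T : L2IR α β lam →L[ℂ] L2IR α β lam, 0 ≤ t → ∀ u, IsExpA κ θ t u (T u) := by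
    intro t
    by_cases ht : 0 ≤ t
    · have hA := isAveraging_of_bounds (ν := Measure.dirac ()) (α := α) (β := β) lam hαθ hθβ
        (ρ := fun _ _ => 1)
        (m := fun _ => Real.exp (-κ * t)) (h := fun _ _ => 0) (H := fun _ => 0) (K := 1)
        measurable_const measurable_const (Real.exp_pos (-κ * t)) (fun _ => le_rfl)
        (fun _ => exp_neg_mul_le_one hκ ht) measurable_const measurable_const
        (by simp) (by simp) (integrable_const _)
      obtain ⟨T, hT, -⟩ := hA.exists_clm
      refine ⟨T, fun _ u => ?_⟩
      filter_upwards [hT u] with p hp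
      rw [hp]
      simp only [shearMap_flow, sub_zero, one_smul, integral_const, probReal_univ]
    · exact ⟨0, fun h => absurd h ht⟩
  choose EA hEA using this
  exact ⟨EA, hEA⟩

theorem exists_expFamilyB (lam : ℝ) (hκ : 0 < κ) (hα : 0 < α) (hαθ : α < θ) (hθβ : θ < β) :
    ∃ EB : ℝ → L2IR α β lam →L[ℂ] L2IR α β lam, ∀ t, 0 ≤ t → ∀ u,
      EB t u =ᵐ[weightMeasure₂ α β lam]
        fun p => ∫ z, u (p.1, p.2 - drift κ θ t p.1 z) ∂gauss := by
  have : ∀ t, ∃ T : L2IR α β lam →L[ℂ] L2IR α β lam, 0 ≤ t → ∀ u,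
      T u =ᵐ[weightMeasure₂ α β lam]
        fun p => ∫ z, u (p.1, p.2 - drift κ θ t p.1 z) ∂gauss := by
    intro t
    by_cases ht : 0 ≤ t
    · obtain ⟨A, hA0, hA⟩ := exists_drift_bound_at hκ hα hαθ hθβ ht
      obtain ⟨T, hT, -⟩ :=
        (isAveraging_drift_one lam hαθ hθβ one_pos le_rfl hA0 hA).exists_clm
      exact ⟨T, fun _ u => by simpa only [one_smul, shearMap_one] using hT u⟩
    · exact ⟨0, fun h => absurd h ht⟩
  choose EB hEB using this
  exact ⟨EB, hEB⟩

theorem memLp_slice {u : ℝ × ℝ → ℂ} (hu : Measurable u)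
    (hu2 : MemLp u 2 (weightMeasure₂ α β lam)) :
    ∀ᵐ σ ∂(volume.restrict (Set.Ioo α β)), MemLp (fun x => u (σ, x)) 2 (weightMeasure lam) := by
  have h := lintegral_enorm_sq_lt_top hu2
  have hm : Measurable fun p => ‖u p‖ₑ ^ 2 := hu.enorm.pow_const 2
  unfold weightMeasure₂ at h
  rw [lintegral_prod _ hm.aemeasurable] at h
  filter_upwards [ae_lt_top hm.lintegral_prod_right' h.ne] with σ hσ
  exact memLp_two_of_lintegral (hu.comp measurable_prodMk_left).aestronglyMeasurable hσ

theorem isExpFamilyB_of_average (hκ : 0 < κ) (hα : 0 < α) (hαθ : α < θ) (hθβ : θ < β)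
    {E : ℝ → L2R lam →L[ℂ] L2R lam}
    (hE : ∀ s, 0 ≤ s → ∀ f,
      E s f =ᵐ[weightMeasure lam] fun x => ∫ z, f (x - gaussShift s z) ∂gauss)
    (ht : 0 ≤ t) {u v : L2IR α β lam}
    (hv : v =ᵐ[weightMeasure₂ α β lam]
      fun p => ∫ z, u (p.1, p.2 - drift κ θ t p.1 z) ∂gauss) :
    IsExpFamilyB E (fun σ => frakD κ θ t σ) u v := by
  unfold IsExpFamilyB
  filter_upwards [memLp_slice (measurable_Lp u) (Lp.memLp u), Measure.ae_ae_of_ae_prod hv,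
    ae_restrict_mem measurableSet_Ioo] with σ h1 h2 hσ
  have h0 := frakD_nonneg hκ hα hαθ hθβ ht hσ
  refine ⟨h1.toLp _, E (frakD κ θ t σ) (h1.toLp _), h1.coeFn_toLp, ?_, rfl⟩
  filter_upwards [h2, hE _ h0 (h1.toLp _),
    (isAveraging_gaussShift lam h0 le_rfl).ae_comp h1.coeFn_toLp] with x e1 e2 e3
  rw [e2, e1, integral_congr_ae e3]
  rfl

section Product

variable {EA EB : ℝ → L2IR α β lam →L[ℂ] L2IR α β lam}

/-- `e^{𝔇(t)B} e^{tA}` is an averaged composition operator. -/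
theorem expFamilyB_expA (hκ : 0 < κ) (hα : 0 < α) (hαθ : α < θ) (hθβ : θ < β)
    (hEA : ∀ t, 0 ≤ t → ∀ u, IsExpA κ θ t u (EA t u))
    (hEB : ∀ t, 0 ≤ t → ∀ u, EB t u =ᵐ[weightMeasure₂ α β lam]
        fun p => ∫ z, u (p.1, p.2 - drift κ θ t p.1 z) ∂gauss)
    (ht : 0 ≤ t) (u : L2IR α β lam) :
    EB t (EA t u) =ᵐ[weightMeasure₂ α β lam]
      fun p => ∫ z, u (flow κ θ t p.1, p.2 - drift κ θ t p.1 z) ∂gauss := by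
  obtain ⟨A, hA0, hA⟩ := exists_drift_bound_at hκ hα hαθ hθβ ht
  filter_upwards [hEB t ht (EA t u),
    (isAveraging_drift_one lam hαθ hθβ one_pos le_rfl hA0 hA).ae_comp (hEA t ht u)] with p h1 h2
  simp only [shearMap_one] at h2
  rw [h1, integral_congr_ae h2]

theorem dist_shearMap_le {m : ℝ} (hm1 : m ≤ 1) (hαθ : α < θ) (hθβ : θ < β) (h : ℝ → ℝ)
    {p : ℝ × ℝ} (hp : p.1 ∈ Set.Ioo α β) :
    dist (shearMap θ m h p) p ≤ (1 - m) * (β - α) + |h p.1| := by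
  have h0 : 0 ≤ 1 - m := by linarith
  have h1 : |p.1 - θ| ≤ β - α := abs_le.2 ⟨by linarith [hp.1], by linarith [hp.2]⟩
  have h2 : 0 ≤ (1 - m) * (β - α) := mul_nonneg h0 ((abs_nonneg _).trans h1)
  rw [Prod.dist_eq]
  refine max_le ?_ ?_
  · rw [Real.dist_eq, show (shearMap θ m h p).1 - p.1 = -((1 - m) * (p.1 - θ)) by
      simp only [shearMap]; ring, abs_neg, abs_mul, abs_of_nonneg h0]
    exact (mul_le_mul_of_nonneg_left h1 h0).trans (le_add_of_nonneg_right (abs_nonneg _))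
  · rw [Real.dist_eq, show (shearMap θ m h p).2 - p.2 = -h p.1 by simp only [shearMap]; ring,
      abs_neg]
    exact le_add_of_nonneg_left h2

theorem add_sqrt_le_two (ht : t ≤ 1) : t + Real.sqrt t ≤ 2 := by
  have := Real.sqrt_le_one.2 ht
  linarith

theorem tendsto_add_sqrt : Tendsto (fun t : ℝ => t + Real.sqrt t) (𝓝[>] 0) (𝓝 0) := by
  have : Continuous fun a : ℝ => a + Real.sqrt a := by fun_prop
  simpa using (this.tendsto 0).mono_left nhdsWithin_le_nhds

theorem tendsto_exp_neg_mul (κ : ℝ) :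
    Tendsto (fun t => Real.exp (-κ * t)) (𝓝[>] 0) (𝓝 1) := by
  have : Continuous fun t : ℝ => Real.exp (-κ * t) := by fun_prop
  simpa using (this.tendsto 0).mono_left nhdsWithin_le_nhds

/-- The strong limit, as `t ↘ 0`, of the averages along the maps
`(σ, x) ↦ (δ_t(σ), x - drift κ θ t σ z)` whose coefficients tend to a constant. -/
theorem tendsto_drift_average (hκ : 0 < κ) (hαθ : α < θ) (hθβ : θ < β) {M : ℝ} (hM1 : 1 ≤ M)
    (hM : ∀ t, 0 < t → ∀ σ ∈ Set.Ioo α β, ∀ z,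
      |drift κ θ t σ z| ≤ M * (t + Real.sqrt t) * (1 + |z|))
    {ρ : ℝ → ℝ × ℝ → ℝ → ℝ} {c : ℝ} (hc : |c| ≤ 1)
    (hρm : ∀ t, Measurable (Function.uncurry (ρ t)))
    (hρb : ∀ t ∈ Set.Ioo (0 : ℝ) 1, ∀ p : ℝ × ℝ, p.1 ∈ Set.Ioo α β → ∀ z,
      |ρ t p z| ≤ Real.exp (2 * (M * 2 * (1 + |z|))))
    (hρ : ∀ p : ℝ × ℝ, p.1 ∈ Set.Ioo α β → ∀ z,
      Tendsto (fun t => ρ t p z) (𝓝[>] 0) (𝓝 c))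
    {f : L2IR α β lam} {F : ℝ → L2IR α β lam}
    (hF : ∀ᶠ t in 𝓝[>] 0, F t =ᵐ[weightMeasure₂ α β lam] fun p =>
      ∫ z, ρ t p z • f (flow κ θ t p.1, p.2 - drift κ θ t p.1 z) ∂gauss) :
    Tendsto F (𝓝[>] 0) (𝓝 (c • f)) := by
  have hM2 : ∀ t ∈ Set.Ioo (0 : ℝ) 1, ∀ σ ∈ Set.Ioo α β, ∀ z,
      |drift κ θ t σ z| ≤ M * 2 * (1 + |z|) := by
    intro t ht σ hσ z
    refine (hM t ht.1 σ hσ z).trans ?_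
    gcongr
    exact add_sqrt_le_two ht.2.le
  refine tendsto_averaging (ν := gauss) (ρ := ρ) (ρ₀ := fun _ _ => c)
    (Φ := fun t p z => shearMap θ (Real.exp (-κ * t)) (fun σ => drift κ θ t σ z) p)
    (R := fun z => 1 * Real.exp (2 * (M * 2 * (1 + |z|))))
    (C := fun z => (Real.exp (-κ * 1))⁻¹ * Real.exp (2 * |lam| * (M * 2 * (1 + |z|))))
    (η := fun t z => (1 - Real.exp (-κ * t)) * (β - α) + M * (t + Real.sqrt t) * (1 + |z|))
    ?_ ?_ ?_ measurable_const ?_ ?_ f ?_ ?_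
  · filter_upwards [eventually_mem_Ioo_one] with t ht
    refine isAveraging_drift lam hαθ hθβ (Real.exp_pos _) (Real.exp_le_exp.2 ?_)
      (exp_neg_mul_le_one hκ ht.1.le) (hM2 t ht) (hρm t) (fun p hp z => ?_)
    · nlinarith [ht.2]
    · rw [one_mul]; exact hρb t ht p hp z
  · intro z
    have h1 := ((tendsto_exp_neg_mul κ).const_sub 1).mul_const (β - α)
    have h2 := (tendsto_add_sqrt.const_mul M).mul_const (1 + |z|)
    simpa using h1.add h2
  · filter_upwards [eventually_mem_Ioo_one] with t ht
    filter_upwards [ae_fst_mem α β lam] with p hp z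
    refine (dist_shearMap_le (exp_neg_mul_le_one hκ ht.1.le) hαθ hθβ _ hp).trans ?_
    gcongr
    exact hM t ht.1 p.1 hp z
  · refine Eventually.of_forall fun p z => ?_
    rw [one_mul]
    exact hc.trans (one_le_exp_affine (by linarith) z)
  · filter_upwards [ae_fst_mem α β lam] with p hp z using hρ p hp z
  · simpa only [shearMap_flow] using hF
  · filter_upwards [Lp.coeFn_smul c f] with p hp
    rw [hp]
    simp

/-- `e^{𝔇(t)B} e^{tA}` is a `c₀` semigroup; the semigroup law is the cocycle identity of `𝔇` along
the flow `δ`, together with the additivity of the variances of independent Gaussians. -/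
theorem isC0Semigroup_expFamilyB_expA (hκ : 0 < κ) (hα : 0 < α) (hαθ : α < θ) (hθβ : θ < β)
    (hEA : ∀ t, 0 ≤ t → ∀ u, IsExpA κ θ t u (EA t u))
    (hEB : ∀ t, 0 ≤ t → ∀ u, EB t u =ᵐ[weightMeasure₂ α β lam]
        fun p => ∫ z, u (p.1, p.2 - drift κ θ t p.1 z) ∂gauss) :
    IsC0Semigroup fun t => (EB t).comp (EA t) where
  map_add := by
    intro s t hs ht
    refine ContinuousLinearMap.ext fun u => Lp.ext ?_
    simp only [ContinuousLinearMap.comp_apply]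
    obtain ⟨A, hA0, hA⟩ := exists_drift_bound_at hκ hα hαθ hθβ hs
    obtain ⟨A', hA0', hA'⟩ := exists_drift_bound_at hκ hα hαθ hθβ (add_nonneg hs ht)
    have a1 := isAveraging_drift_one lam hαθ hθβ (Real.exp_pos _)
      (exp_neg_mul_le_one hκ hs) hA0 hA
    have a2 := isAveraging_drift_one lam hαθ hθβ (Real.exp_pos _)
      (exp_neg_mul_le_one hκ (add_nonneg hs ht)) hA0' hA'
    filter_upwards [expFamilyB_expA hκ hα hαθ hθβ hEA hEB (add_nonneg hs ht) u,
      expFamilyB_expA hκ hα hαθ hθβ hEA hEB hs (EB t (EA t u)),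
      a1.ae_comp (expFamilyB_expA hκ hα hαθ hθβ hEA hEB ht u),
      a2.ae_integrable (measurable_Lp u) (Lp.memLp u), ae_fst_mem α β lam] with p h1 h2 h3 h4 hp
    simp only [shearMap_flow, one_smul] at h3 h4
    rw [h1, h2, integral_congr_ae h3]
    simp only [flow_flow]
    have d1 := frakD_nonneg hκ hα hαθ hθβ hs hp
    have d2 := frakD_nonneg hκ hα hαθ hθβ ht (flow_mem hκ hαθ hθβ hs hp)
    have e : 2 * frakD κ θ s p.1 + 2 * frakD κ θ t (flow κ θ s p.1) =
        2 * frakD κ θ (s + t) p.1 := by rw [frakD_add hκ.ne']; ring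
    have := integral_gauss_gauss (2 * frakD κ θ s p.1) (2 * frakD κ θ t (flow κ θ s p.1))
      (by positivity) (by positivity)
      (k := fun w => u (flow κ θ (s + t) p.1, p.2 - frakD κ θ (s + t) p.1 - w))
      ((measurable_Lp u).comp (measurable_const.prodMk (measurable_const.sub measurable_id))) (by
        rw [e]
        refine h4.congr (Eventually.of_forall fun z => ?_)
        simp only [drift, gaussShift, sub_sub])
    rw [e] at this
    refine Eq.trans ?_ (this.symm.trans ?_)
    · simp only [drift, gaussShift, sub_sub]
    · refine integral_congr_ae (Eventually.of_forall fun z => ?_)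
      refine integral_congr_ae (Eventually.of_forall fun z' => ?_)
      simp only [drift, gaussShift]
      rw [frakD_add hκ.ne']
      congr 2
      ring
  map_zero := by
    refine ContinuousLinearMap.ext fun u => Lp.ext ?_
    filter_upwards [expFamilyB_expA hκ hα hαθ hθβ hEA hEB le_rfl u] with p hp
    rw [ContinuousLinearMap.comp_apply, hp]
    simp [drift_bound_zero, flow]
  tendsto := by
    intro u
    obtain ⟨M, hM1, hM⟩ := exists_drift_bound hκ hα hαθ hθβ
    have := tendsto_drift_average (lam := lam) hκ hαθ hθβ hM1
      (fun t ht σ hσ z => (hM t ht σ hσ z).1)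
      (ρ := fun _ _ _ => 1) (c := 1) (by simp) (fun _ => measurable_const)
      (fun t _ p _ z => by simpa using one_le_exp_affine (A := M * 2) (by linarith) z)
      (fun _ _ _ => tendsto_const_nhds) (f := u) (F := fun t => EB t (EA t u)) (by
        filter_upwards [self_mem_nhdsWithin] with t ht
        simpa only [one_smul] using expFamilyB_expA hκ hα hαθ hθβ hEA hEB (le_of_lt ht) u)
    rwa [one_smul] at this

end Product

end Operators

/-! ### The generator on `H²_lam(I × ℝ)` -/

/-- The limit of averaging operators, together with the functions it involves. -/
theorem exists_tendsto_averaging {P Z ι : Type*} [MeasurableSpace P] [MeasurableSpace Z]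
    [MetricSpace P] [ProperSpace P] [BorelSpace P]
    {μ : Measure P} [SFinite μ] [μ.Regular] {ν : Measure Z} [IsProbabilityMeasure ν]
    {l : Filter ι} [l.IsCountablyGenerated] [l.NeBot]
    {ρ : ι → P → Z → ℝ} {Φ : ι → P → Z → P} {R C : Z → ℝ} {ρ₀ : P → Z → ℝ} {η : ι → Z → ℝ}
    (h : ∀ᶠ t in l, IsAveraging μ ν (ρ t) (Φ t) R C)
    (hη : ∀ z, Tendsto (fun t => η t z) l (𝓝 0))
    (hd : ∀ᶠ t in l, ∀ᵐ p ∂μ, ∀ z, dist (Φ t p z) p ≤ η t z)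
    (hρ₀ : Measurable (Function.uncurry ρ₀)) (hb₀ : ∀ᵐ p ∂μ, ∀ z, |ρ₀ p z| ≤ R z)
    (hρ : ∀ᵐ p ∂μ, ∀ z, Tendsto (fun t => ρ t p z) l (𝓝 (ρ₀ p z))) (f : Lp ℂ 2 μ) :
    ∃ (F : ι → Lp ℂ 2 μ) (g : Lp ℂ 2 μ),
      (∀ᶠ t in l, F t =ᵐ[μ] fun p => ∫ z, ρ t p z • f (Φ t p z) ∂ν) ∧
      (g =ᵐ[μ] fun p => (∫ z, ρ₀ p z ∂ν) • f p) ∧ Tendsto F l (𝓝 g) := by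
  classical
  have hF : ∀ t, ∃ F : Lp ℂ 2 μ, IsAveraging μ ν (ρ t) (Φ t) R C →
      F =ᵐ[μ] fun p => ∫ z, ρ t p z • f (Φ t p z) ∂ν := by
    intro t
    by_cases ht : IsAveraging μ ν (ρ t) (Φ t) R C
    · obtain ⟨T, hT, -⟩ := ht.exists_clm
      exact ⟨T f, fun _ => hT f⟩
    · exact ⟨0, fun h => absurd h ht⟩
  choose F hF using hF
  obtain ⟨t₀, ht₀⟩ := h.exists
  have hA₀ : IsAveraging μ ν ρ₀ (fun p _ => p) R C :=
    { ht₀.of_coeff with measurable_coeff := hρ₀, abs_le := hb₀ }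
  obtain ⟨T, hT, -⟩ := hA₀.exists_clm
  have hF' := h.mono fun t ht => hF t ht
  have hg : T f =ᵐ[μ] fun p => (∫ z, ρ₀ p z ∂ν) • f p := by
    filter_upwards [hT f] with p hp
    rw [hp, integral_smul_const]
  exact ⟨F, T f, hF', hg, tendsto_averaging h hη hd hρ₀ hb₀ hρ f hF' hg⟩

section Generator

variable {κ θ α β lam t : ℝ}

theorem abs_unitInterval_mul_le (r : unitInterval) {a b : ℝ} (h : |a| ≤ b) : |(r : ℝ) * a| ≤ b := by
  rw [abs_mul, abs_of_nonneg r.2.1]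
  exact (mul_le_of_le_one_left (abs_nonneg _) r.2.2).trans h

theorem isAveraging_contraction (lam : ℝ) (hκ : 0 < κ) (hαθ : α < θ) (hθβ : θ < β)
    (ht : 0 ≤ t) (ht1 : t ≤ 1) {A : ℝ} (hA0 : 0 ≤ A) {h : ℝ → ℝ → ℝ}
    (hh : Measurable (Function.uncurry h))
    (hA : ∀ σ ∈ Set.Ioo α β, ∀ z, |h σ z| ≤ A * (1 + |z|)) :
    IsAveraging (weightMeasure₂ α β lam) (gauss.prod (volume : Measure unitInterval))
      (fun p q => -(κ * Real.exp (-(q.2 * (κ * t))) * (p.1 - θ)))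
      (fun p q => shearMap θ (Real.exp (-(q.2 * (κ * t)))) (fun σ => h σ q.1) p)
      (fun q => κ * (β - α) * Real.exp (2 * (A * (1 + |q.1|))))
      (fun q => (Real.exp (-κ))⁻¹ * Real.exp (2 * |lam| * (A * (1 + |q.1|)))) := by
  have hr : ∀ r : unitInterval, 0 ≤ (r : ℝ) * (κ * t) ∧ (r : ℝ) * (κ * t) ≤ κ := fun r =>
    ⟨mul_nonneg r.2.1 (mul_nonneg hκ.le ht), (mul_le_of_le_one_left (mul_nonneg hκ.le ht)
      r.2.2).trans (mul_le_of_le_one_right hκ.le ht1)⟩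
  have me : Measurable fun q : ℝ × unitInterval => Real.exp (-(q.2 * (κ * t))) :=
    ((measurable_subtype_coe.comp measurable_snd).mul_const _).neg.exp
  refine isAveraging_of_bounds lam hαθ hθβ (H := fun q => A * (1 + |q.1|)) ?_ me
    (Real.exp_pos _) (fun q => Real.exp_le_exp.2 (neg_le_neg (hr q.2).2))
    (fun q => Real.exp_le_one_iff.2 (neg_nonpos.2 (hr q.2).1)) ?_ (by fun_prop) ?_
    (fun σ hσ q => hA σ hσ q.1)
    ((integrable_exp_affine_gauss _ _).comp_fst (volume : Measure unitInterval))
  · exact (((me.comp measurable_snd).const_mul κ).mul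
      ((measurable_fst.comp measurable_fst).sub_const θ)).neg
  · exact (hh).comp (measurable_fst.prodMk (measurable_fst.comp measurable_snd))
  · intro p hp q
    have h1 : |p.1 - θ| ≤ β - α := abs_le.2 ⟨by linarith [hp.1], by linarith [hp.2]⟩
    have h2 := one_le_exp_affine hA0 q.1
    have h3 : Real.exp (-(q.2 * (κ * t))) ≤ 1 :=
      Real.exp_le_one_iff.2 (neg_nonpos.2 (hr q.2).1)
    rw [abs_neg, abs_mul, abs_mul, abs_of_pos hκ, abs_of_pos (Real.exp_pos _)]
    calc κ * Real.exp (-(q.2 * (κ * t))) * |p.1 - θ| ≤ κ * 1 * (β - α) := by gcongr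
      _ = κ * (β - α) * 1 := by ring
      _ ≤ _ := by
        have : 0 ≤ β - α := by linarith
        gcongr

/-- The second order Taylor remainder, as an average. -/
theorem isAveraging_taylor (lam : ℝ) (hαθ : α < θ) (hθβ : θ < β) {A c : ℝ}
    {h : ℝ → ℝ → ℝ} (hh : Measurable (Function.uncurry h))
    (hA : ∀ σ ∈ Set.Ioo α β, ∀ z, |h σ z| ≤ A * (1 + |z|))
    (hc : ∀ σ ∈ Set.Ioo α β, ∀ z, |c * h σ z ^ 2| ≤ Real.exp (2 * (A * (1 + |z|)))) :
    IsAveraging (weightMeasure₂ α β lam)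
      ((gauss.prod (volume : Measure unitInterval)).prod (volume : Measure unitInterval))
      (fun p q => c * h p.1 q.1.1 ^ 2 * q.1.2)
      (fun p q => shearMap θ 1 (fun σ => q.2 * (q.1.2 * h σ q.1.1)) p)
      (fun q => 1 * Real.exp (2 * (A * (1 + |q.1.1|))))
      (fun q => 1⁻¹ * Real.exp (2 * |lam| * (A * (1 + |q.1.1|)))) := by
  have m1 : Measurable fun q : (ℝ × ℝ) × (ℝ × unitInterval) × unitInterval =>
      h q.1.1 q.2.1.1 :=
    (hh).comp ((measurable_fst.comp measurable_fst).prodMk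
      (measurable_fst.comp (measurable_fst.comp measurable_snd)))
  have m2 : Measurable fun q : ℝ × (ℝ × unitInterval) × unitInterval =>
      h q.1 q.2.1.1 :=
    (hh).comp (measurable_fst.prodMk
      (measurable_fst.comp (measurable_fst.comp measurable_snd)))
  have m3 : Measurable fun q : (ℝ × ℝ) × (ℝ × unitInterval) × unitInterval => (q.2.1.2 : ℝ) :=
    measurable_subtype_coe.comp (measurable_snd.comp (measurable_fst.comp measurable_snd))
  have m4 : Measurable fun q : ℝ × (ℝ × unitInterval) × unitInterval =>
      (q.2.2 : ℝ) * (q.2.1.2 * h q.1 q.2.1.1) :=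
    (measurable_subtype_coe.comp (measurable_snd.comp measurable_snd)).mul
      ((measurable_subtype_coe.comp (measurable_snd.comp
        (measurable_fst.comp measurable_snd))).mul m2)
  have m5 : Measurable fun q : (ℝ × unitInterval) × unitInterval => A * (1 + |q.1.1|) := by
    fun_prop
  have hi : Integrable (fun q : (ℝ × unitInterval) × unitInterval =>
      Real.exp ((4 + 2 * |lam|) * (A * (1 + |q.1.1|))))
      ((gauss.prod (volume : Measure unitInterval)).prod (volume : Measure unitInterval)) :=
    ((integrable_exp_affine_gauss (4 + 2 * |lam|) A).comp_fst
      (volume : Measure unitInterval)).comp_fst (volume : Measure unitInterval)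
  have hρ : ∀ p : ℝ × ℝ, p.1 ∈ Set.Ioo α β → ∀ q : (ℝ × unitInterval) × unitInterval,
      |c * h p.1 q.1.1 ^ 2 * q.1.2| ≤ 1 * Real.exp (2 * (A * (1 + |q.1.1|))) := by
    intro p hp q
    rw [one_mul, abs_mul, abs_of_nonneg q.1.2.2.1]
    exact (mul_le_of_le_one_right (abs_nonneg _) q.1.2.2.2).trans (hc _ hp _)
  exact isAveraging_of_bounds lam hαθ hθβ (((m1.pow_const 2).const_mul c).mul m3)
    measurable_const one_pos (fun _ => le_rfl) (fun _ => le_rfl) m4 m5 hρ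
    (fun σ hσ q => abs_unitInterval_mul_le _ (abs_unitInterval_mul_le _ (hA σ hσ _))) hi

variable {EA EB : ℝ → L2IR α β lam →L[ℂ] L2IR α β lam}

theorem integral_drift (κ θ t σ : ℝ) : ∫ z, drift κ θ t σ z ∂gauss = frakD κ θ t σ :=
  integral_gaussShift _

/-- Taylor's formula for `e^{𝔇(t)B} e^{tA} u - u`: first order in `σ`, second order in `x`. -/
theorem expFamilyB_expA_sub_eq (hκ : 0 < κ) (hα : 0 < α) (hαθ : α < θ) (hθβ : θ < β)
    (hEA : ∀ t, 0 ≤ t → ∀ u, IsExpA κ θ t u (EA t u))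
    (hEB : ∀ t, 0 ≤ t → ∀ u, EB t u =ᵐ[weightMeasure₂ α β lam]
        fun p => ∫ z, u (p.1, p.2 - drift κ θ t p.1 z) ∂gauss)
    (ht : 0 < t) (ht1 : t ≤ 1) {A : ℝ} (hA0 : 0 ≤ A)
    (hA : ∀ σ ∈ Set.Ioo α β, ∀ z, |drift κ θ t σ z| ≤ A * (1 + |z|))
    {u us ux uxx : L2IR α β lam} (hs : IsWeakPDeriv α β 1 0 u us)
    (hx : IsWeakPDeriv α β 0 1 u ux) (hxx : IsWeakPDeriv α β 0 1 ux uxx) :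
    ∀ᵐ p ∂weightMeasure₂ α β lam, EB t (EA t u) p - u p =
      (∫ q : ℝ × unitInterval, t • (-(κ * Real.exp (-(q.2 * (κ * t))) * (p.1 - θ))) •
        us (θ + Real.exp (-(q.2 * (κ * t))) * (p.1 - θ), p.2 - drift κ θ t p.1 q.1)
        ∂(gauss.prod volume)) + (-frakD κ θ t p.1) • ux p +
      ∫ q : (ℝ × unitInterval) × unitInterval, (drift κ θ t p.1 q.1.1 ^ 2 * q.1.2) •
        uxx (p.1, p.2 - q.2 * (q.1.2 * drift κ θ t p.1 q.1.1))
        ∂((gauss.prod volume).prod volume) := by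
  have a1 := isAveraging_drift_one lam hαθ hθβ (Real.exp_pos _)
    (exp_neg_mul_le_one hκ ht.le) hA0 hA
  have a2 := isAveraging_drift_one lam hαθ hθβ one_pos le_rfl hA0 hA
  have a3 := isAveraging_contraction lam hκ hαθ hθβ ht.le ht1 hA0 (measurable_drift κ θ t) hA
  have c1 := comp_contraction_sub_eq hαθ hθβ (mul_nonneg hκ.le ht.le) (measurable_Lp u)
    (Lp.memLp u) (measurable_Lp us) (Lp.memLp us) hs
  filter_upwards [expFamilyB_expA hκ hα hαθ hθβ hEA hEB ht.le u, a2.ae_comp c1,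
    a1.ae_integrable (measurable_Lp u) (Lp.memLp u),
    a2.ae_integrable (measurable_Lp u) (Lp.memLp u),
    a3.ae_integrable (measurable_Lp us) (Lp.memLp us),
    integral_shear_sub_eq (ν := gauss) hαθ hθβ (contDiff_drift hκ (hα.trans hαθ) ht)
      (measurable_drift κ θ t) (by fun_prop) hA (integrable_exp_affine_gauss _ _)
      (measurable_Lp u) (Lp.memLp u) (measurable_Lp ux) (Lp.memLp ux) (measurable_Lp uxx)
      (Lp.memLp uxx) hx hxx] with p h1 h2 h3 h4 h5 h6
  simp only [shearMap_flow, shearMap_one, one_smul] at h2 h3 h4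
  simp only [shearMap] at h5
  rw [integral_drift, integral_sub h4 (integrable_const _)] at h6
  simp only [integral_const, probReal_univ, one_smul] at h6
  rw [add_assoc, ← h6, h1, ← sub_add_sub_cancel _
    (∫ z, u (p.1, p.2 - drift κ θ t p.1 z) ∂gauss), ← integral_sub h3 h4, integral_smul,
    integral_prod _ h5, ← integral_smul]
  congr 1
  refine integral_congr_ae ?_
  filter_upwards [h2] with z hz
  rw [flow_eq, neg_mul, hz, ← integral_smul]
  refine integral_congr_ae (Eventually.of_forall fun r => ?_)
  simp only [smul_smul]
  congr 1
  ring

/-- The generator of `e^{𝔇(t)B} e^{tA}` is `L₀` on `H²_lam(I × ℝ)`. -/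
theorem exists_generatorMapsTo (hκ : 0 < κ) (hα : 0 < α) (hαθ : α < θ) (hθβ : θ < β)
    (hEA : ∀ t, 0 ≤ t → ∀ u, IsExpA κ θ t u (EA t u))
    (hEB : ∀ t, 0 ≤ t → ∀ u, EB t u =ᵐ[weightMeasure₂ α β lam]
        fun p => ∫ z, u (p.1, p.2 - drift κ θ t p.1 z) ∂gauss) (U : H2IR α β lam) :
    ∃ v : L2IR α β lam, L0MapsTo κ θ U v ∧
      GeneratorMapsTo (fun t => (EB t).comp (EA t)) U.incl v := by
  obtain ⟨M, hM1, hM⟩ := exists_drift_bound hκ hα hαθ hθβ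
  have hM0 : 0 ≤ M := by linarith
  have hA : ∀ t ∈ Set.Ioo (0 : ℝ) 1, ∀ σ ∈ Set.Ioo α β, ∀ z,
      |drift κ θ t σ z| ≤ M * 2 * (1 + |z|) := by
    intro t ht σ hσ z
    refine (hM t ht.1 σ hσ z).1.trans ?_
    gcongr
    exact add_sqrt_le_two ht.2.le
  have hs : IsWeakPDeriv α β 1 0 (U.pd 0 0) (U.pd 1 0) := U.2 ⟨(1, 0), by decide⟩
  have hx : IsWeakPDeriv α β 0 1 (U.pd 0 0) (U.pd 0 1) := U.2 ⟨(0, 1), by decide⟩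
  have hxx' : IsWeakPDeriv α β 0 2 (U.pd 0 0) (U.pd 0 2) := U.2 ⟨(0, 2), by decide⟩
  have hxx := hx.of_x_x hxx'
  have hdrift : ∀ t ∈ Set.Ioo (0 : ℝ) 1, ∀ σ ∈ Set.Ioo α β, ∀ z,
      |t⁻¹ * drift κ θ t σ z ^ 2| ≤ Real.exp (2 * (M * 2 * (1 + |z|))) := by
    intro t ht σ hσ z
    have hs0 := Real.sqrt_pos.2 ht.1
    have hss := Real.sq_sqrt ht.1.le
    have e : t⁻¹ * drift κ θ t σ z ^ 2 = (drift κ θ t σ z / Real.sqrt t) ^ 2 := by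
      rw [div_pow, hss]; ring
    rw [e, abs_of_nonneg (sq_nonneg _)]
    refine sq_le_exp_two_mul ?_
    rw [abs_div, abs_of_pos hs0, div_le_iff₀ hs0]
    refine (hM t ht.1 σ hσ z).1.trans ?_
    have h1 : Real.sqrt t ≤ 1 := Real.sqrt_le_one.2 ht.2.le
    have h2 : t + Real.sqrt t ≤ 2 * Real.sqrt t := by nlinarith
    calc M * (t + Real.sqrt t) * (1 + |z|) ≤ M * (2 * Real.sqrt t) * (1 + |z|) := by gcongr
      _ = M * 2 * (1 + |z|) * Real.sqrt t := by ring
  have hη1 : ∀ z : ℝ, Tendsto (fun t => (1 - Real.exp (-κ * t)) * (β - α) +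
      M * (t + Real.sqrt t) * (1 + |z|)) (𝓝[>] 0) (𝓝 0) := by
    intro z
    have h1 := ((tendsto_exp_neg_mul κ).const_sub 1).mul_const (β - α)
    have h2 := (tendsto_add_sqrt.const_mul M).mul_const (1 + |z|)
    simpa using h1.add h2
  have hquot : ∀ σ, Tendsto (fun t => t⁻¹ * frakD κ θ t σ) (𝓝[>] 0) (𝓝 (σ ^ 2 / 2)) := by
    intro σ
    have h1 := (hasDerivAt_frakD hκ.ne' θ σ 0).tendsto_slope_zero_right
    simpa [frakD_zero, flow] using h1
  have hlim : ∀ σ ∈ Set.Ioo α β, ∀ q : (ℝ × unitInterval) × unitInterval,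
      Tendsto (fun t => t⁻¹ * drift κ θ t σ q.1.1 ^ 2 * (q.1.2 : ℝ)) (𝓝[>] 0)
        (𝓝 (σ ^ 2 / 2 * (2 * q.1.1 ^ 2 * q.1.2))) := by
    intro σ hσ q
    have h0 : Tendsto (fun t => frakD κ θ t σ) (𝓝[>] 0) (𝓝 0) := by
      have := (hasDerivAt_frakD hκ.ne' θ σ 0).continuousAt.tendsto
      rw [frakD_zero] at this
      exact this.mono_left nhdsWithin_le_nhds
    have h1 : Continuous fun a : ℝ => (Real.sqrt a + Real.sqrt 2 * q.1.1) ^ 2 := by fun_prop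
    have h2 := ((hquot σ).mul ((h1.tendsto 0).comp h0)).mul_const (q.1.2 : ℝ)
    have e : σ ^ 2 / 2 * (Real.sqrt 0 + Real.sqrt 2 * q.1.1) ^ 2 * (q.1.2 : ℝ) =
        σ ^ 2 / 2 * (2 * q.1.1 ^ 2 * q.1.2) := by
      rw [Real.sqrt_zero, zero_add, mul_pow, Real.sq_sqrt two_pos.le]; ring
    rw [e] at h2
    refine h2.congr' ?_
    filter_upwards [self_mem_nhdsWithin] with t ht
    have hp := frakD_pos hκ (hα.trans hαθ) ht σ
    simp only [Function.comp_apply]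
    rw [← inv_mul_gaussShift_sq hp, mul_assoc t⁻¹ (frakD κ θ t σ), mul_inv_cancel_left₀ hp.ne']
    rfl
  -- the three terms of Taylor's formula, divided by `t`
  obtain ⟨F₁, g₁, hF₁, hg₁, ht₁⟩ := exists_tendsto_averaging (μ := weightMeasure₂ α β lam)
    (ν := gauss.prod (volume : Measure unitInterval)) (l := 𝓝[>] (0 : ℝ))
    (ρ := fun t p q => -(κ * Real.exp (-(q.2 * (κ * t))) * (p.1 - θ)))
    (Φ := fun t p q => shearMap θ (Real.exp (-(q.2 * (κ * t)))) (fun σ => drift κ θ t σ q.1) p)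
    (ρ₀ := fun p _ => κ * (θ - p.1))
    (η := fun t q => (1 - Real.exp (-κ * t)) * (β - α) + M * (t + Real.sqrt t) * (1 + |q.1|))
    (by
      filter_upwards [eventually_mem_Ioo_one] with t ht
      exact isAveraging_contraction lam hκ hαθ hθβ ht.1.le ht.2.le
        (mul_nonneg hM0 two_pos.le) (measurable_drift κ θ t) (hA t ht))
    (fun q => hη1 q.1) (by
      filter_upwards [eventually_mem_Ioo_one] with t ht
      filter_upwards [ae_fst_mem α β lam] with p hp q
      have h0 : 0 ≤ (q.2 : ℝ) * (κ * t) := mul_nonneg q.2.2.1 (mul_nonneg hκ.le ht.1.le)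
      have h1 : (q.2 : ℝ) * (κ * t) ≤ κ * t :=
        mul_le_of_le_one_left (mul_nonneg hκ.le ht.1.le) q.2.2.2
      refine (dist_shearMap_le (Real.exp_le_one_iff.2 (neg_nonpos.2 h0)) hαθ hθβ _ hp).trans ?_
      have h2 : 0 ≤ β - α := by linarith
      rw [neg_mul]
      gcongr
      exact (hM t ht.1 p.1 hp q.1).1)
    (by
      have : Measurable fun q : (ℝ × ℝ) × (ℝ × unitInterval) => κ * (θ - q.1.1) :=
        ((measurable_fst.comp measurable_fst).const_sub θ).const_mul κ
      exact this)
    (by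
      filter_upwards [ae_fst_mem α β lam] with p hp q
      have h1 : |θ - p.1| ≤ β - α := abs_le.2 ⟨by linarith [hp.2], by linarith [hp.1]⟩
      have h2 := one_le_exp_affine (mul_nonneg hM0 two_pos.le) q.1
      have h3 : 0 ≤ β - α := by linarith
      rw [abs_mul, abs_of_pos hκ]
      exact (mul_le_mul_of_nonneg_left h1 hκ.le).trans
        (le_mul_of_one_le_right (mul_nonneg hκ.le h3) h2))
    (Eventually.of_forall fun p q => by
      have : Continuous fun t : ℝ => -(κ * Real.exp (-(q.2 * (κ * t))) * (p.1 - θ)) := by fun_prop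
      have h0 := (this.tendsto 0).mono_left (nhdsWithin_le_nhds (s := Set.Ioi 0))
      convert h0 using 2
      simp
      ring)
    (U.pd 1 0)
  obtain ⟨F₂, g₂, hF₂, hg₂, ht₂⟩ := exists_tendsto_averaging (μ := weightMeasure₂ α β lam)
    (ν := gauss) (l := 𝓝[>] (0 : ℝ)) (ρ := fun t p _ => -(t⁻¹ * frakD κ θ t p.1))
    (Φ := fun t p _ => p) (ρ₀ := fun p _ => -(p.1 ^ 2 / 2)) (η := fun _ _ => 0)
    (by
      filter_upwards [eventually_mem_Ioo_one] with t ht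
      refine (isAveraging_drift (K := β ^ 2 / 2) lam hαθ hθβ one_pos le_rfl le_rfl (hA t ht)
        ?_ ?_).of_coeff
      · exact (((measurable_frakD κ θ t).comp (measurable_fst.comp
          measurable_fst)).const_mul t⁻¹).neg
      · intro p hp z
        have d1 := frakD_nonneg hκ hα hαθ hθβ ht.1.le hp
        have d2 := frakD_le hκ hα hαθ hθβ ht.1.le hp
        rw [abs_neg, abs_of_nonneg (mul_nonneg (inv_pos.2 ht.1).le d1), inv_mul_eq_div]
        exact ((div_le_iff₀ ht.1).2 d2).trans (le_mul_of_one_le_right (by positivity)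
          (one_le_exp_affine (mul_nonneg hM0 two_pos.le) z)))
    (fun _ => tendsto_const_nhds) (by simp)
    (by
      have : Measurable fun q : (ℝ × ℝ) × ℝ => -(q.1.1 ^ 2 / 2) := by fun_prop
      exact this)
    (by
      filter_upwards [ae_fst_mem α β lam] with p hp z
      have h1 : p.1 ^ 2 ≤ β ^ 2 := pow_le_pow_left₀ (hα.trans hp.1).le hp.2.le 2
      rw [abs_neg, abs_of_nonneg (by positivity)]
      exact (by gcongr : p.1 ^ 2 / 2 ≤ β ^ 2 / 2).trans (le_mul_of_one_le_right (by positivity)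
          (one_le_exp_affine (mul_nonneg hM0 two_pos.le) z)))
    (Eventually.of_forall fun p z => (hquot p.1).neg) (U.pd 0 1)
  obtain ⟨F₃, g₃, hF₃, hg₃, ht₃⟩ := exists_tendsto_averaging (μ := weightMeasure₂ α β lam)
    (ν := (gauss.prod (volume : Measure unitInterval)).prod (volume : Measure unitInterval))
    (l := 𝓝[>] (0 : ℝ))
    (ρ := fun t p q => t⁻¹ * drift κ θ t p.1 q.1.1 ^ 2 * q.1.2)
    (Φ := fun t p q => shearMap θ 1 (fun σ => q.2 * (q.1.2 * drift κ θ t σ q.1.1)) p)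
    (ρ₀ := fun p q => p.1 ^ 2 / 2 * (2 * q.1.1 ^ 2 * q.1.2))
    (η := fun t q => (1 - Real.exp (-κ * t)) * (β - α) + M * (t + Real.sqrt t) * (1 + |q.1.1|))
    (by
      filter_upwards [eventually_mem_Ioo_one] with t ht
      exact isAveraging_taylor lam hαθ hθβ (measurable_drift κ θ t) (hA t ht) (hdrift t ht))
    (fun q => hη1 q.1.1) (by
      filter_upwards [eventually_mem_Ioo_one] with t ht
      filter_upwards [ae_fst_mem α β lam] with p hp q
      refine (dist_shearMap_le le_rfl hαθ hθβ _ hp).trans ?_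
      rw [sub_self, zero_mul]
      have h1 := exp_neg_mul_le_one hκ ht.1.le
      have h2 : 0 ≤ (1 - Real.exp (-κ * t)) * (β - α) :=
        mul_nonneg (by linarith) (by linarith)
      exact add_le_add h2 (abs_unitInterval_mul_le _ (abs_unitInterval_mul_le _
        (hM t ht.1 p.1 hp q.1.1).1)))
    (by
      have m1 : Measurable fun q : (ℝ × ℝ) × (ℝ × unitInterval) × unitInterval => q.2.1.1 :=
        measurable_fst.comp (measurable_fst.comp measurable_snd)
      have m2 : Measurable fun q : (ℝ × ℝ) × (ℝ × unitInterval) × unitInterval =>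
          (q.2.1.2 : ℝ) := measurable_subtype_coe.comp
        (measurable_snd.comp (measurable_fst.comp measurable_snd))
      have m3 : Measurable fun q : (ℝ × ℝ) × (ℝ × unitInterval) × unitInterval => q.1.1 :=
        measurable_fst.comp measurable_fst
      exact ((m3.pow_const 2).div_const 2).mul (((m1.pow_const 2).const_mul 2).mul m2))
    (by
      filter_upwards [ae_fst_mem α β lam] with p hp q
      refine le_of_tendsto (hlim p.1 hp q).abs ?_
      filter_upwards [eventually_mem_Ioo_one] with t ht
      rw [one_mul, abs_mul, abs_of_nonneg q.1.2.2.1]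
      exact (mul_le_of_le_one_right (abs_nonneg _) q.1.2.2.2).trans (hdrift t ht _ hp _))
    (by
      filter_upwards [ae_fst_mem α β lam] with p hp q using hlim p.1 hp q)
    (U.pd 0 2)
  have hint₃ : ∀ p : ℝ × ℝ, ∫ q : (ℝ × unitInterval) × unitInterval,
      p.1 ^ 2 / 2 * (2 * q.1.1 ^ 2 * (q.1.2 : ℝ)) ∂((gauss.prod volume).prod volume) =
        p.1 ^ 2 / 2 := by
    intro p
    rw [integral_const_mul, integral_sq_mul_gauss, mul_one]
  refine ⟨g₁ + g₂ + g₃, ?_, ((ht₁.add ht₂).add ht₃).congr' ?_⟩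
  · unfold L0MapsTo
    filter_upwards [Lp.coeFn_add (g₁ + g₂) g₃, Lp.coeFn_add g₁ g₂, hg₁, hg₂, hg₃]
      with p e1 e2 e3 e4 e5
    simp only [integral_const, probReal_univ, one_smul] at e3 e4
    rw [hint₃] at e5
    rw [e1, Pi.add_apply, e2, Pi.add_apply, e3, e4, e5]
    simp only [Complex.real_smul]
    push_cast
    ring
  · filter_upwards [eventually_mem_Ioo_one, hF₁, hF₂, hF₃] with t ht f1 f2 f3
    refine Lp.ext ?_
    filter_upwards [Lp.coeFn_add (F₁ t + F₂ t) (F₃ t), Lp.coeFn_add (F₁ t) (F₂ t), f1, f2, f3,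
      Lp.coeFn_smul ((t : ℂ)⁻¹) (EB t (EA t U.incl) - U.incl),
      Lp.coeFn_sub (EB t (EA t U.incl)) U.incl,
      expFamilyB_expA_sub_eq hκ hα hαθ hθβ hEA hEB ht.1 ht.2.le (mul_nonneg hM0 two_pos.le)
        (hA t ht) hs hx hxx] with p e1 e2 e3 e4 e5 e6 e7 e8
    change _ = ((t : ℂ)⁻¹ • (EB t (EA t U.incl) - U.incl) : L2IR α β lam) p
    have e8' : EB t (EA t U.incl) p - U.incl p = _ := e8
    rw [e1, Pi.add_apply, e2, Pi.add_apply, e3, e4, e5, e6, Pi.smul_apply, e7, Pi.sub_apply, e8']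
    have ht0 : (t : ℂ) ≠ 0 := by exact_mod_cast ht.1.ne'
    simp only [mul_assoc t⁻¹, mul_smul t⁻¹, integral_smul, integral_const, probReal_univ, one_smul,
      shearMap, smul_eq_mul, one_mul, add_sub_cancel]
    simp only [Complex.real_smul]
    push_cast
    rw [mul_add, mul_add, inv_mul_cancel_left₀ ht0]
    ring

end Generator

/-! ### The restriction to `H²_lam(I × ℝ)` -/

section Jets

variable {κ θ α β lam t : ℝ}

theorem isWeakPDeriv_add {i j : ℕ} {u u' g g' : L2IR α β lam} (h : IsWeakPDeriv α β i j u g)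
    (h' : IsWeakPDeriv α β i j u' g') :
    IsWeakPDeriv α β i j (u + u' : L2IR α β lam) (g + g' : L2IR α β lam) := by
  intro φ hφ
  rw [integral_add_mul _ _ (hφ.pderiv i j), integral_add_mul _ _ hφ, h φ hφ, h' φ hφ, mul_add]

theorem isWeakPDeriv_smul {i j : ℕ} {u g : L2IR α β lam} (c : ℂ) (h : IsWeakPDeriv α β i j u g) :
    IsWeakPDeriv α β i j (c • u : L2IR α β lam) (c • g : L2IR α β lam) := by
  intro φ hφ
  rw [integral_smul_mul, integral_smul_mul, h φ hφ]
  ring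

/-- Weak derivatives are unique, so an element of `H²_lam(I × ℝ)` is determined by its class in
`L²_lam(I × ℝ)`. -/
theorem incl_injective : Function.Injective (H2IR.incl (α := α) (β := β) (lam := lam)) := by
  intro U V h
  refine Subtype.ext (PiLp.ext fun a => Lp.ext ?_)
  refine ae_eq_of_integral_test (Lp.memLp _) (Lp.memLp _) fun φ hφ => ?_
  have h1 := U.2 a φ hφ
  have h2 := V.2 a φ hφ
  have h3 : (U : PiLp 2 fun _ : Idx => L2IR α β lam) ⟨(0, 0), by decide⟩ =
      (V : PiLp 2 fun _ : Idx => L2IR α β lam) ⟨(0, 0), by decide⟩ := h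
  rw [h3, h2] at h1
  exact (mul_left_cancel₀ (pow_ne_zero _ (by norm_num)) h1).symm

/-- The family over the multi-indices of order at most two with the given entries, in the order
`(0, 0)`, `(1, 0)`, `(0, 1)`, `(2, 0)`, `(1, 1)`, `(0, 2)`. -/
def Idx.family {X : Type*} (x₀₀ x₁₀ x₀₁ x₂₀ x₁₁ x₀₂ : X) : Idx → X
  | ⟨(0, 0), _⟩ => x₀₀
  | ⟨(1, 0), _⟩ => x₁₀
  | ⟨(0, 1), _⟩ => x₀₁
  | ⟨(2, 0), _⟩ => x₂₀
  | ⟨(1, 1), _⟩ => x₁₁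
  | _ => x₀₂

theorem Idx.forall {p : Idx → Prop} (h₀₀ : p ⟨(0, 0), by decide⟩) (h₁₀ : p ⟨(1, 0), by decide⟩)
    (h₀₁ : p ⟨(0, 1), by decide⟩) (h₂₀ : p ⟨(2, 0), by decide⟩) (h₁₁ : p ⟨(1, 1), by decide⟩)
    (h₀₂ : p ⟨(0, 2), by decide⟩) (a : Idx) : p a := by
  obtain ⟨⟨i, j⟩, h⟩ := a
  fin_cases i <;> fin_cases j <;> first | assumption | exact absurd h (by decide)

/-- The averages along the maps `(σ, x) ↦ (δ_t(σ), x - drift κ θ t σ z)` with the coefficients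
`-∂_σ drift`, `(∂_σ drift)²` and `-∂_σ² drift`, which the chain rule for `∂_σ` and `∂_σ²`
produces. -/
structure IsJetOperators (κ θ t : ℝ) (S T₁ T₁₁ T₂ : L2IR α β lam →L[ℂ] L2IR α β lam) : Prop where
  zero : ∀ f, S f =ᵐ[weightMeasure₂ α β lam] fun p =>
    ∫ z, f (flow κ θ t p.1, p.2 - drift κ θ t p.1 z) ∂gauss
  one : ∀ f, T₁ f =ᵐ[weightMeasure₂ α β lam] fun p =>
    ∫ z, (-drift₁ κ θ t p.1 z) • f (flow κ θ t p.1, p.2 - drift κ θ t p.1 z) ∂gauss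
  one_one : ∀ f, T₁₁ f =ᵐ[weightMeasure₂ α β lam] fun p =>
    ∫ z, (drift₁ κ θ t p.1 z ^ 2) • f (flow κ θ t p.1, p.2 - drift κ θ t p.1 z) ∂gauss
  two : ∀ f, T₂ f =ᵐ[weightMeasure₂ α β lam] fun p =>
    ∫ z, (-drift₂ κ θ t p.1 z) • f (flow κ θ t p.1, p.2 - drift κ θ t p.1 z) ∂gauss

theorem measurable_neg_drift₁ (κ θ t : ℝ) :
    Measurable (Function.uncurry fun (p : ℝ × ℝ) z => -drift₁ κ θ t p.1 z) :=
  ((measurable_drift₁ κ θ t).comp ((measurable_fst.comp measurable_fst).prodMk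
    measurable_snd)).neg

theorem measurable_drift₁_sq (κ θ t : ℝ) :
    Measurable (Function.uncurry fun (p : ℝ × ℝ) z => drift₁ κ θ t p.1 z ^ 2) :=
  ((measurable_drift₁ κ θ t).comp ((measurable_fst.comp measurable_fst).prodMk
    measurable_snd)).pow_const 2

theorem measurable_neg_drift₂ (κ θ t : ℝ) :
    Measurable (Function.uncurry fun (p : ℝ × ℝ) z => -drift₂ κ θ t p.1 z) :=
  ((measurable_drift₂ κ θ t).comp ((measurable_fst.comp measurable_fst).prodMk
    measurable_snd)).neg

/-- The averaging property for the coefficients produced by the chain rule. -/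
theorem isAveraging_jet (lam : ℝ) (hκ : 0 < κ) (hαθ : α < θ) (hθβ : θ < β) (ht : 0 < t) {A : ℝ}
    (hA : ∀ σ ∈ Set.Ioo α β, ∀ z, |drift κ θ t σ z| ≤ A * (1 + |z|) ∧
      |drift₁ κ θ t σ z| ≤ A * (1 + |z|) ∧ |drift₂ κ θ t σ z| ≤ A * (1 + |z|))
    {ρ : ℝ × ℝ → ℝ → ℝ} (hρ : Measurable (Function.uncurry ρ))
    (hρb : ∀ p : ℝ × ℝ, p.1 ∈ Set.Ioo α β → ∀ z, |ρ p z| ≤ Real.exp (2 * (A * (1 + |z|)))) :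
    IsAveraging (weightMeasure₂ α β lam) gauss ρ
      (fun p z => shearMap θ (Real.exp (-κ * t)) (fun σ => drift κ θ t σ z) p)
      (fun z => 1 * Real.exp (2 * (A * (1 + |z|))))
      (fun z => (Real.exp (-κ * t))⁻¹ * Real.exp (2 * |lam| * (A * (1 + |z|)))) :=
  isAveraging_drift lam hαθ hθβ (Real.exp_pos _) le_rfl (exp_neg_mul_le_one hκ ht.le)
    (fun σ hσ z => (hA σ hσ z).1) hρ fun p hp z => by rw [one_mul]; exact hρb p hp z

section Fixed

variable {A : ℝ}

theorem exists_isJetOperators (lam : ℝ) (hκ : 0 < κ) (hαθ : α < θ) (hθβ : θ < β) (ht : 0 < t)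
    (hA : ∀ σ ∈ Set.Ioo α β, ∀ z, |drift κ θ t σ z| ≤ A * (1 + |z|) ∧
      |drift₁ κ θ t σ z| ≤ A * (1 + |z|) ∧ |drift₂ κ θ t σ z| ≤ A * (1 + |z|))
    {S : L2IR α β lam →L[ℂ] L2IR α β lam}
    (hS : ∀ f, S f =ᵐ[weightMeasure₂ α β lam] fun p =>
      ∫ z, f (flow κ θ t p.1, p.2 - drift κ θ t p.1 z) ∂gauss) :
    ∃ T₁ T₁₁ T₂, IsJetOperators κ θ t S T₁ T₁₁ T₂ := by
  obtain ⟨T₁, h1, -⟩ := (isAveraging_jet lam hκ hαθ hθβ ht hA (measurable_neg_drift₁ κ θ t)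
    fun p hp z => by rw [abs_neg]; exact le_exp_two_mul (hA _ hp z).2.1).exists_clm
  obtain ⟨T₁₁, h2, -⟩ := (isAveraging_jet lam hκ hαθ hθβ ht hA (measurable_drift₁_sq κ θ t)
    fun p hp z => by
      rw [abs_of_nonneg (sq_nonneg _)]
      exact sq_le_exp_two_mul (hA _ hp z).2.1).exists_clm
  obtain ⟨T₂, h3, -⟩ := (isAveraging_jet lam hκ hαθ hθβ ht hA (measurable_neg_drift₂ κ θ t)
    fun p hp z => by rw [abs_neg]; exact le_exp_two_mul (hA _ hp z).2.2).exists_clm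
  simp only [shearMap_flow] at h1 h2 h3
  exact ⟨T₁, T₁₁, T₂, hS, h1, h2, h3⟩

variable {S T₁ T₁₁ T₂ : L2IR α β lam →L[ℂ] L2IR α β lam}

namespace IsJetOperators

theorem x_zero (hJ : IsJetOperators κ θ t S T₁ T₁₁ T₂) (hκ : 0 < κ) (hθ : 0 < θ) (hαθ : α < θ)
    (hθβ : θ < β) (ht : 0 < t) (hA0 : 0 ≤ A)
    (hA : ∀ σ ∈ Set.Ioo α β, ∀ z, |drift κ θ t σ z| ≤ A * (1 + |z|) ∧
      |drift₁ κ θ t σ z| ≤ A * (1 + |z|) ∧ |drift₂ κ θ t σ z| ≤ A * (1 + |z|))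
    {u ux : L2IR α β lam} (hx : IsWeakPDeriv α β 0 1 u ux) :
    IsWeakPDeriv α β 0 1 (S u) (S ux) := by
  have h := isWeakPDeriv_average_x hαθ hθβ (Real.exp_pos _) (exp_neg_mul_le_one hκ ht.le)
    (contDiff_drift hκ hθ ht) (ρ := fun _ _ => 1) (fun _ => contDiff_const)
    (isAveraging_jet lam hκ hαθ hθβ ht hA measurable_const fun p hp z => by
      simpa using one_le_exp_affine hA0 z)
    (measurable_Lp u) (Lp.memLp u) (measurable_Lp ux) (Lp.memLp ux) hx
  simp only [shearMap_flow, one_smul] at h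
  exact h.congr (hJ.zero u).symm (hJ.zero ux).symm

theorem x_one (hJ : IsJetOperators κ θ t S T₁ T₁₁ T₂) (hκ : 0 < κ) (hθ : 0 < θ) (hαθ : α < θ)
    (hθβ : θ < β) (ht : 0 < t)
    (hA : ∀ σ ∈ Set.Ioo α β, ∀ z, |drift κ θ t σ z| ≤ A * (1 + |z|) ∧
      |drift₁ κ θ t σ z| ≤ A * (1 + |z|) ∧ |drift₂ κ θ t σ z| ≤ A * (1 + |z|))
    {u ux : L2IR α β lam} (hx : IsWeakPDeriv α β 0 1 u ux) :
    IsWeakPDeriv α β 0 1 (T₁ u) (T₁ ux) := by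
  have h := isWeakPDeriv_average_x hαθ hθβ (Real.exp_pos _) (exp_neg_mul_le_one hκ ht.le)
    (contDiff_drift hκ hθ ht) (ρ := fun σ z => -drift₁ κ θ t σ z)
    (fun z => (contDiff_drift₁ hκ hθ ht z).neg)
    (isAveraging_jet lam hκ hαθ hθβ ht hA (measurable_neg_drift₁ κ θ t)
      fun p hp z => by rw [abs_neg]; exact le_exp_two_mul (hA _ hp z).2.1)
    (measurable_Lp u) (Lp.memLp u) (measurable_Lp ux) (Lp.memLp ux) hx
  simp only [shearMap_flow] at h
  exact h.congr (hJ.one u).symm (hJ.one ux).symm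

/-- `∂_σ` of `S u`: the derivative of `δ_t` produces the factor `e^{-κt}`, that of the
displacement the operator `T₁`. -/
theorem sigma_zero (hJ : IsJetOperators κ θ t S T₁ T₁₁ T₂) (hκ : 0 < κ) (hθ : 0 < θ)
    (hαθ : α < θ) (hθβ : θ < β) (ht : 0 < t) (hA0 : 0 ≤ A)
    (hA : ∀ σ ∈ Set.Ioo α β, ∀ z, |drift κ θ t σ z| ≤ A * (1 + |z|) ∧
      |drift₁ κ θ t σ z| ≤ A * (1 + |z|) ∧ |drift₂ κ θ t σ z| ≤ A * (1 + |z|))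
    {u us ux : L2IR α β lam} (hs : IsWeakPDeriv α β 1 0 u us) (hx : IsWeakPDeriv α β 0 1 u ux) :
    IsWeakPDeriv α β 1 0 (S u)
      ((Real.exp (-κ * t) : ℂ) • S us + T₁ ux : L2IR α β lam) := by
  have hone : ∀ z : ℝ, (1 : ℝ) ≤ Real.exp (2 * (A * (1 + |z|))) := one_le_exp_affine hA0
  have hm1 := exp_neg_mul_le_one hκ ht.le
  have hd : ∀ z σ, deriv (fun σ => drift κ θ t σ z) σ = drift₁ κ θ t σ z := fun z σ =>
    (hasDerivAt_drift hκ hθ ht z σ).deriv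
  have h := isWeakPDeriv_average_sigma hαθ hθβ (Real.exp_pos _) hm1
    (contDiff_drift hκ hθ ht) (ρ := fun _ _ => 1) (fun _ => contDiff_const)
    (isAveraging_jet lam hκ hαθ hθβ ht hA measurable_const fun p hp z => by simpa using hone z)
    (isAveraging_jet lam hκ hαθ hθβ ht hA measurable_const fun p hp z => by
      rw [one_mul, abs_of_pos (Real.exp_pos _)]
      exact hm1.trans (hone z))
    (by
      simp only [hd, one_mul]
      exact isAveraging_jet lam hκ hαθ hθβ ht hA (measurable_neg_drift₁ κ θ t)
        fun p hp z => by rw [abs_neg]; exact le_exp_two_mul (hA _ hp z).2.1)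
    (by
      simp only [deriv_const]
      exact isAveraging_jet lam hκ hαθ hθβ ht hA measurable_const fun p hp z => by
        simpa using Real.exp_nonneg _)
    (measurable_Lp u) (Lp.memLp u) (measurable_Lp us) (Lp.memLp us) (measurable_Lp ux)
    (Lp.memLp ux) hs hx
  simp only [hd, shearMap_flow, one_smul, one_mul, deriv_const, zero_smul, integral_zero,
    add_zero] at h
  refine h.congr (hJ.zero u).symm ?_
  filter_upwards [Lp.coeFn_add ((Real.exp (-κ * t) : ℂ) • S us) (T₁ ux),
    Lp.coeFn_smul (Real.exp (-κ * t) : ℂ) (S us), hJ.zero us, hJ.one ux] with p e1 e2 e3 e4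
  rw [e1, Pi.add_apply, e2, Pi.smul_apply, e3, e4, integral_smul, smul_eq_mul, Complex.real_smul]

/-- `∂_σ` of `T₁ u`; the last term comes from the `σ`-dependence of the coefficient. -/
theorem sigma_one (hJ : IsJetOperators κ θ t S T₁ T₁₁ T₂) (hκ : 0 < κ) (hθ : 0 < θ)
    (hαθ : α < θ) (hθβ : θ < β) (ht : 0 < t)
    (hA : ∀ σ ∈ Set.Ioo α β, ∀ z, |drift κ θ t σ z| ≤ A * (1 + |z|) ∧
      |drift₁ κ θ t σ z| ≤ A * (1 + |z|) ∧ |drift₂ κ θ t σ z| ≤ A * (1 + |z|))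
    {u us ux : L2IR α β lam} (hs : IsWeakPDeriv α β 1 0 u us) (hx : IsWeakPDeriv α β 0 1 u ux) :
    IsWeakPDeriv α β 1 0 (T₁ u)
      ((Real.exp (-κ * t) : ℂ) • T₁ us + T₁₁ ux + T₂ u : L2IR α β lam) := by
  have hm1 := exp_neg_mul_le_one hκ ht.le
  have hd : ∀ z σ, deriv (fun σ => drift κ θ t σ z) σ = drift₁ κ θ t σ z := fun z σ =>
    (hasDerivAt_drift hκ hθ ht z σ).deriv
  have hd' : ∀ z σ, deriv (fun σ => -drift₁ κ θ t σ z) σ = -drift₂ κ θ t σ z := fun z σ =>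
    (hasDerivAt_drift₁ hκ hθ ht z σ).neg.deriv
  have hsq : ∀ σ z, -(-drift₁ κ θ t σ z * drift₁ κ θ t σ z) = drift₁ κ θ t σ z ^ 2 := by
    intro σ z; ring
  have h := isWeakPDeriv_average_sigma hαθ hθβ (Real.exp_pos _) hm1
    (contDiff_drift hκ hθ ht) (ρ := fun σ z => -drift₁ κ θ t σ z)
    (fun z => (contDiff_drift₁ hκ hθ ht z).neg)
    (isAveraging_jet lam hκ hαθ hθβ ht hA (measurable_neg_drift₁ κ θ t)
      fun p hp z => by rw [abs_neg]; exact le_exp_two_mul (hA _ hp z).2.1)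
    (isAveraging_jet lam hκ hαθ hθβ ht hA ((measurable_neg_drift₁ κ θ t).mul_const _)
      fun p hp z => by
        rw [abs_mul, abs_neg, abs_of_pos (Real.exp_pos _)]
        exact (mul_le_of_le_one_right (abs_nonneg _) hm1).trans (le_exp_two_mul (hA _ hp z).2.1))
    (by
      simp only [hd, hsq]
      exact isAveraging_jet lam hκ hαθ hθβ ht hA (measurable_drift₁_sq κ θ t)
        fun p hp z => by
          rw [abs_of_nonneg (sq_nonneg _)]
          exact sq_le_exp_two_mul (hA _ hp z).2.1)
    (by
      simp only [hd']
      exact isAveraging_jet lam hκ hαθ hθβ ht hA (measurable_neg_drift₂ κ θ t)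
        fun p hp z => by rw [abs_neg]; exact le_exp_two_mul (hA _ hp z).2.2)
    (measurable_Lp u) (Lp.memLp u) (measurable_Lp us) (Lp.memLp us) (measurable_Lp ux)
    (Lp.memLp ux) hs hx
  simp only [hd, hd', hsq, shearMap_flow] at h
  refine h.congr (hJ.one u).symm ?_
  filter_upwards [Lp.coeFn_add ((Real.exp (-κ * t) : ℂ) • T₁ us + T₁₁ ux) (T₂ u),
    Lp.coeFn_add ((Real.exp (-κ * t) : ℂ) • T₁ us) (T₁₁ ux),
    Lp.coeFn_smul (Real.exp (-κ * t) : ℂ) (T₁ us), hJ.one us, hJ.one_one ux, hJ.two u]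
    with p e1 e2 e3 e4 e5 e6
  rw [e1, Pi.add_apply, e2, Pi.add_apply, e3, Pi.smul_apply, e4, e5, e6]
  congr 2
  rw [smul_eq_mul, ← Complex.real_smul, ← integral_smul]
  refine integral_congr_ae (Eventually.of_forall fun z => ?_)
  simp only [smul_smul]
  congr 1
  ring

end IsJetOperators

end Fixed

end Jets

section Restriction

variable {κ θ α β lam t : ℝ}

/-- For fixed `t > 0` the semigroup acts on the jets of `H²_lam(I × ℝ)` by the chain rule. -/
theorem IsJetOperators.exists_restriction {S T₁ T₁₁ T₂ : L2IR α β lam →L[ℂ] L2IR α β lam}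
    (hJ : IsJetOperators κ θ t S T₁ T₁₁ T₂) (hκ : 0 < κ) (hα : 0 < α) (hαθ : α < θ)
    (hθβ : θ < β) (ht : 0 < t) :
    ∃ S₁ : H2IR α β lam →L[ℂ] H2IR α β lam, ∀ U a,
      (S₁ U : PiLp 2 fun _ : Idx => L2IR α β lam) a = Idx.family (S (U.pd 0 0))
        ((Real.exp (-κ * t) : ℂ) • S (U.pd 1 0) + T₁ (U.pd 0 1))
        (S (U.pd 0 1))
        ((Real.exp (-κ * t) : ℂ) • ((Real.exp (-κ * t) : ℂ) • S (U.pd 2 0) + T₁ (U.pd 1 1)) +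
          ((Real.exp (-κ * t) : ℂ) • T₁ (U.pd 1 1) + T₁₁ (U.pd 0 2) + T₂ (U.pd 0 1)))
        ((Real.exp (-κ * t) : ℂ) • S (U.pd 1 1) + T₁ (U.pd 0 2))
        (S (U.pd 0 2)) a := by
  obtain ⟨m, hm⟩ : ∃ m : ℂ, m = (Real.exp (-κ * t) : ℂ) := ⟨_, rfl⟩
  obtain ⟨M, hM1, hM⟩ := exists_drift_bound hκ hα hαθ hθβ
  have hA0 : 0 ≤ M * (t + Real.sqrt t) := by positivity
  have hA := hM t ht
  have hθ := hα.trans hαθ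
  let π : Idx → (PiLp 2 fun _ : Idx => L2IR α β lam) →L[ℂ] L2IR α β lam := fun a =>
    PiLp.proj 2 (fun _ : Idx => L2IR α β lam) a
  let π₀₀ := π ⟨(0, 0), by decide⟩
  let π₁₀ := π ⟨(1, 0), by decide⟩
  let π₀₁ := π ⟨(0, 1), by decide⟩
  let π₂₀ := π ⟨(2, 0), by decide⟩
  let π₁₁ := π ⟨(1, 1), by decide⟩
  let π₀₂ := π ⟨(0, 2), by decide⟩
  let J : (PiLp 2 fun _ : Idx => L2IR α β lam) →L[ℂ] PiLp 2 fun _ : Idx => L2IR α β lam :=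
    (PiLp.continuousLinearEquiv 2 ℂ fun _ : Idx => L2IR α β lam).symm.toContinuousLinearMap.comp
      (ContinuousLinearMap.pi (Idx.family (S.comp π₀₀) (m • S.comp π₁₀ + T₁.comp π₀₁)
        (S.comp π₀₁)
        (m • (m • S.comp π₂₀ + T₁.comp π₁₁) +
          (m • T₁.comp π₁₁ + T₁₁.comp π₀₂ + T₂.comp π₀₁))
        (m • S.comp π₁₁ + T₁.comp π₀₂) (S.comp π₀₂)))
  have hJa : ∀ (U : H2IR α β lam) a, J U a = Idx.family (S (U.pd 0 0))
        (m • S (U.pd 1 0) + T₁ (U.pd 0 1)) (S (U.pd 0 1))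
        (m • (m • S (U.pd 2 0) + T₁ (U.pd 1 1)) +
          (m • T₁ (U.pd 1 1) + T₁₁ (U.pd 0 2) + T₂ (U.pd 0 1)))
        (m • S (U.pd 1 1) + T₁ (U.pd 0 2)) (S (U.pd 0 2)) a := by
    intro U a
    induction a using Idx.forall <;> rfl
  have hmem : ∀ U : H2IR α β lam, J U ∈ sobolevJets α β lam := by
    intro U
    have hs : IsWeakPDeriv α β 1 0 (U.pd 0 0) (U.pd 1 0) := U.2 ⟨(1, 0), by decide⟩
    have hx : IsWeakPDeriv α β 0 1 (U.pd 0 0) (U.pd 0 1) := U.2 ⟨(0, 1), by decide⟩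
    have hss : IsWeakPDeriv α β 1 0 (U.pd 1 0) (U.pd 2 0) :=
      hs.of_sigma_sigma (U.2 ⟨(2, 0), by decide⟩)
    have hsx : IsWeakPDeriv α β 0 1 (U.pd 1 0) (U.pd 1 1) :=
      hs.x_of_sigma_x (U.2 ⟨(1, 1), by decide⟩)
    have hxs : IsWeakPDeriv α β 1 0 (U.pd 0 1) (U.pd 1 1) :=
      hx.sigma_of_sigma_x (U.2 ⟨(1, 1), by decide⟩)
    have hxx : IsWeakPDeriv α β 0 1 (U.pd 0 1) (U.pd 0 2) :=
      hx.of_x_x (U.2 ⟨(0, 2), by decide⟩)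
    have d10 := hJ.sigma_zero hκ hθ hαθ hθβ ht hA0 hA hs hx
    have d01 := hJ.x_zero hκ hθ hαθ hθβ ht hA0 hA hx
    have d02 := hJ.x_zero hκ hθ hαθ hθβ ht hA0 hA hxx
    have d11 := isWeakPDeriv_add (isWeakPDeriv_smul m (hJ.x_zero hκ hθ hαθ hθβ ht hA0 hA hsx))
      (hJ.x_one hκ hθ hαθ hθβ ht hA hxx)
    have d20 := isWeakPDeriv_add
      (isWeakPDeriv_smul m (hJ.sigma_zero hκ hθ hαθ hθβ ht hA0 hA hss hsx))
      (hJ.sigma_one hκ hθ hαθ hθβ ht hA hxs hxx)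
    rw [← hm] at d10 d20
    intro a
    rw [hJa, hJa]
    induction a using Idx.forall
    · exact isWeakPDeriv_zero _ _ _
    · exact d10
    · exact d01
    · exact d10.sigma_sigma d20
    · exact d10.sigma_x d11
    · exact d01.x_x d02
  refine ⟨(J.comp (sobolevJets α β lam).subtypeL).codRestrict (sobolevJets α β lam) hmem,
    fun U a => ?_⟩
  rw [← hm]
  exact hJa U a

/-- Convergence in `H²_lam(I × ℝ)` is the convergence of all derivatives. -/
theorem tendsto_H2IR {ι : Type*} {l : Filter ι} {F : ι → H2IR α β lam} {U : H2IR α β lam}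
    (h : ∀ a : Idx, Tendsto (fun i => (F i : PiLp 2 fun _ : Idx => L2IR α β lam) a) l
      (𝓝 ((U : PiLp 2 fun _ : Idx => L2IR α β lam) a))) : Tendsto F l (𝓝 U) := by
  rw [tendsto_subtype_rng]
  have h1 := tendsto_pi_nhds.2 h
  exact ((PiLp.continuous_toLp 2 fun _ : Idx => L2IR α β lam).tendsto _).comp h1

variable {EA EB : ℝ → L2IR α β lam →L[ℂ] L2IR α β lam}

/-- `e^{𝔇(t)B} e^{tA}` restricts to a `c₀` semigroup on `H²_lam(I × ℝ)`. The semigroup law is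
inherited, since the inclusion in `L²_lam(I × ℝ)` is injective; strong continuity holds because the
additional terms in the derivatives have coefficients of order `√t`. -/
theorem exists_restriction_isC0Semigroup (hκ : 0 < κ) (hα : 0 < α) (hαθ : α < θ) (hθβ : θ < β)
    (hEA : ∀ t, 0 ≤ t → ∀ u, IsExpA κ θ t u (EA t u))
    (hEB : ∀ t, 0 ≤ t → ∀ u, EB t u =ᵐ[weightMeasure₂ α β lam]
        fun p => ∫ z, u (p.1, p.2 - drift κ θ t p.1 z) ∂gauss) :
    ∃ S₁ : ℝ → H2IR α β lam →L[ℂ] H2IR α β lam,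
      (∀ t, 0 ≤ t → ∀ U : H2IR α β lam, (S₁ t U).incl = EB t (EA t U.incl)) ∧
      IsC0Semigroup S₁ := by
  have hC := isC0Semigroup_expFamilyB_expA hκ hα hαθ hθβ hEA hEB
  obtain ⟨M, hM1, hM⟩ := exists_drift_bound hκ hα hαθ hθβ
  have hM0 : 0 ≤ M := by linarith
  have hops : ∀ t, ∃ T₁ T₁₁ T₂, 0 < t → IsJetOperators κ θ t ((EB t).comp (EA t)) T₁ T₁₁ T₂ := by
    intro t
    by_cases ht : 0 < t
    · obtain ⟨T₁, T₁₁, T₂, hJ⟩ := exists_isJetOperators lam hκ hαθ hθβ ht (hM t ht)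
        (S := (EB t).comp (EA t)) (expFamilyB_expA hκ hα hαθ hθβ hEA hEB ht.le)
      exact ⟨T₁, T₁₁, T₂, fun _ => hJ⟩
    · exact ⟨0, 0, 0, fun h => absurd h ht⟩
  choose T₁ T₁₁ T₂ hJ using hops
  have hS₁ : ∀ t, ∃ S₁ : H2IR α β lam →L[ℂ] H2IR α β lam,
      (t ≤ 0 → S₁ = ContinuousLinearMap.id ℂ _) ∧ (0 < t → ∀ U a,
      (S₁ U : PiLp 2 fun _ : Idx => L2IR α β lam) a = Idx.family (EB t (EA t (U.pd 0 0)))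
        ((Real.exp (-κ * t) : ℂ) • EB t (EA t (U.pd 1 0)) + T₁ t (U.pd 0 1))
        (EB t (EA t (U.pd 0 1)))
        ((Real.exp (-κ * t) : ℂ) • ((Real.exp (-κ * t) : ℂ) • EB t (EA t (U.pd 2 0)) +
          T₁ t (U.pd 1 1)) + ((Real.exp (-κ * t) : ℂ) • T₁ t (U.pd 1 1) +
            T₁₁ t (U.pd 0 2) + T₂ t (U.pd 0 1)))
        ((Real.exp (-κ * t) : ℂ) • EB t (EA t (U.pd 1 1)) + T₁ t (U.pd 0 2))
        (EB t (EA t (U.pd 0 2))) a) := by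
    intro t
    rcases le_or_gt t 0 with ht | ht
    · exact ⟨_, fun _ => rfl, fun h => absurd h ht.not_gt⟩
    · obtain ⟨S₁, hS₁⟩ := (hJ t ht).exists_restriction hκ hα hαθ hθβ ht
      exact ⟨S₁, fun h => absurd ht h.not_gt, fun _ => hS₁⟩
  -- the value for `t < 0` is irrelevant, and `drift` is differentiable in `σ` only for `t > 0`
  choose S₁ hid hS₁ using hS₁
  have hincl : ∀ t, 0 ≤ t → ∀ U : H2IR α β lam, (S₁ t U).incl = EB t (EA t U.incl) := by
    intro t ht U
    rcases ht.eq_or_lt with rfl | ht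
    · rw [hid 0 le_rfl]
      exact (DFunLike.congr_fun hC.map_zero U.incl).symm
    · exact hS₁ t ht U ⟨(0, 0), by decide⟩
  refine ⟨S₁, hincl, ?_, hid 0 le_rfl, fun U => tendsto_H2IR ?_⟩
  · intro s t hs ht
    refine ContinuousLinearMap.ext fun U => incl_injective ?_
    rw [hincl _ (add_nonneg hs ht), ContinuousLinearMap.comp_apply, hincl s hs, hincl t ht]
    exact DFunLike.congr_fun (hC.map_add s t hs ht) U.incl
  have hb : ∀ t ∈ Set.Ioo (0 : ℝ) 1, ∀ z a : ℝ, a ≤ M * (t + Real.sqrt t) * (1 + |z|) →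
      a ≤ M * 2 * (1 + |z|) := by
    intro t ht z a ha
    refine ha.trans ?_
    gcongr
    exact add_sqrt_le_two ht.2.le
  have h0 : ∀ z : ℝ, Tendsto (fun t => M * (t + Real.sqrt t) * (1 + |z|)) (𝓝[>] 0) (𝓝 0) := by
    intro z
    simpa using (tendsto_add_sqrt.const_mul M).mul_const (1 + |z|)
  have hzero : ∀ (z : ℝ) (f : ℝ → ℝ), (∀ t, 0 < t → |f t| ≤ M * (t + Real.sqrt t) * (1 + |z|)) →
      Tendsto f (𝓝[>] 0) (𝓝 0) := by
    intro z f hf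
    refine squeeze_zero_norm' ?_ (h0 z)
    filter_upwards [self_mem_nhdsWithin] with t ht using hf t ht
  have lS : ∀ f, Tendsto (fun t => EB t (EA t f)) (𝓝[>] 0) (𝓝 f) := hC.tendsto
  -- the operators with a coefficient `drift₁`, `drift₁²` or `drift₂` tend strongly to zero
  have l1 : ∀ f, Tendsto (fun t => T₁ t f) (𝓝[>] 0) (𝓝 0) := by
    intro f
    have := tendsto_drift_average (lam := lam) (f := f) (F := fun t => T₁ t f) hκ hαθ hθβ hM1
      (fun t ht σ hσ z => (hM t ht σ hσ z).1) (ρ := fun t p z => -drift₁ κ θ t p.1 z) (c := 0)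
      (by simp) (measurable_neg_drift₁ κ θ)
      (fun t ht p hp z => by
        rw [abs_neg]; exact le_exp_two_mul (hb t ht z _ (hM t ht.1 _ hp z).2.1))
      (fun p hp z => by
        simpa using (hzero z _ fun t ht => (hM t ht _ hp z).2.1).neg)
      (by filter_upwards [self_mem_nhdsWithin] with t ht using (hJ t ht).one f)
    rwa [zero_smul] at this
  have l11 : ∀ f, Tendsto (fun t => T₁₁ t f) (𝓝[>] 0) (𝓝 0) := by
    intro f
    have := tendsto_drift_average (lam := lam) (f := f) (F := fun t => T₁₁ t f) hκ hαθ hθβ hM1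
      (fun t ht σ hσ z => (hM t ht σ hσ z).1) (ρ := fun t p z => drift₁ κ θ t p.1 z ^ 2) (c := 0)
      (by simp) (measurable_drift₁_sq κ θ)
      (fun t ht p hp z => by
        rw [abs_of_nonneg (sq_nonneg _)]
        exact sq_le_exp_two_mul (hb t ht z _ (hM t ht.1 _ hp z).2.1))
      (fun p hp z => by
        simpa using (hzero z _ fun t ht => (hM t ht _ hp z).2.1).pow 2)
      (by filter_upwards [self_mem_nhdsWithin] with t ht using (hJ t ht).one_one f)
    rwa [zero_smul] at this
  have l2 : ∀ f, Tendsto (fun t => T₂ t f) (𝓝[>] 0) (𝓝 0) := by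
    intro f
    have := tendsto_drift_average (lam := lam) (f := f) (F := fun t => T₂ t f) hκ hαθ hθβ hM1
      (fun t ht σ hσ z => (hM t ht σ hσ z).1) (ρ := fun t p z => -drift₂ κ θ t p.1 z) (c := 0)
      (by simp) (measurable_neg_drift₂ κ θ)
      (fun t ht p hp z => by
        rw [abs_neg]; exact le_exp_two_mul (hb t ht z _ (hM t ht.1 _ hp z).2.2))
      (fun p hp z => by
        simpa using (hzero z _ fun t ht => (hM t ht _ hp z).2.2).neg)
      (by filter_upwards [self_mem_nhdsWithin] with t ht using (hJ t ht).two f)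
    rwa [zero_smul] at this
  have lm : Tendsto (fun t => (Real.exp (-κ * t) : ℂ)) (𝓝[>] 0) (𝓝 1) := by
    have := (Complex.continuous_ofReal.tendsto 1).comp (tendsto_exp_neg_mul κ)
    rw [Complex.ofReal_one] at this
    exact this
  have key : ∀ a : Idx, ∀ {G : ℝ → L2IR α β lam},
      (∀ t, 0 < t → (S₁ t U : PiLp 2 fun _ : Idx => L2IR α β lam) a = G t) →
      Tendsto G (𝓝[>] 0) (𝓝 ((U : PiLp 2 fun _ : Idx => L2IR α β lam) a)) →
      Tendsto (fun t => (S₁ t U : PiLp 2 fun _ : Idx => L2IR α β lam) a) (𝓝[>] 0)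
        (𝓝 ((U : PiLp 2 fun _ : Idx => L2IR α β lam) a)) := by
    intro a G hG h
    refine h.congr' ?_
    filter_upwards [self_mem_nhdsWithin] with t ht using (hG t ht).symm
  intro a
  induction a using Idx.forall
  · exact key _ (fun t ht => hS₁ t ht U _) (lS _)
  · refine key _ (fun t ht => hS₁ t ht U _) ?_
    have h := (lm.smul (lS (U.pd 1 0))).add (l1 (U.pd 0 1))
    simp only [one_smul, add_zero] at h
    exact h
  · exact key _ (fun t ht => hS₁ t ht U _) (lS _)
  · refine key _ (fun t ht => hS₁ t ht U _) ?_
    have h := (lm.smul ((lm.smul (lS (U.pd 2 0))).add (l1 (U.pd 1 1)))).add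
      (((lm.smul (l1 (U.pd 1 1))).add (l11 (U.pd 0 2))).add (l2 (U.pd 0 1)))
    simp only [one_smul, add_zero, smul_zero] at h
    exact h
  · refine key _ (fun t ht => hS₁ t ht U _) ?_
    have h := (lm.smul (lS (U.pd 1 1))).add (l1 (U.pd 0 2))
    simp only [one_smul, add_zero] at h
    exact h
  · exact key _ (fun t ht => hS₁ t ht U _) (lS _)

end Restriction

end LambdaSABR

open LambdaSABR in
theorem theorem4p9 (κ θ α β lam : ℝ) (hκ : 0 < κ) (hα : 0 < α) (hαθ : α < θ) (hθβ : θ < β) :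
    -- the semigroup `e^{sB}` on `L²_lam(ℝ)`
    ∃ E : ℝ → L2R lam →L[ℂ] L2R lam, IsExpB E ∧
    -- the bounded operators `e^{tA}` and `e^{𝔇(t)B}` on `L²_lam(I × ℝ)`
    ∃ EA EB : ℝ → L2IR α β lam →L[ℂ] L2IR α β lam,
      (∀ t : ℝ, 0 ≤ t → ∀ u, IsExpA κ θ t u (EA t u)) ∧
      (∀ t : ℝ, 0 ≤ t → ∀ u, IsExpFamilyB E (fun σ => frakD κ θ t σ) u (EB t u)) ∧
      -- `S(t) = e^{𝔇(t)B} e^{tA}` is a `c₀` semigroup on `L²_lam(I × ℝ)`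
      IsC0Semigroup (fun t => (EB t).comp (EA t)) ∧
      -- its generator is defined on `K₁` and coincides there with `L₀`
      (∀ U : H2IR α β lam, ∃ v : L2IR α β lam, L0MapsTo κ θ U v ∧
        GeneratorMapsTo (fun t => (EB t).comp (EA t)) U.incl v) ∧
      -- `S(t)` restricts to a `c₀` semigroup on `K₁`
      ∃ S₁ : ℝ → H2IR α β lam →L[ℂ] H2IR α β lam,
        (∀ t : ℝ, 0 ≤ t → ∀ U : H2IR α β lam, (S₁ t U).incl = EB t (EA t U.incl)) ∧
        IsC0Semigroup S₁ := by
  obtain ⟨E, hE⟩ := exists_gaussian_translation lam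
  obtain ⟨EA, hEA⟩ := exists_expA (α := α) (β := β) (θ := θ) lam hκ hαθ hθβ
  obtain ⟨EB, hEB⟩ := exists_expFamilyB lam hκ hα hαθ hθβ
  exact ⟨E, isExpB_gaussian_translation hE, EA, EB, hEA,
    fun t ht u => isExpFamilyB_of_average hκ hα hαθ hθβ hE ht (hEB t ht u),
    isC0Semigroup_expFamilyB_expA hκ hα hαθ hθβ hEA hEB,
    exists_generatorMapsTo hκ hα hαθ hθβ hEA hEB,
    exists_restriction_isC0Semigroup hκ hα hαθ hθβ hEA hEB⟩
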